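/- Notation. Let $\Lambda$ be the ring of symmetric functions in $x_1,x_2,\dots$ over $\mathbb{C}$, with power sums $p_k$, complete homogeneous functions $h_k$ and elementary functions $e_k$. For a class function $f$ on $S_n$ let $\mathrm{ch}(f)=\frac1{n!}\sum_{w\in S_n} f(w)\,p_{\lambda(w)}$, where $\lambda(w)$ is the cycle type of $w$, be its Frobenius characteristic; $\mathrm{ch}$ is injective on class functions. For a partition $\mu$ of $n$, $\chi^\mu$ is the irreducible character of $S_n$ with $\mathrm{ch}(\chi^\mu)=s_\mu=\det(h_{\mu_i-i+j})$. Plethysm is denoted $f[g]$. For $j\ge 1$ let $\mathrm{Lie}_{(j)}$ be the character of $S_j$ induced from a linear character of the subgroup generated by a $j$-cycle $c$ that sends $c$ to a primitive $j$-th root of unity. Put $\ell_j=\mathrm{ch}(\mathrm{Lie}_{(j)})$ and $\pi_j=\mathrm{ch}(\epsilon_{S_j}\otimes \mathrm{Lie}_{(j)})$, where $\epsilon_{S_j}$ is the sign character. For a partition $\lambda=1^{m_1}2^{m_2}\cdots$ of $n$ let $\mathrm{Lie}_\lambda$ and $\mathrm{W}_\lambda$ be the characters of $S_n$ with $$\mathrm{ch}(\mathrm{Lie}_\lambda)=\prod_{j\ge1}h_{m_j}[\ell_j],\qquad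 \mathrm{ch}(\mathrm{W}_\lambda)=\prod_{j \text{ odd}}h_{m_j}[\pi_j]\prod_{j\text{ even}}e_{m_j}[\pi_j].$$ Let $\widehat{\mathrm{Lie}}^i_n=\sum_\lambda \mathrm{Lie}_\lambda$ and $\widehat{\mathrm{W}}^i_n=\sum_\lambda \mathrm{W}_\lambda$, both sums over the partitions $\lambda$ of $n$ with no part equal to $1$ and with rank $\sum_k(\lambda_k-1)=i$, and let $\widehat{\mathrm{Lie}}_n=\sum_{i\ge 0}\widehat{\mathrm{Lie}}^i_n$ and $\widehat{\mathrm{W}}_n=\sum_{i\ge 0}\widehat{\mathrm{W}}^i_n$. Let $Q$ be a standard Young tableau of size $n$, drawn with rows going down. Call $i$ an ascent of $Q$ if $i=n$, or if $1\le i<n$ and $i+1$ lies in a weakly higher row than $i$. $Q$ is a desarrangement tableau if its smallest ascent is even (so the empty tableau is one). $Q$ is Whitney-generating if either it is one of the three tableaux $\varnothing$, $12$, $12/3$ (rows separated by slashes), or $n\ge 4$ and its restriction to the entries $1,2,3,4$ is * $12/3/4$ or $124/3$; or * $12/34$, and the smallest ascent $k\ge 4$ of $Q$ is odd; or * $123/4$,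 and the smallest ascent $k\ge 4$ of $Q$ is even. **Theorem.** For every $n\ge 0$ one has the irreducible decompositions $$\widehat{\mathrm{Lie}}_n=\sum_Q\chi^{\mathrm{shape}(Q)},\qquad \widehat{\mathrm{W}}_n=\sum_Q\chi^{\mathrm{shape}(Q)},$$ where the first sum is over all desarrangement tableaux $Q$ of size $n$ and the second over all Whitney-generating tableaux $Q$ of size $n$. -/

import Mathlib

noncomputable section

namespace WhitneyTableaux

/-! ### Symmetric functions, as formal power series in `x_0, x_1, x_2, …` over `ℂ` -/

/-- The ring of formal power series in countably many variables, in which the symmetric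
functions live. -/
abbrev Series : Type := MvPowerSeries ℕ ℂ

open Classical in
/-- The power sum `p_k = ∑ i, x_i ^ k` (used for `k ≥ 1`). -/
def psum (k : ℕ) : Series := fun d => if ∃ i, d = Finsupp.single i k then 1 else 0

/-- The complete homogeneous symmetric function `h_r`, the sum of all monomials of degree `r`;
it is indexed by an integer, with `h_r = 0` for `r < 0`. -/
def hsymm (r : ℤ) : Series := fun d => if (d.degree : ℤ) = r then 1 else 0

open Classical in
/-- The elementary symmetric function `e_r`, the sum of all squarefree monomials of degree `r`. -/
def esymm (r : ℕ) : Series := fun d => if d.degree = r ∧ ∀ i, d i ≤ 1 then 1 else 0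

/-- The Schur function of the partition whose Ferrers diagram is `μ`, by the Jacobi-Trudi
determinant `det (h_{μ_i - i + j})`, whose size is the number of rows of `μ`. -/
def schur (μ : YoungDiagram) : Series :=
  Matrix.det (Matrix.of fun i j : Fin (μ.colLen 0) =>
    hsymm ((μ.rowLen i : ℤ) - (i : ℤ) + (j : ℤ)))

open Classical in
/-- The plethysm `f[g]`. The functions `p_1, p_2, …` are algebraically independent generators of
the algebra of symmetric functions over `ℂ`, so that a symmetric function `f` is
`F(p_1, p_2, …)` for a unique polynomial `F` (whose variable number `k` stands for `p_{k+1}`).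
The plethysm by `g` is the algebra homomorphism in `f` that sends `p_k` to
`p_k[g] = g(x_0 ^ k, x_1 ^ k, …)`, that is, it replaces the variables of `f` by the
monomials of `g`. (The value is `0` when `f` is not a symmetric function.) -/
def plethysm (f g : Series) : Series :=
  if h : ∃ F : MvPolynomial ℕ ℂ, MvPolynomial.aeval (fun k : ℕ => psum (k + 1)) F = f then
    MvPolynomial.aeval
      (fun k : ℕ => MvPowerSeries.expand (k + 1) (Nat.succ_ne_zero k) g) h.choose
  else 0

/-! ### Characters of finite groups and the Frobenius characteristic -/

/-- `f` is constant on conjugacy classes. -/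
def IsClassFunction {G : Type} [Group G] (f : G → ℂ) : Prop :=
  ∀ g h : G, f (h * g * h⁻¹) = f g

/-- `χ` is the character of an irreducible finite-dimensional complex representation of `G`. -/
def IsIrreducibleCharacter {G : Type} [Group G] (χ : G → ℂ) : Prop :=
  ∃ (d : ℕ) (ρ : Representation ℂ G (Fin d → ℂ)), ρ.IsIrreducible ∧ ρ.character = χ

open Classical in
/-- The induced character `ψ ↑_H^G`, namely
`g ↦ |H|⁻¹ ∑_{x ∈ G, x⁻¹ g x ∈ H} ψ (x⁻¹ g x)`. -/
def inducedCharacter {G : Type} [Group G] [Fintype G] (H : Subgroup G) (ψ : H → ℂ) (g : G) : ℂ :=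
  (Nat.card H : ℂ)⁻¹ * ∑ x : G, if h : x⁻¹ * g * x ∈ H then ψ ⟨x⁻¹ * g * x, h⟩ else 0

/-- The Frobenius characteristic `ch f = (n!)⁻¹ ∑_{w ∈ S_n} f(w) p_{λ(w)}`, where `λ(w)` is the
cycle type of `w`, fixed points included. -/
def ch (n : ℕ) (f : Equiv.Perm (Fin n) → ℂ) : Series :=
  ((n.factorial : ℂ)⁻¹) • ∑ w, f w • (w.partition.parts.map psum).prod

open Classical in
/-- The class function on `S_n` with Frobenius characteristic `F` (`ch` is injective on class
functions, and onto the symmetric functions over `ℂ` that are homogeneous of degree `n`;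
the value is `0` for other `F`). -/
def classFunctionOf (n : ℕ) (F : Series) : Equiv.Perm (Fin n) → ℂ :=
  if h : ∃ f : Equiv.Perm (Fin n) → ℂ, IsClassFunction f ∧ ch n f = F then h.choose else 0

open Classical in
/-- The irreducible character `χ^μ` of `S_n`, for a partition `μ` of `n`: the one whose Frobenius
characteristic is the Schur function of `μ`. (The value is `0` if `μ` is not of size `n`.) -/
def irreducibleCharacter (n : ℕ) (μ : YoungDiagram) : Equiv.Perm (Fin n) → ℂ :=
  if h : ∃ χ : Equiv.Perm (Fin n) → ℂ, IsIrreducibleCharacter χ ∧ ch n χ = schur μ then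
    h.choose
  else 0

/-! ### The characters `Lie_λ` and `W_λ` -/

/-- The complex number `exp(2πi/n)`, a primitive `n`-th root of unity for `n ≥ 1`. -/
def rootOfUnity (n : ℕ) : ℂˣ :=
  Units.mk0 (Complex.exp (2 * Real.pi * Complex.I / n)) (Complex.exp_ne_zero _)

/-- The cyclic subgroup `C_n` of `S_n` generated by the `n`-cycle `finRotate n`. -/
def cyclicSubgroup (n : ℕ) : Subgroup (Equiv.Perm (Fin n)) := Subgroup.zpowers (finRotate n)

/-- The chosen `n`-cycle, as an element of `C_n`. -/
def cyclicGenerator (n : ℕ) : cyclicSubgroup n := ⟨finRotate n, Subgroup.mem_zpowers _⟩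

theorem mem_zpowers_cyclicGenerator (n : ℕ) (x : cyclicSubgroup n) :
    x ∈ Subgroup.zpowers (cyclicGenerator n) := by
  obtain ⟨x, k, hk⟩ := x
  exact ⟨k, Subtype.ext hk⟩

theorem orderOf_rootOfUnity_dvd (n : ℕ) :
    orderOf (rootOfUnity n) ∣ orderOf (cyclicGenerator n) := by
  have h1 : orderOf (cyclicGenerator n) = orderOf (finRotate n) :=
    (Subgroup.orderOf_coe (cyclicGenerator n)).symm
  rw [h1]
  match n with
  | 0 =>
    have : rootOfUnity 0 = 1 := by ext; simp [rootOfUnity]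
    simp [this]
  | 1 =>
    have : rootOfUnity 1 = 1 := by ext; simp [rootOfUnity]
    simp [this]
  | n + 2 =>
    rw [isCycle_finRotate.orderOf, support_finRotate, Finset.card_univ, Fintype.card_fin]
    apply orderOf_dvd_of_pow_eq_one
    ext
    have h := (Complex.isPrimitiveRoot_exp (n + 2) (by omega)).pow_eq_one
    simpa [rootOfUnity] using h

/-- The linear character of `C_n` that sends the `n`-cycle to a primitive `n`-th root of unity. -/
def cyclicCharacter (n : ℕ) : cyclicSubgroup n →* ℂˣ :=
  monoidHomOfForallMemZpowers (mem_zpowers_cyclicGenerator n) (orderOf_rootOfUnity_dvd n)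

/-- The Lie character `Lie_(n)`, induced from the above linear character of `C_n`. -/
def lieCharacter (n : ℕ) : Equiv.Perm (Fin n) → ℂ :=
  inducedCharacter (cyclicSubgroup n) fun x => (cyclicCharacter n x : ℂ)

/-- `ℓ_n = ch(Lie_(n))`. -/
def ell (n : ℕ) : Series := ch n (lieCharacter n)

/-- `π_n = ch(ε ⊗ Lie_(n))`, where `ε` is the sign character. -/
def piSymm (n : ℕ) : Series :=
  ch n fun w => ((Equiv.Perm.sign w : ℤ) : ℂ) * lieCharacter n w

/-- The higher Lie character `Lie_λ` of `S_n`: its Frobenius characteristic is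
`∏_j h_{m_j}[ℓ_j]`, where `m_j` is the multiplicity of `j` in `λ`. -/
def lieChar {n : ℕ} (l : n.Partition) : Equiv.Perm (Fin n) → ℂ :=
  classFunctionOf n (∏ j ∈ Finset.Icc 1 n, plethysm (hsymm (l.parts.count j)) (ell j))

/-- The Whitney homology character `W_λ` of `S_n`: its Frobenius characteristic is
`∏_{j odd} h_{m_j}[π_j] ∏_{j even} e_{m_j}[π_j]`, where `m_j` is the multiplicity of `j`
in `λ`. -/
def whitneyChar {n : ℕ} (l : n.Partition) : Equiv.Perm (Fin n) → ℂ :=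
  classFunctionOf n
    ((∏ j ∈ (Finset.Icc 1 n).filter Odd, plethysm (hsymm (l.parts.count j)) (piSymm j)) *
      ∏ j ∈ (Finset.Icc 1 n).filter Even, plethysm (esymm (l.parts.count j)) (piSymm j))

/-- The rank `∑_k (λ_k - 1)` of a partition. -/
def rank {n : ℕ} (l : n.Partition) : ℕ := (l.parts.map fun k => k - 1).sum

/-- The partitions of `n` without parts of size `1` and of rank `i`. -/
def hatPartitions (i n : ℕ) : Finset n.Partition :=
  Finset.univ.filter fun l => 1 ∉ l.parts ∧ rank l = i

/-- The character `\widehat{Lie}^i_n`. -/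
def lieHatGraded (i n : ℕ) : Equiv.Perm (Fin n) → ℂ := ∑ l ∈ hatPartitions i n, lieChar l

/-- The character `\widehat{W}^i_n`. -/
def whitneyHatGraded (i n : ℕ) : Equiv.Perm (Fin n) → ℂ :=
  ∑ l ∈ hatPartitions i n, whitneyChar l

/-- The character `\widehat{Lie}_n = ∑_i \widehat{Lie}^i_n` (the rank of a partition of `n` is at
most `n`). -/
def lieHat (n : ℕ) : Equiv.Perm (Fin n) → ℂ := ∑ i ∈ Finset.range (n + 1), lieHatGraded i n

/-- The character `\widehat{W}_n = ∑_i \widehat{W}^i_n`. -/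
def whitneyHat (n : ℕ) : Equiv.Perm (Fin n) → ℂ :=
  ∑ i ∈ Finset.range (n + 1), whitneyHatGraded i n

/-! ### Standard Young tableaux -/

/-- Standard Young tableaux of size `n`: the entry in row `i` and column `j` (both counted from
`0`, rows downwards) is `entry i j`, which is `0` outside the shape. -/
@[ext]
structure StandardTableau (n : ℕ) where
  shape : YoungDiagram
  entry : ℕ → ℕ → ℕ
  bijOn : Set.BijOn (fun c : ℕ × ℕ => entry c.1 c.2) (shape.cells : Set (ℕ × ℕ)) (Set.Icc 1 n)
  row_strict : ∀ i j₁ j₂ : ℕ, j₁ < j₂ → (i, j₂) ∈ shape → entry i j₁ < entry i j₂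
  col_strict : ∀ i₁ i₂ j : ℕ, i₁ < i₂ → (i₂, j) ∈ shape → entry i₁ j < entry i₂ j
  zeros : ∀ i j : ℕ, (i, j) ∉ shape → entry i j = 0

namespace StandardTableau

variable {n : ℕ}

theorem entry_mem (Q : StandardTableau n) {i j : ℕ} (h : (i, j) ∈ Q.shape) :
    1 ≤ Q.entry i j ∧ Q.entry i j ≤ n :=
  Q.bijOn.mapsTo (x := (i, j)) h

theorem row_lt_entry (Q : StandardTableau n) (i j : ℕ) (h : (i, j) ∈ Q.shape) :
    i < Q.entry i j := by
  induction i with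
  | zero => exact (Q.entry_mem h).1
  | succ i ih =>
    have h1 := ih (Q.shape.up_left_mem (Nat.le_succ i) le_rfl h)
    have h2 := Q.col_strict i (i + 1) j (Nat.lt_succ_self i) h
    omega

theorem col_lt_entry (Q : StandardTableau n) (i j : ℕ) (h : (i, j) ∈ Q.shape) :
    j < Q.entry i j := by
  induction j with
  | zero => exact (Q.entry_mem h).1
  | succ j ih =>
    have h1 := ih (Q.shape.up_left_mem le_rfl (Nat.le_succ j) h)
    have h2 := Q.row_strict i j (j + 1) (Nat.lt_succ_self j) h
    omega

theorem entry_le (Q : StandardTableau n) (i j : ℕ) : Q.entry i j ≤ n := by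
  by_cases h : (i, j) ∈ Q.shape
  · exact (Q.entry_mem h).2
  · simp [Q.zeros i j h]

theorem mem_shape_iff (Q : StandardTableau n) (i j : ℕ) :
    (i, j) ∈ Q.shape ↔ Q.entry i j ≠ 0 := by
  refine ⟨fun h => ?_, fun h => ?_⟩
  · have := (Q.entry_mem h).1
    omega
  · by_contra h'
    exact h (Q.zeros i j h')

/-- There are finitely many standard Young tableaux of size `n`. -/
instance : Finite (StandardTableau n) := by
  refine Finite.of_injective
    (fun Q : StandardTableau n => fun c : Fin n × Fin n =>
      (⟨Q.entry c.1 c.2, Nat.lt_succ_of_le (Q.entry_le _ _)⟩ : Fin (n + 1))) ?_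
  intro Q R hQR
  have he : Q.entry = R.entry := by
    funext i j
    by_cases hb : i < n ∧ j < n
    · have := congrFun hQR (⟨i, hb.1⟩, ⟨j, hb.2⟩)
      simpa using this
    · have key : ∀ S : StandardTableau n, S.entry i j = 0 := by
        intro S
        refine S.zeros i j fun h => hb ⟨?_, ?_⟩
        · exact (S.row_lt_entry i j h).trans_le (S.entry_mem h).2
        · exact (S.col_lt_entry i j h).trans_le (S.entry_mem h).2
      rw [key Q, key R]
  have hs : Q.shape = R.shape := by
    refine SetLike.ext fun c => ?_
    obtain ⟨i, j⟩ := c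
    rw [Q.mem_shape_iff, R.mem_shape_iff, he]
  exact StandardTableau.ext hs he

/-- `k` is an ascent of `Q` if `k = n`, or if `k + 1` lies in a weakly higher row than `k`. -/
def IsAscent (Q : StandardTableau n) (k : ℕ) : Prop :=
  k = n ∨ ∃ i j i' j' : ℕ, (i, j) ∈ Q.shape ∧ (i', j') ∈ Q.shape ∧
    Q.entry i j = k ∧ Q.entry i' j' = k + 1 ∧ i' ≤ i

/-- The smallest ascent of `Q` that is at least `m` (it exists for `m ≤ n`, as `n` is an
ascent). -/
def firstAscentFrom (Q : StandardTableau n) (m : ℕ) : ℕ := sInf {k | m ≤ k ∧ Q.IsAscent k}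

/-- A desarrangement tableau is a standard tableau whose first ascent is even. -/
def IsDesarrangement (Q : StandardTableau n) : Prop := Even (Q.firstAscentFrom 0)

/-- Whitney-generating tableaux. The first three clauses are the ones of size at most `3`. The
last four describe those whose entries `1, 2, 3, 4` form, in this order, one of
the tableaux `12/3/4`, `124/3`, `12/34`, `123/4` (rows separated by slashes). -/
def IsWhitneyGenerating (Q : StandardTableau n) : Prop :=
  n = 0 ∨
  (n = 2 ∧ Q.entry 0 0 = 1 ∧ Q.entry 0 1 = 2) ∨
  (n = 3 ∧ Q.entry 0 0 = 1 ∧ Q.entry 0 1 = 2 ∧ Q.entry 1 0 = 3) ∨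
  (Q.entry 0 0 = 1 ∧ Q.entry 0 1 = 2 ∧ Q.entry 1 0 = 3 ∧ Q.entry 2 0 = 4) ∨
  (Q.entry 0 0 = 1 ∧ Q.entry 0 1 = 2 ∧ Q.entry 1 0 = 3 ∧ Q.entry 0 2 = 4) ∨
  ((Q.entry 0 0 = 1 ∧ Q.entry 0 1 = 2 ∧ Q.entry 1 0 = 3 ∧ Q.entry 1 1 = 4) ∧
    Odd (Q.firstAscentFrom 4)) ∨
  ((Q.entry 0 0 = 1 ∧ Q.entry 0 1 = 2 ∧ Q.entry 0 2 = 3 ∧ Q.entry 1 0 = 4) ∧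
    Even (Q.firstAscentFrom 4))

end StandardTableau

/-- The set of desarrangement tableaux of size `n`. -/
def desarrangementTableaux (n : ℕ) : Finset (StandardTableau n) :=
  (Set.toFinite {Q : StandardTableau n | Q.IsDesarrangement}).toFinset

/-- The set of Whitney-generating tableaux of size `n`. -/
def whitneyGeneratingTableaux (n : ℕ) : Finset (StandardTableau n) :=
  (Set.toFinite {Q : StandardTableau n | Q.IsWhitneyGenerating}).toFinset

end WhitneyTableaux

end

/-!
Since `ch` is injective, it suffices to compare Frobenius characteristics. Let `H(t) = ∑ h_n t ^ n`.
Logarithmic derivatives of the generating functions of the plethysms, together with the formula for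
`ℓ_j` and `π_j` as Möbius sums of powers of power sums, give `H(t) L(t) = 1 / (1 - p_1 t)` and
`H(t) W(t) = (1 + p_2 t ^ 2) / (1 - p_1 t)`, where `L` and `W` are the generating functions of the
characteristics of the two hat characters.

On the side of the tableaux, remove the largest entry. By the Pieri rule, multiplication by `h_1`
turns the sum of the Schur functions over the tableaux of size `n` with a given property into the
sum over their extensions. Removing the entry `n + 1` changes the first ascent only if this ascent
is at the very end, and there is just one such tableau with a given small initial part. This leads
to the recursions `D_{n+1} = h_1 D_n + (-1) ^ (n+1) e_{n+1}` and
`W_{n+2} = h_1 W_{n+1} + (-1) ^ n (e_{n+2} + p_2 e_n)`, which are the identities above multiplied by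
`1 / H(t) = ∑ (-1) ^ n e_n t ^ n`.

That `s_μ` is the characteristic of an irreducible character is proved as follows. The
Jacobi-Trudi determinant expands into characters of permutation representations on colourings, so
`s_μ` is the characteristic of a virtual character. It has norm `1` by the bialternant formula, and
its sign is determined by `p_1 ^ n = ∑_Q s_{shape Q}`, the sum being over all standard tableaux `Q`.
-/

noncomputable section

namespace WhitneyTableaux

section NewtonIdentities

open MvPowerSeries Finset

/-! ### Newton's identities -/

open Classical in
theorem coeff_psum (k : ℕ) (d : ℕ →₀ ℕ) :
    coeff d (psum k) = if ∃ i, d = Finsupp.single i k then 1 else 0 := rfl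

theorem coeff_hsymm (r : ℤ) (d : ℕ →₀ ℕ) :
    coeff d (hsymm r) = if (d.degree : ℤ) = r then 1 else 0 := rfl

open Classical in
theorem coeff_esymm (r : ℕ) (d : ℕ →₀ ℕ) :
    coeff d (esymm r) = if d.degree = r ∧ ∀ i, d i ≤ 1 then 1 else 0 := rfl

theorem coeff_psum_mul {k : ℕ} (hk : 0 < k) (F : Series) (d : ℕ →₀ ℕ) :
    coeff d (psum k * F) =
      ∑ i ∈ d.support, if k ≤ d i then coeff (d - Finsupp.single i k) F else 0 := by
  classical
  rw [coeff_mul, ← sum_filter]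
  simp_rw [coeff_psum, ite_mul, one_mul, zero_mul]
  rw [← sum_filter]
  refine (sum_bij (fun i _ => (Finsupp.single i k, d - Finsupp.single i k)) ?_ ?_ ?_ ?_).symm
  · intro i hi
    rw [mem_filter] at hi ⊢
    exact ⟨mem_antidiagonal.2 (add_tsub_cancel_of_le (Finsupp.single_le_iff.2 hi.2)), i, rfl⟩
  · intro i _ j _ h
    exact Finsupp.single_left_injective hk.ne' (congrArg Prod.fst h)
  · rintro ⟨a, b⟩ h
    obtain ⟨hab, i, rfl⟩ := mem_filter.1 h
    obtain rfl : Finsupp.single i k + b = d := mem_antidiagonal.1 hab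
    exact ⟨i, mem_filter.2 ⟨by simp [hk.ne'], by simp⟩, by simp⟩
  · exact fun i _ => rfl

theorem degree_sub_single {σ : Type*} {d : σ →₀ ℕ} {i : σ} {k : ℕ} (h : k ≤ d i) :
    (d - Finsupp.single i k).degree + k = d.degree := by
  conv_rhs => rw [← tsub_add_cancel_of_le (Finsupp.single_le_iff.2 h)]
  simp

/-- The degree `m` part of `∏ i, ∑ a, φ a * x_i ^ a`, for a sequence `φ` with `φ 0 = 1`; it is
`h_m` for `φ = 1`, and `e_m` if `φ` is the indicator function of `{0, 1}`. -/
def multiplicativeSeries (φ : ℕ → ℂ) (m : ℕ) : Series :=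
  fun d => if d.degree = m then d.prod fun _ => φ else 0

theorem coeff_multiplicativeSeries (φ : ℕ → ℂ) (m : ℕ) (d : ℕ →₀ ℕ) :
    coeff d (multiplicativeSeries φ m) = if d.degree = m then d.prod fun _ => φ else 0 := rfl

theorem hsymm_eq_multiplicativeSeries (m : ℕ) : hsymm m = multiplicativeSeries 1 m := by
  ext d
  rw [coeff_hsymm, coeff_multiplicativeSeries]
  simp [Finsupp.prod]

theorem esymm_eq_multiplicativeSeries (m : ℕ) :
    esymm m = multiplicativeSeries (fun a => if a ≤ 1 then 1 else 0) m := by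
  classical
  ext d
  rw [coeff_esymm, coeff_multiplicativeSeries, Finsupp.prod, prod_boole, ite_and]
  have hd : (∀ i, d i ≤ 1) ↔ ∀ i ∈ d.support, d i ≤ 1 :=
    ⟨fun h i _ => h i, fun h i => by
      by_cases hi : i ∈ d.support
      · exact h i hi
      · simp [Finsupp.notMem_support_iff.1 hi]⟩
  simp only [hd]

theorem multiplicativeSeries_zero (φ : ℕ → ℂ) : multiplicativeSeries φ 0 = 1 := by
  classical
  ext d
  rw [coeff_multiplicativeSeries, coeff_one]
  by_cases h : d = 0 <;> simp [h, Finsupp.degree_eq_zero_iff]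

theorem hsymm_zero : hsymm 0 = 1 :=
  (hsymm_eq_multiplicativeSeries 0).trans (multiplicativeSeries_zero _)

theorem esymm_zero : esymm 0 = 1 :=
  (esymm_eq_multiplicativeSeries 0).trans (multiplicativeSeries_zero _)

theorem hsymm_of_neg {r : ℤ} (h : r < 0) : hsymm r = 0 := by
  ext d
  rw [coeff_hsymm, if_neg (by lia), map_zero]

theorem coeff_sub_single_multiplicativeSeries {φ : ℕ → ℂ} (h0 : φ 0 = 1) {m k i : ℕ} (hkm : k ≤ m)
    {d : ℕ →₀ ℕ} (hk : k < d i) :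
    coeff (d - Finsupp.single i (k + 1)) (multiplicativeSeries φ (m - k)) =
      if d.degree = m + 1 then φ (d i - 1 - k) * ∏ j ∈ d.support.erase i, φ (d j) else 0 := by
  have hdeg := degree_sub_single (d := d) (i := i) (k := k + 1) hk
  have hprod : ((d - Finsupp.single i (k + 1)).prod fun _ => φ) =
      φ (d i - 1 - k) * ∏ j ∈ d.support.erase i, φ (d j) := by
    have hi : i ∈ d.support := Finsupp.mem_support_iff.2 (by lia)
    rw [Finsupp.prod_of_support_subset _ (Finsupp.support_mono tsub_le_self) _ fun _ _ => h0,
      ← mul_prod_erase _ _ hi]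
    refine congrArg₂ _ (by simp [Nat.sub_sub, add_comm]) (prod_congr rfl fun j hj => ?_)
    simp [Finsupp.single_eq_of_ne (ne_of_mem_erase hj)]
  rw [coeff_multiplicativeSeries, hprod]
  exact if_congr (by lia) rfl rfl

theorem multiplicativeSeries_newton {φ c : ℕ → ℂ} (h0 : φ 0 = 1)
    (hφ : ∀ a : ℕ, (a : ℂ) * φ a = ∑ k ∈ range a, c k * φ (a - 1 - k)) (m : ℕ) :
    ((m : ℂ) + 1) • multiplicativeSeries φ (m + 1) =
      ∑ k ∈ range (m + 1), c k • (psum (k + 1) * multiplicativeSeries φ (m - k)) := by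
  ext d
  have hcoeff : ∀ k ∈ range (m + 1), coeff d (c k • (psum (k + 1) * multiplicativeSeries φ (m - k)))
      = ∑ i ∈ d.support, if k < d i then c k * if d.degree = m + 1 then
          φ (d i - 1 - k) * ∏ j ∈ d.support.erase i, φ (d j) else 0 else 0 := by
    intro k hk
    rw [coeff_smul, coeff_psum_mul k.succ_pos, mul_sum]
    refine sum_congr rfl fun i _ => ?_
    simp only [mul_ite, mul_zero, Nat.succ_le_iff]
    split_ifs with hki hd <;> [skip; skip; rfl] <;>
      rw [coeff_sub_single_multiplicativeSeries h0 (mem_range_succ_iff.1 hk) hki] <;> simp [hd]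
  rw [map_sum, sum_congr rfl hcoeff, sum_comm, coeff_smul, coeff_multiplicativeSeries]
  split_ifs with hd
  · have hrow : ∀ i ∈ d.support, (∑ k ∈ range (m + 1), if k < d i then
        c k * (φ (d i - 1 - k) * ∏ j ∈ d.support.erase i, φ (d j)) else 0) =
          d i * d.prod fun _ => φ := by
      intro i hi
      have hle : d i ≤ m + 1 := hd ▸ Finsupp.le_degree i d
      have hfilter : (range (m + 1)).filter (· < d i) = range (d i) := by
        ext k
        simp only [mem_filter, mem_range]
        lia
      simp_rw [← sum_filter, hfilter, ← mul_assoc]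
      rw [← sum_mul, ← hφ, Finsupp.prod, ← mul_prod_erase _ _ hi, mul_assoc]
    rw [sum_congr rfl hrow, ← sum_mul, ← Nat.cast_sum, ← Finsupp.degree_apply, hd]
    push_cast
    rfl
  · simp

theorem hsymm_newton (m : ℕ) :
    ((m : ℂ) + 1) • hsymm (m + 1 : ℕ) =
      ∑ k ∈ range (m + 1), psum (k + 1) * hsymm (m - k : ℕ) := by
  simp_rw [hsymm_eq_multiplicativeSeries]
  simpa using multiplicativeSeries_newton (φ := 1) (c := 1) rfl (by simp) m

theorem esymm_newton (m : ℕ) :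
    ((m : ℂ) + 1) • esymm (m + 1) =
      ∑ k ∈ range (m + 1), ((-1 : ℂ) ^ k) • (psum (k + 1) * esymm (m - k)) := by
  simp_rw [esymm_eq_multiplicativeSeries]
  refine multiplicativeSeries_newton rfl (fun a => ?_) m
  match a with
  | 0 => simp
  | 1 => simp
  | a + 2 =>
    rw [sum_range_succ, sum_range_succ, sum_eq_zero fun k hk => ?_]
    · simp [pow_succ]
    · rw [if_neg (by have := mem_range.1 hk; lia), mul_zero]

/-- The expansion of the complete homogeneous (`ε = 1`) or elementary (`ε = -1`) symmetric
functions in power sums, where the variable number `k` stands for `p_{k+1}`. -/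
def newtonPoly (ε : ℂ) : ℕ → MvPolynomial ℕ ℂ
  | 0 => 1
  | m + 1 => ((m : ℂ) + 1)⁻¹ •
      ∑ k : Fin (m + 1), ε ^ (k : ℕ) • (MvPolynomial.X (k : ℕ) * newtonPoly ε (m - k))

theorem newtonPoly_succ (ε : ℂ) (m : ℕ) :
    ((m : ℂ) + 1) • newtonPoly ε (m + 1) =
      ∑ k ∈ range (m + 1), ε ^ k • (MvPolynomial.X k * newtonPoly ε (m - k)) := by
  rw [newtonPoly, smul_smul, mul_inv_cancel₀ (Nat.cast_add_one_ne_zero m), one_smul, sum_range]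

section

variable {R : Type*} [CommRing R] [Algebra ℂ R]

theorem aeval_newtonPoly_succ (q : ℕ → R) (ε : ℂ) (m : ℕ) :
    ((m : ℂ) + 1) • MvPolynomial.aeval q (newtonPoly ε (m + 1)) =
      ∑ k ∈ range (m + 1), ε ^ k • (q k * MvPolynomial.aeval q (newtonPoly ε (m - k))) := by
  rw [← map_smul, newtonPoly_succ]
  simp only [map_sum, map_smul, map_mul, MvPolynomial.aeval_X]

theorem aeval_newtonPoly_eq {q s : ℕ → R} {ε : ℂ} (h0 : s 0 = 1)
    (hs : ∀ m : ℕ, ((m : ℂ) + 1) • s (m + 1) = ∑ k ∈ range (m + 1), ε ^ k • (q k * s (m - k)))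
    (m : ℕ) : MvPolynomial.aeval q (newtonPoly ε m) = s m := by
  induction m using Nat.strong_induction_on with
  | _ m ih =>
    rcases m with _ | m
    · simp [newtonPoly, h0]
    · refine smul_right_injective R (Nat.cast_add_one_ne_zero (R := ℂ) m) ?_
      simp only [aeval_newtonPoly_succ, hs]
      exact sum_congr rfl fun k _ => by rw [ih _ (by lia)]

end

theorem aeval_psum_newtonPoly_one (m : ℕ) :
    MvPolynomial.aeval (fun k : ℕ => psum (k + 1)) (newtonPoly 1 m) = hsymm m :=
  aeval_newtonPoly_eq (s := fun m => hsymm m) hsymm_zero (by simpa using hsymm_newton) m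

theorem aeval_psum_newtonPoly_neg_one (m : ℕ) :
    MvPolynomial.aeval (fun k : ℕ => psum (k + 1)) (newtonPoly (-1) m) = esymm m :=
  aeval_newtonPoly_eq esymm_zero esymm_newton m

end NewtonIdentities

section Truncation

open MvPowerSeries Finset

/-! ### Restriction to finitely many variables -/

/-- Set the variables `x_M, x_{M+1}, …` to zero. -/
def truncVars (M : ℕ) : Series →ₐ[ℂ] MvPowerSeries (Fin M) ℂ := killCompl Fin.valEmbedding

theorem coeff_truncVars (M : ℕ) (F : Series) (d : Fin M →₀ ℕ) :
    coeff d (truncVars M F) = coeff (d.embDomain Fin.valEmbedding) F :=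
  coeff_killCompl _ _

theorem ext_truncVars {F G : Series} (h : ∀ M, truncVars M F = truncVars M G) : F = G := by
  classical
  ext d
  obtain ⟨M, hM⟩ : ∃ M, ∀ i ∈ d.support, i < M :=
    ⟨d.support.sup id + 1, fun i hi => Nat.lt_succ_of_le (le_sup (f := id) hi)⟩
  obtain ⟨d', rfl⟩ : ∃ d' : Fin M →₀ ℕ, d'.embDomain Fin.valEmbedding = d :=
    ⟨d.comapDomain Fin.valEmbedding Fin.valEmbedding.injective.injOn,
      Finsupp.embDomain_comapDomain fun i hi => ⟨⟨i, hM i hi⟩, rfl⟩⟩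
  rw [← coeff_truncVars, ← coeff_truncVars, h]

theorem embDomain_eq_single_iff {α β : Type*} (f : α ↪ β) {d : α →₀ ℕ} {b : β} {k : ℕ}
    (hk : k ≠ 0) :
    d.embDomain f = Finsupp.single b k ↔ ∃ a, f a = b ∧ d = Finsupp.single a k := by
  refine ⟨fun h => ?_, ?_⟩
  · have hb : b ∈ Set.range f := by
      by_contra hb
      have := Finsupp.embDomain_of_notMem_range f d b hb
      rw [h, Finsupp.single_eq_same] at this
      exact hk this
    obtain ⟨a, rfl⟩ := hb
    exact ⟨a, rfl, Finsupp.embDomain_injective f (h.trans (Finsupp.embDomain_single f a k).symm)⟩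
  · rintro ⟨a, rfl, rfl⟩
    exact Finsupp.embDomain_single f a k

theorem truncVars_psum (M : ℕ) {k : ℕ} (hk : k ≠ 0) :
    truncVars M (psum k) = ∑ i : Fin M, X i ^ k := by
  classical
  ext d
  rw [coeff_truncVars, coeff_psum, map_sum]
  simp_rw [coeff_X_pow, embDomain_eq_single_iff _ hk]
  by_cases h : ∃ j : Fin M, d = Finsupp.single j k
  · obtain ⟨j, rfl⟩ := h
    simp [Finsupp.single_left_inj hk]
  · push Not at h
    simp [h]

theorem degree_embDomain {α β : Type*} (f : α ↪ β) (d : α →₀ ℕ) :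
    (d.embDomain f).degree = d.degree := by
  simp [Finsupp.degree_apply, Finsupp.support_embDomain]

theorem coeff_truncVars_hsymm (M : ℕ) (r : ℤ) (d : Fin M →₀ ℕ) :
    coeff d (truncVars M (hsymm r)) = if (d.degree : ℤ) = r then 1 else 0 := by
  rw [coeff_truncVars, coeff_hsymm, degree_embDomain]

end Truncation

section PowerSumIndependence

open Finset

variable (K : Type*) [Field K] [CharZero K] (n : ℕ)

theorem mvPolynomial_esymm_mem_adjoin_psum {k : ℕ} (hk : k ≤ n) :
    MvPolynomial.esymm (Fin n) K k ∈
      Algebra.adjoin K (Set.range fun i : Fin n => MvPolynomial.psum (Fin n) K (i + 1)) := by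
  induction k using Nat.strong_induction_on with
  | _ k ih =>
    rcases k.eq_zero_or_pos with rfl | hpos
    · simp
    · have hk0 : (k : K) ≠ 0 := Nat.cast_ne_zero.2 hpos.ne'
      have hnewton := MvPolynomial.mul_esymm_eq_sum (Fin n) K k
      rw [← nsmul_eq_mul, ← Nat.cast_smul_eq_nsmul K, ← eq_inv_smul_iff₀ hk0] at hnewton
      rw [hnewton]
      refine Subalgebra.smul_mem _ (Subalgebra.mul_mem _ (pow_mem (neg_mem (one_mem _)) _) <|
        Subalgebra.sum_mem _ fun ⟨a, b⟩ hab => ?_) _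
      obtain ⟨hadd, hlt⟩ := mem_filter.1 hab
      have hadd : a + b = k := mem_antidiagonal.1 hadd
      refine mul_mem (mul_mem (pow_mem (neg_mem (one_mem _)) _) (ih a hlt (by lia)))
        (Algebra.subset_adjoin ⟨⟨b - 1, by lia⟩, ?_⟩)
      simp only [Nat.sub_add_cancel (show 1 ≤ b by lia)]

theorem isIntegral_X_adjoin_psum (i : Fin n) :
    IsIntegral
      (Algebra.adjoin K (Set.range fun i : Fin n => MvPolynomial.psum (Fin n) K (i + 1)))
      (MvPolynomial.X (R := K) i) := by
  set S := Algebra.adjoin K (Set.range fun i : Fin n => MvPolynomial.psum (Fin n) K (i + 1))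
  let e (j : Fin (n + 1)) : S := ⟨_, mvPolynomial_esymm_mem_adjoin_psum K n (Fin.is_le j)⟩
  let q : Polynomial S := ∑ j : Fin (n + 1), Polynomial.C (e j) * Polynomial.X ^ (n - j)
  have hq : q.map (algebraMap S _) =
      ∏ j : Fin n, (Polynomial.X + Polynomial.C (MvPolynomial.X (R := K) j)) := by
    rw [MvPolynomial.prod_C_add_X_eq_sum_esymm, Fintype.card_fin, sum_range]
    simp only [q, Polynomial.map_sum, Polynomial.map_mul, Polynomial.map_C, Polynomial.map_pow,
      Polynomial.map_X]
    rfl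
  refine IsIntegral.of_neg ⟨q, ?_, ?_⟩
  · refine Polynomial.monic_of_injective (f := algebraMap S _) Subtype.val_injective ?_
    exact hq ▸ Polynomial.monic_prod_of_monic _ _ fun j _ => Polynomial.monic_X_add_C _
  · rw [← Polynomial.eval_map, hq, Polynomial.eval_prod]
    exact prod_eq_zero (mem_univ i) (by simp)

theorem algebraicIndependent_mvPolynomial_psum :
    AlgebraicIndependent K fun i : Fin n => MvPolynomial.psum (Fin n) K (i + 1) := by
  have hint : Algebra.IsIntegral (Algebra.adjoin K
      (Set.range fun i : Fin n => MvPolynomial.psum (Fin n) K (i + 1)))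
      (MvPolynomial (Fin n) K) := by
    refine ⟨fun F => F.induction_on (fun a => ?_) (fun _ _ => .add) fun _ i hF =>
      hF.mul (isIntegral_X_adjoin_psum K n i)⟩
    exact isIntegral_algebraMap (x := algebraMap K _ a)
  have : Algebra.IsAlgebraic (Algebra.adjoin K
      (Set.range fun i : Fin n => MvPolynomial.psum (Fin n) K (i + 1)))
      (MvPolynomial (Fin n) K) := hint.isAlgebraic
  exact (Algebra.IsAlgebraic.isTranscendenceBasis_of_lift_le_trdeg_of_finite K _
    (by simp [MvPolynomial.trdeg_of_isDomain])).1

end PowerSumIndependence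

section Plethysm

open MvPowerSeries

theorem algebraicIndependent_psum : AlgebraicIndependent ℂ fun k : ℕ => psum (k + 1) := by
  have hfin (n : ℕ) : AlgebraicIndependent ℂ fun i : Fin n => psum (i + 1) := by
    refine .of_comp (truncVars n) ?_
    have hcoe := (algebraicIndependent_mvPolynomial_psum ℂ n).map'
      (f := MvPolynomial.coeToMvPowerSeries.algHom ℂ) (MvPolynomial.coe_injective _ _)
    suffices h : truncVars n ∘ (fun i : Fin n => psum (i + 1)) =
        MvPolynomial.coeToMvPowerSeries.algHom ℂ ∘ fun i : Fin n =>
          MvPolynomial.psum (Fin n) ℂ (i + 1) from h ▸ hcoe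
    ext1 i
    simp [truncVars_psum, MvPolynomial.psum, MvPolynomial.coeToMvPowerSeries.algHom_apply]
  refine algebraicIndependent_of_finite_type fun t ht => ?_
  obtain ⟨n, hn⟩ := ht.bddAbove
  exact (hfin (n + 1)).comp (fun i : t => ⟨i, Nat.lt_succ_of_le (hn i.2)⟩)
    fun i j hij => Subtype.ext (congrArg Fin.val hij)

theorem plethysm_aeval (F : MvPolynomial ℕ ℂ) (g : Series) :
    plethysm (MvPolynomial.aeval (fun k : ℕ => psum (k + 1)) F) g =
      MvPolynomial.aeval (fun k : ℕ => expand (k + 1) (Nat.succ_ne_zero k) g) F := by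
  have h : ∃ G : MvPolynomial ℕ ℂ, MvPolynomial.aeval (fun k : ℕ => psum (k + 1)) G =
      MvPolynomial.aeval (fun k : ℕ => psum (k + 1)) F := ⟨F, rfl⟩
  rw [plethysm, dif_pos h, algebraicIndependent_psum h.choose_spec]

theorem plethysm_hsymm (m : ℕ) (g : Series) :
    plethysm (hsymm m) g = MvPolynomial.aeval
      (fun k : ℕ => expand (k + 1) (Nat.succ_ne_zero k) g) (newtonPoly 1 m) := by
  rw [← aeval_psum_newtonPoly_one, plethysm_aeval]

theorem plethysm_esymm (m : ℕ) (g : Series) :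
    plethysm (esymm m) g = MvPolynomial.aeval
      (fun k : ℕ => expand (k + 1) (Nat.succ_ne_zero k) g) (newtonPoly (-1) m) := by
  rw [← aeval_psum_newtonPoly_neg_one, plethysm_aeval]

theorem coeff_expand_of_not_smul {σ R : Type*} [CommRing R] {k : ℕ} (hk : k ≠ 0)
    (F : MvPowerSeries σ R) {e : σ →₀ ℕ} (he : ∀ d : σ →₀ ℕ, e ≠ k • d) :
    coeff e (expand k hk F) = 0 := by
  obtain ⟨i, hi⟩ : ∃ i, ¬ k ∣ e i := by
    by_contra! hdvd
    exact he (e.mapRange (· / k) (Nat.zero_div k))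
      (Finsupp.ext fun i => by simp [Nat.mul_div_cancel' (hdvd i)])
  exact coeff_expand_of_not_dvd _ hk _ hi

theorem expand_psum {k : ℕ} (hk : k ≠ 0) (d : ℕ) : expand k hk (psum d) = psum (k * d) := by
  classical
  ext e
  have hsingle (i : ℕ) : Finsupp.single i (k * d) = k • Finsupp.single i d := by simp
  simp_rw [coeff_psum, hsingle]
  by_cases h : ∃ f : ℕ →₀ ℕ, e = k • f
  · obtain ⟨f, rfl⟩ := h
    simp_rw [coeff_expand_smul, coeff_psum, (smul_right_injective _ hk).eq_iff]
  · push Not at h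
    rw [coeff_expand_of_not_smul hk _ h, if_neg (not_exists.2 fun i => h _)]

end Plethysm

section LogarithmicDerivative

open Finset PowerSeries
open scoped PowerSeries.WithPiTopology

/-! ### Logarithmic derivatives of generating functions -/

variable {R : Type*} [CommRing R]

/-- The Euler operator `t d/dt` on power series. It turns a product into the sum of the logarithmic
derivatives of its factors, which is how the generating functions below are compared. -/
def eulerOp (R : Type*) [CommRing R] : Derivation R R⟦X⟧ R⟦X⟧ :=
  (X : R⟦X⟧) • derivative R

theorem coeff_eulerOp (f : R⟦X⟧) (n : ℕ) : coeff n (eulerOp R f) = n * coeff n f := by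
  change coeff n (X * derivative R f) = _
  cases n with
  | zero => simp
  | succ n => rw [coeff_succ_X_mul, coeff_derivative, Nat.cast_succ, mul_comm]

theorem eulerOp_mul {f g a b : R⟦X⟧} (hf : eulerOp R f = f * a) (hg : eulerOp R g = g * b) :
    eulerOp R (f * g) = f * g * (a + b) := by
  rw [Derivation.leibniz, hf, hg, smul_eq_mul, smul_eq_mul]; ring

theorem eulerOp_prod {ι : Type*} (s : Finset ι) (f g : ι → R⟦X⟧)
    (h : ∀ i ∈ s, eulerOp R (f i) = f i * g i) :
    eulerOp R (∏ i ∈ s, f i) = (∏ i ∈ s, f i) * ∑ i ∈ s, g i := by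
  classical
  induction s using Finset.induction_on with
  | empty => simp
  | insert i s hi ih =>
    rw [prod_insert hi, sum_insert hi]
    exact eulerOp_mul (h i (mem_insert_self _ _)) (ih fun j hj => h j (mem_insert_of_mem hj))

theorem eulerOp_eq_of_mul_eq_one {f g a : R⟦X⟧} (hfg : f * g = 1) (hf : eulerOp R f = f * a) :
    eulerOp R g = g * -a := by
  have hleibniz : f * eulerOp R g + g * eulerOp R f = 0 := by
    simpa [hfg] using ((eulerOp R).leibniz f g).symm
  linear_combination g * hleibniz - g * g * hf - (eulerOp R g + g * a) * hfg

theorem eulerOp_expand {j : ℕ} (hj : j ≠ 0) {f g : R⟦X⟧} (h : eulerOp R f = f * g) :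
    eulerOp R (expand j hj f) = expand j hj f * ((j : R) • expand j hj g) := by
  have hcomm : eulerOp R (expand j hj f) = (j : R) • expand j hj (eulerOp R f) := by
    ext n
    rw [coeff_eulerOp, coeff_smul, coeff_expand, coeff_expand]
    split_ifs with hd
    · obtain ⟨m, rfl⟩ := hd
      rw [coeff_eulerOp, Nat.mul_div_cancel_left _ (Nat.pos_of_ne_zero hj), smul_eq_mul,
        Nat.cast_mul, mul_assoc]
    · simp
  rw [hcomm, h, map_mul, mul_smul_comm]

theorem eq_of_eulerOp [Algebra ℚ R] {A B C : R⟦X⟧} (hA : eulerOp R A = A * C)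
    (hB : eulerOp R B = B * C) (hC : coeff 0 C = 0) (h0 : coeff 0 A = coeff 0 B) : A = B := by
  ext n
  induction n using Nat.strong_induction_on with
  | _ n ih =>
    obtain rfl | hn := eq_or_ne n 0
    · exact h0
    have hmul : (n : R) * coeff n A = n * coeff n B := by
      rw [← coeff_eulerOp, ← coeff_eulerOp, hA, hB, coeff_mul, coeff_mul]
      refine sum_congr rfl fun x hx => ?_
      obtain hx2 | hx2 := eq_or_ne x.2 0
      · rw [hx2, hC, mul_zero, mul_zero]
      · rw [ih x.1 (by have := mem_antidiagonal.1 hx; lia)]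
    have hunit : IsUnit (n : R) := by
      simpa using (Nat.cast_ne_zero.2 hn : (n : ℚ) ≠ 0).isUnit.map (algebraMap ℚ R)
    exact hunit.mul_left_cancel hmul

theorem continuous_eulerOp [TopologicalSpace R] [IsTopologicalRing R] :
    Continuous (eulerOp R) := by
  refine continuous_iff_continuousAt.2 fun f => (WithPiTopology.tendsto_iff_coeff_tendsto ..).2 ?_
  intro n
  simp only [coeff_eulerOp]
  exact ((WithPiTopology.continuous_coeff R n).const_mul _).continuousAt

theorem eulerOp_eq_of_hasProd [TopologicalSpace R] [IsTopologicalRing R] [T2Space R] {ι : Type*}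
    {f g : ι → R⟦X⟧} {A B : R⟦X⟧} (hf : HasProd f A) (hg : HasSum g B)
    (h : ∀ i, eulerOp R (f i) = f i * g i) : eulerOp R A = A * B := by
  refine tendsto_nhds_unique ((continuous_eulerOp.tendsto A).comp hf) ?_
  refine (Filter.Tendsto.mul hf hg).congr fun s => ?_
  exact (eulerOp_prod s f g fun i _ => h i).symm

/-! ### Generating functions over partitions -/

theorem one_add_tsum_smul_X_pow [TopologicalSpace R] [T2Space R] {c : ℕ → R} (hc : c 0 = 1) {j : ℕ}
    (hj : j ≠ 0) : 1 + ∑' m, c (m + 1) • (X : R⟦X⟧) ^ (j * (m + 1)) = expand j hj (mk c) := by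
  suffices h : HasSum (fun m => c (m + 1) • (X : R⟦X⟧) ^ (j * (m + 1)))
      (expand j hj (mk c) - 1) by rw [h.tsum_eq, add_sub_cancel]
  refine (WithPiTopology.hasSum_iff_hasSum_coeff R).2 fun n => ?_
  have hzero {m : ℕ} (hm : n ≠ j * (m + 1)) :
      coeff n (c (m + 1) • (X : R⟦X⟧) ^ (j * (m + 1))) = 0 := by
    rw [coeff_smul, coeff_X_pow, if_neg hm, smul_zero]
  by_cases hn : j ∣ n ∧ n ≠ 0
  · obtain ⟨⟨_ | m, rfl⟩, hn⟩ := hn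
    · exact absurd (mul_zero j) hn
    convert hasSum_single m fun m' hm' => hzero fun h => hm' ?_ using 1
    · simp [coeff_one, hj, coeff_expand_mul]
    · simpa [hj] using h.symm
  · convert hasSum_zero with m
    · exact hzero fun h => hn ⟨h ▸ dvd_mul_right _ _, h ▸ mul_ne_zero hj m.succ_ne_zero⟩
    · obtain rfl | hn0 := eq_or_ne n 0
      · simp [constantCoeff_expand, hc]
      · rw [map_sub, coeff_expand_of_not_dvd _ _ _ fun hd => hn ⟨hd, hn0⟩, coeff_one, if_neg hn0,
          sub_zero]

theorem hasSum_smul_expand [TopologicalSpace R] {G : ℕ → R⟦X⟧} (hG : ∀ j, coeff 0 (G j) = 0) :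
    HasSum (fun i => ((i + 1 : ℕ) : R) • expand (i + 1) i.succ_ne_zero (G (i + 1)))
      (mk fun r => ∑ y ∈ r.divisorsAntidiagonal, (y.1 : R) * coeff y.2 (G y.1)) := by
  refine (WithPiTopology.hasSum_iff_hasSum_coeff R).2 fun r => ?_
  have hdivisors : ∑ y ∈ r.divisorsAntidiagonal, (y.1 : R) * coeff y.2 (G y.1) =
      ∑ i ∈ range r, if i + 1 ∣ r then (↑(i + 1) : R) * coeff (r / (i + 1)) (G (i + 1)) else 0 := by
    rw [Nat.sum_divisorsAntidiagonal (f := fun j k => (j : R) * coeff k (G j)), Nat.divisors,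
      sum_filter, range_eq_Ico, sum_Ico_add' (fun j => if j ∣ r then
        (j : R) * coeff (r / j) (G j) else 0), zero_add]
  simp only [coeff_smul, coeff_expand, coeff_mk, smul_eq_mul, mul_ite, mul_zero]
  rw [hdivisors]
  refine hasSum_sum_of_ne_finset_zero fun i hi => ?_
  rw [mem_range, not_lt] at hi
  rw [Nat.div_eq_of_lt (Nat.lt_succ_of_le hi), hG, mul_zero, ite_self]

theorem eulerOp_genFun {f : ℕ → ℕ → R} {G : ℕ → R⟦X⟧} (hf : ∀ j, f j 0 = 1)
    (hG : ∀ j, coeff 0 (G j) = 0) (h : ∀ j, eulerOp R (mk (f j)) = mk (f j) * G j) :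
    eulerOp R (Nat.Partition.genFun f) = Nat.Partition.genFun f *
      mk fun r => ∑ y ∈ r.divisorsAntidiagonal, (y.1 : R) * coeff y.2 (G y.1) := by
  let : TopologicalSpace R := ⊥
  have : DiscreteTopology R := ⟨rfl⟩
  refine eulerOp_eq_of_hasProd (Nat.Partition.hasProd_genFun f) (hasSum_smul_expand hG) fun i => ?_
  rw [one_add_tsum_smul_X_pow (hf _) i.succ_ne_zero]
  exact eulerOp_expand _ (h _)

theorem coeff_genFun_eq_sum_prod_Icc {f : ℕ → ℕ → R} (hf : ∀ j, f j 0 = 1) (n : ℕ) :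
    coeff n (Nat.Partition.genFun f) =
      ∑ l : n.Partition, ∏ j ∈ Icc 1 n, f j (l.parts.count j) := by
  rw [Nat.Partition.coeff_genFun]
  refine sum_congr rfl fun l _ => ?_
  rw [Finsupp.prod_of_support_subset (s := Icc 1 n) _ ?_ f fun j _ => hf j]
  · simp
  · intro j hj
    rw [Multiset.toFinsupp_support, Multiset.mem_toFinset] at hj
    exact mem_Icc.2 ⟨l.parts_pos hj, l.parts_sum ▸ Multiset.le_sum_of_mem hj⟩

/-- The generating function of the plethysms `h_m[g]` (for `ε = 1`) or `e_m[g]` (for `ε = -1`),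
where `q k` is `p_{k+1}[g]`. -/
def newtonSeries [Algebra ℂ R] (ε : ℂ) (q : ℕ → R) : R⟦X⟧ :=
  mk fun m => MvPolynomial.aeval q (newtonPoly ε m)

theorem eulerOp_newtonSeries [Algebra ℂ R] (ε : ℂ) (q : ℕ → R) :
    eulerOp R (newtonSeries ε q) =
      newtonSeries ε q * (X * PowerSeries.mk fun k => ε ^ k • q k) := by
  ext n
  rw [coeff_eulerOp]
  cases n with
  | zero => simp
  | succ n =>
    have hnewton := aeval_newtonPoly_succ q ε n
    rw [Algebra.smul_def, map_add, map_natCast, map_one] at hnewton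
    rw [mul_left_comm, coeff_succ_X_mul, mul_comm (newtonSeries ε q), coeff_mul,
      Nat.sum_antidiagonal_eq_sum_range_succ_mk]
    simpa [newtonSeries] using hnewton

end LogarithmicDerivative

section PrimitiveRoots

open Finset

/-! ### Sums of primitive roots of unity -/

/-- The sum of the primitive `d`-th roots of unity, that is, the value at `d` of the Möbius
function. -/
def primitiveSum (d : ℕ) : ℂ := ∑ z ∈ primitiveRoots d ℂ, z

theorem primitiveSum_one : primitiveSum 1 = 1 := by simp [primitiveSum]

theorem nthRootsFinset_one_eq_image_pow {n : ℕ} {ζ : ℂ} (hn : n ≠ 0) (hζ : IsPrimitiveRoot ζ n) :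
    Polynomial.nthRootsFinset n (1 : ℂ) = (range n).image fun k => ζ ^ k := by
  have : NeZero n := ⟨hn⟩
  ext z
  rw [Polynomial.mem_nthRootsFinset (Nat.pos_of_ne_zero hn), mem_image]
  refine ⟨fun hz => ?_, ?_⟩
  · obtain ⟨i, hi, rfl⟩ := hζ.eq_pow_of_pow_eq_one hz
    exact ⟨i, mem_range.2 hi, rfl⟩
  · rintro ⟨k, -, rfl⟩
    rw [pow_right_comm, hζ.pow_eq_one, one_pow]

theorem sum_primitiveRoots {A : Type*} [AddCommMonoid A] {n : ℕ} {ζ : ℂ} (hn : n ≠ 0)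
    (hζ : IsPrimitiveRoot ζ n) (f : ℂ → A) :
    ∑ d ∈ n.divisors, ∑ z ∈ primitiveRoots d ℂ, f z = ∑ k ∈ range n, f (ζ ^ k) := by
  classical
  have : NeZero n := ⟨hn⟩
  rw [← sum_biUnion fun a _ b _ hab => IsPrimitiveRoot.disjoint hab,
    ← IsPrimitiveRoot.nthRoots_one_eq_biUnion_primitiveRoots,
    nthRootsFinset_one_eq_image_pow hn hζ, sum_image]
  exact fun a ha b hb hab => hζ.pow_inj (mem_range.1 ha) (mem_range.1 hb) hab

theorem sum_primitiveSum {n : ℕ} (hn : n ≠ 0) :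
    ∑ d ∈ n.divisors, primitiveSum d = if n = 1 then 1 else 0 := by
  have hζ := Complex.isPrimitiveRoot_exp n hn
  refine (sum_primitiveRoots hn hζ id).trans ?_
  split_ifs with h
  · subst h; simp
  · exact hζ.geom_sum_eq_zero (by lia)

theorem filter_dvd_div_divisors {m n : ℕ} (hn : n ≠ 0) (hmn : m ∣ n) :
    (n.divisors.filter fun d => m ∣ n / d) = (n / m).divisors := by
  obtain ⟨c, rfl⟩ := hmn
  obtain ⟨hm, hc⟩ := mul_ne_zero_iff.1 hn
  rw [Nat.mul_div_cancel_left _ (Nat.pos_of_ne_zero hm)]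
  ext d
  simp only [mem_filter, Nat.mem_divisors]
  constructor
  · rintro ⟨⟨hd, -⟩, h⟩
    rw [Nat.dvd_div_iff_mul_dvd hd, mul_comm] at h
    exact ⟨Nat.dvd_of_mul_dvd_mul_left (Nat.pos_of_ne_zero hm) h, hc⟩
  · rintro ⟨hd, -⟩
    refine ⟨⟨hd.mul_left m, hn⟩, ?_⟩
    rw [Nat.dvd_div_iff_mul_dvd (hd.mul_left m), mul_comm]
    exact mul_dvd_mul_left m hd

theorem sum_primitiveSum_sign {n : ℕ} (hn : n ≠ 0) :
    ∑ d ∈ n.divisors, (-1) ^ (n / d) * primitiveSum d =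
      if n = 1 then -1 else if n = 2 then 2 else 0 := by
  have hsign (d : ℕ) : (-1 : ℂ) ^ (n / d) * primitiveSum d =
      2 * (if 2 ∣ n / d then primitiveSum d else 0) - primitiveSum d := by
    simp only [neg_one_pow_eq_ite, ← even_iff_two_dvd]
    split_ifs <;> ring
  have heven : ∑ d ∈ n.divisors with 2 ∣ n / d, primitiveSum d = if n = 2 then 1 else 0 := by
    by_cases h2 : 2 ∣ n
    · rw [filter_dvd_div_divisors hn h2, sum_primitiveSum (by lia)]
      exact if_congr (by lia) rfl rfl
    · rw [filter_false_of_mem, sum_empty, if_neg (by lia)]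
      exact fun d hd h => h2 (h.trans (Nat.div_dvd_of_dvd (Nat.dvd_of_mem_divisors hd)))
  rw [sum_congr rfl fun d _ => hsign d, sum_sub_distrib, ← mul_sum, ← sum_filter, heven,
    sum_primitiveSum hn]
  split_ifs <;> first | lia | norm_num

end PrimitiveRoots

section PartitionSeries

open Finset PowerSeries

/-! ### Generating functions of products of plethysms -/

/-- The power sums `p_{k+1}[g]`. -/
def psumPlethysm (g : Series) (k : ℕ) : Series :=
  MvPowerSeries.expand (k + 1) (Nat.succ_ne_zero k) g

/-- The generating function of the symmetric functions `∑_λ ∏_j h_{m_j}[g_j]`, the sum being over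
the partitions `λ = 1^{m_1} 2^{m_2} ⋯` of `n`. The factor `h_{m_j}[g_j]` occurs for `ε j = 1`, and
is replaced by `e_{m_j}[g_j]` for `ε j = -1`. -/
def partitionSeries (ε : ℕ → ℂ) (g : ℕ → Series) : PowerSeries Series :=
  Nat.Partition.genFun fun j m => MvPolynomial.aeval (psumPlethysm (g j)) (newtonPoly (ε j) m)

theorem aeval_newtonPoly_zero {R : Type*} [CommRing R] [Algebra ℂ R] (q : ℕ → R) (ε : ℂ) :
    MvPolynomial.aeval q (newtonPoly ε 0) = 1 := by
  rw [newtonPoly, map_one]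

theorem aeval_zero_newtonPoly {R : Type*} [CommRing R] [Algebra ℂ R] (ε : ℂ) {m : ℕ} (hm : m ≠ 0) :
    MvPolynomial.aeval (0 : ℕ → R) (newtonPoly ε m) = 0 := by
  rw [aeval_newtonPoly_eq (s := Pi.single 0 1) (Pi.single_eq_same _ _) (fun m => by simp),
    Pi.single_eq_of_ne hm]

theorem coeff_zero_partitionSeries (ε : ℕ → ℂ) (g : ℕ → Series) :
    coeff 0 (partitionSeries ε g) = 1 := by
  rw [partitionSeries, coeff_genFun_eq_sum_prod_Icc fun j => aeval_newtonPoly_zero _ _]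
  simp

theorem eulerOp_partitionSeries (ε : ℕ → ℂ) (g : ℕ → Series) :
    eulerOp Series (partitionSeries ε g) = partitionSeries ε g *
      PowerSeries.mk fun r => ∑ y ∈ r.divisorsAntidiagonal,
        ε y.1 ^ (y.2 - 1) • psumPlethysm ((y.1 : ℂ) • g y.1) (y.2 - 1) := by
  refine (eulerOp_genFun (fun j => aeval_newtonPoly_zero _ _) (fun j => by simp) fun j =>
    eulerOp_newtonSeries (ε j) (psumPlethysm (g j))).trans (congrArg₂ _ rfl ?_)
  ext1 r
  rw [coeff_mk, coeff_mk]
  refine sum_congr rfl fun y hy => ?_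
  obtain ⟨k, hk⟩ := Nat.exists_eq_succ_of_ne_zero (Nat.pos_of_mem_divisors
    (Nat.snd_mem_divisors_of_mem_antidiagonal hy)).ne'
  rw [hk, coeff_succ_X_mul, coeff_mk, Nat.succ_sub_one, psumPlethysm, psumPlethysm, map_smul,
    smul_comm, Algebra.smul_def (y.1 : ℂ), map_natCast]

/-- The factor `H(t)` is the one for the parts equal to `1`. -/
theorem hsymm_mul_partitionSeries_update {ε : ℕ → ℂ} {g : ℕ → Series} (hε : ε 1 = 1)
    (hg : g 1 = psum 1) :
    (PowerSeries.mk fun m => hsymm (m : ℕ)) * partitionSeries ε (Function.update g 1 0) =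
      partitionSeries ε g := by
  have hH : newtonSeries 1 (fun k => psum (k + 1)) = PowerSeries.mk fun m => hsymm (m : ℕ) :=
    congrArg PowerSeries.mk (funext aeval_psum_newtonPoly_one)
  have hlog (r : ℕ) : coeff r (X * PowerSeries.mk fun k => (1 : ℂ) ^ k • psum (k + 1)) =
      ∑ y ∈ r.divisorsAntidiagonal, if y.1 = 1 then psum y.2 else 0 := by
    obtain _ | r := r
    · simp
    · rw [coeff_succ_X_mul, Nat.sum_divisorsAntidiagonal (f := fun j k => if j = 1 then
        psum k else 0), sum_ite_eq', if_pos (Nat.one_mem_divisors.2 r.succ_ne_zero)]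
      simp
  refine eq_of_eulerOp ?_ (eulerOp_partitionSeries ε g) (by simp) ?_
  · rw [← hH, eulerOp_mul (eulerOp_newtonSeries _ _) (eulerOp_partitionSeries _ _)]
    congr 1
    ext1 r
    rw [map_add, hlog, coeff_mk, coeff_mk, ← sum_add_distrib]
    refine sum_congr rfl fun y hy => ?_
    obtain hy1 | hy1 := eq_or_ne y.1 1
    · have hy2 := Nat.pos_of_mem_divisors (Nat.snd_mem_divisors_of_mem_antidiagonal hy)
      simp [hy1, hε, hg, psumPlethysm, expand_psum, Nat.sub_add_cancel hy2]
    · simp [hy1]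
  · rw [coeff_zero_eq_constantCoeff_apply, map_mul, ← coeff_zero_eq_constantCoeff_apply,
      ← coeff_zero_eq_constantCoeff_apply, coeff_zero_partitionSeries, coeff_zero_partitionSeries,
      coeff_mk, mul_one]
    exact hsymm_zero

theorem coeff_partitionSeries_update (ε : ℕ → ℂ) (g : ℕ → Series) (n : ℕ) :
    coeff n (partitionSeries ε (Function.update g 1 0)) =
      ∑ l : n.Partition with 1 ∉ l.parts, ∏ j ∈ Icc 1 n,
        MvPolynomial.aeval (psumPlethysm (g j)) (newtonPoly (ε j) (l.parts.count j)) := by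
  have hzero : psumPlethysm 0 = 0 := by ext1 k; simp [psumPlethysm]
  rw [partitionSeries, coeff_genFun_eq_sum_prod_Icc fun j => aeval_newtonPoly_zero _ _, sum_filter]
  refine sum_congr rfl fun l _ => ?_
  split_ifs with h1
  · have hn : 1 ≤ n := l.parts_sum ▸ Multiset.le_sum_of_mem h1
    refine prod_eq_zero (mem_Icc.2 ⟨le_rfl, hn⟩) ?_
    rw [Function.update_self, hzero, aeval_zero_newtonPoly _ (Multiset.count_ne_zero.2 h1)]
  · refine prod_congr rfl fun j _ => ?_
    obtain rfl | hj := eq_or_ne j 1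
    · simp only [Multiset.count_eq_zero.2 h1, aeval_newtonPoly_zero]
    · rw [Function.update_of_ne hj]

theorem sum_divisorsAntidiagonal_swap {A : Type*} [AddCommMonoid A] (Φ : ℕ → ℕ → ℕ → A) (r : ℕ) :
    ∑ y ∈ r.divisorsAntidiagonal, ∑ x ∈ y.1.divisorsAntidiagonal, Φ y.2 x.1 x.2 =
      ∑ y ∈ r.divisorsAntidiagonal, ∑ x ∈ y.1.divisorsAntidiagonal, Φ x.2 x.1 y.2 := by
  rw [sum_sigma', sum_sigma']
  refine sum_nbij' (fun z => ⟨(z.2.1 * z.1.2, z.2.2), (z.2.1, z.1.2)⟩)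
    (fun z => ⟨(z.2.1 * z.1.2, z.2.2), (z.2.1, z.1.2)⟩) ?_ ?_ ?_ ?_ fun _ _ => rfl
  all_goals
    rintro ⟨⟨j, k⟩, ⟨d, e⟩⟩ h
    simp only [mem_sigma, Nat.mem_divisorsAntidiagonal] at h ⊢
    grind

theorem sum_divisorsAntidiagonal_ite {A : Type*} [AddCommMonoid A] (F : ℕ → A) (n : ℕ) {r : ℕ}
    (hr : r ≠ 0) : ∑ y ∈ r.divisorsAntidiagonal, (if y.1 = n then F y.2 else 0) =
      if n ∣ r then F (r / n) else 0 := by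
  rw [Nat.sum_divisorsAntidiagonal (f := fun j k => if j = n then F k else 0), sum_ite_eq']
  simp [hr]

/-- Regrouping the logarithmic derivative by the powers of power sums turns their coefficients into
Möbius sums, most of which vanish for the signs of the Lie and of the Whitney characters. -/
theorem eulerOp_partitionSeries_of_primitiveSum {ε v : ℕ → ℂ} {η u : ℕ → ℕ → ℂ} {g : ℕ → Series}
    (hg : ∀ j : ℕ, j ≠ 0 → (j : ℂ) • g j =
      ∑ x ∈ j.divisorsAntidiagonal, (η j x.2 * primitiveSum x.1) • psum x.1 ^ x.2)
    (h : ∀ d e k, ε (d * e) ^ k * η (d * e) e = u (d * (k + 1)) e * v (k + 1)) :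
    eulerOp Series (partitionSeries ε g) = partitionSeries ε g *
      PowerSeries.mk fun r => ∑ y ∈ r.divisorsAntidiagonal,
        (u y.1 y.2 * ∑ d ∈ y.1.divisors, v (y.1 / d) * primitiveSum d) • psum y.1 ^ y.2 := by
  rw [eulerOp_partitionSeries]
  congr 2
  ext1 r
  trans ∑ y ∈ r.divisorsAntidiagonal, ∑ x ∈ y.1.divisorsAntidiagonal,
    (u (x.1 * y.2) x.2 * v y.2 * primitiveSum x.1) • psum (x.1 * y.2) ^ x.2
  · refine sum_congr rfl fun y hy => ?_
    obtain ⟨hy1, hy2⟩ := mul_ne_zero_iff.1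
      ((Nat.mem_divisorsAntidiagonal.1 hy).1 ▸ (Nat.mem_divisorsAntidiagonal.1 hy).2)
    obtain ⟨k, hk⟩ := Nat.exists_eq_succ_of_ne_zero hy2
    rw [hg _ hy1, psumPlethysm, map_sum, smul_sum]
    refine sum_congr rfl fun x hx => ?_
    rw [← (Nat.mem_divisorsAntidiagonal.1 hx).1, hk, Nat.succ_sub_one, ← h, map_smul, map_pow,
      expand_psum, smul_smul, mul_assoc, mul_comm x.1 (k + 1)]
  · rw [sum_divisorsAntidiagonal_swap fun k d e =>
      (u (d * k) e * v k * primitiveSum d) • psum (d * k) ^ e]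
    refine sum_congr rfl fun y _ => ?_
    rw [← Nat.sum_divisorsAntidiagonal (f := fun d k => v k * primitiveSum d), mul_sum, sum_smul]
    refine sum_congr rfl fun x hx => ?_
    rw [(Nat.mem_divisorsAntidiagonal.1 hx).1, mul_assoc]

section Geometric

variable {R : Type*} [CommRing R] (p : R)

theorem mk_pow_mul_one_sub : (PowerSeries.mk fun r => p ^ r) * (1 - C p * X) = 1 := by
  ext n
  obtain _ | n := n
  · simp
  · rw [mul_sub, mul_one, mul_left_comm, map_sub, coeff_C_mul, coeff_succ_mul_X, coeff_mk, coeff_mk,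
      pow_succ', sub_self, coeff_one, if_neg n.succ_ne_zero]

theorem eulerOp_one_sub_C_mul_X : eulerOp R (1 - C p * X) =
    (1 - C p * X) * -PowerSeries.mk fun r => if r = 0 then 0 else p ^ r := by
  have hshift : (PowerSeries.mk fun r => if r = 0 then 0 else p ^ r) =
      C p * X * PowerSeries.mk fun r => p ^ r := by
    ext n
    obtain _ | n := n
    · simp
    · rw [mul_assoc, coeff_C_mul, coeff_succ_X_mul, coeff_mk, coeff_mk, if_neg n.succ_ne_zero,
        pow_succ']
  have heuler : eulerOp R (1 - C p * X) = -(C p * X) := by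
    ext n
    rw [coeff_eulerOp, map_sub, map_neg, coeff_C_mul, coeff_X, coeff_one]
    by_cases h1 : n = 1
    · simp [h1]
    · by_cases h0 : n = 0 <;> simp [h0, h1]
  rw [hshift, heuler]
  linear_combination C p * X * mk_pow_mul_one_sub p

theorem eulerOp_mk_pow : eulerOp R (PowerSeries.mk fun r => p ^ r) =
    (PowerSeries.mk fun r => p ^ r) * PowerSeries.mk fun r => if r = 0 then 0 else p ^ r := by
  rw [eulerOp_eq_of_mul_eq_one ((mul_comm _ _).trans (mk_pow_mul_one_sub p))
    (eulerOp_one_sub_C_mul_X p), neg_neg]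

theorem eulerOp_one_add_C_mul_X_sq : eulerOp R (1 + C p * X ^ 2) = (1 + C p * X ^ 2) *
    PowerSeries.mk fun r => if 2 ∣ r ∧ r ≠ 0 then -2 * (-p) ^ (r / 2) else 0 := by
  have hexpand : expand 2 two_ne_zero (1 - C (-p) * X) = 1 + C p * X ^ 2 := by
    rw [map_sub, map_one, map_mul, expand_C, expand_X, map_neg, neg_mul, sub_neg_eq_add]
  rw [← hexpand, eulerOp_expand two_ne_zero (eulerOp_one_sub_C_mul_X (-p))]
  congr 1
  ext1 r
  rw [coeff_smul, coeff_expand, coeff_mk]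
  by_cases h2 : 2 ∣ r
  · obtain ⟨m, rfl⟩ := h2
    by_cases hm : m = 0 <;> simp [hm]
  · simp [h2]

end Geometric

theorem eq_psum_one_of_smul_eq {η : ℕ → ℕ → ℂ} {g : ℕ → Series} (hη : η 1 1 = 1)
    (hg : ∀ j : ℕ, j ≠ 0 → (j : ℂ) • g j =
      ∑ x ∈ j.divisorsAntidiagonal, (η j x.2 * primitiveSum x.1) • psum x.1 ^ x.2) :
    g 1 = psum 1 := by
  simpa [hη, primitiveSum_one] using hg 1 one_ne_zero

theorem hsymm_mul_partitionSeries_lie {g : ℕ → Series}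
    (hg : ∀ j : ℕ, j ≠ 0 → (j : ℂ) • g j =
      ∑ x ∈ j.divisorsAntidiagonal, (1 * primitiveSum x.1) • psum x.1 ^ x.2) :
    (PowerSeries.mk fun m => hsymm (m : ℕ)) * partitionSeries (fun _ => 1) (Function.update g 1 0) =
      PowerSeries.mk fun r => psum 1 ^ r := by
  rw [hsymm_mul_partitionSeries_update rfl (eq_psum_one_of_smul_eq (η := fun _ _ => 1) rfl hg)]
  have heuler := eulerOp_partitionSeries_of_primitiveSum (ε := fun _ => 1) (v := fun _ => 1)
    (u := fun _ _ => 1) (η := fun _ _ => 1) hg fun _ _ _ => by rw [one_pow, one_mul]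
  refine eq_of_eulerOp (heuler.trans ?_) (eulerOp_mk_pow _) (by simp)
    (by simp [coeff_zero_partitionSeries])
  congr 1
  ext1 r
  rw [coeff_mk, coeff_mk]
  split_ifs with hr
  · simp [hr]
  have hcollapse : ∀ y ∈ r.divisorsAntidiagonal,
      ((1 : ℂ) * ∑ d ∈ y.1.divisors, 1 * primitiveSum d) • psum y.1 ^ y.2 =
        if y.1 = 1 then psum 1 ^ y.2 else 0 := by
    intro y hy
    simp only [one_mul]
    rw [sum_primitiveSum (Nat.ne_zero_of_mem_divisorsAntidiagonal hy).1]
    split_ifs with h1 <;> simp [h1]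
  rw [sum_congr rfl hcollapse, sum_divisorsAntidiagonal_ite (psum 1 ^ ·) 1 hr]
  simp

/-- The signs of the Whitney characters: `h` for odd parts and `e` for even parts. -/
def whitneySign (j : ℕ) : ℂ := (-1) ^ (j + 1)

theorem sum_primitiveSum_sign_smul_psum {r : ℕ} (hr : r ≠ 0) :
    ∑ y ∈ r.divisorsAntidiagonal, ((-1 : ℂ) ^ (y.1 * y.2 + y.2 + 1) *
      ∑ d ∈ y.1.divisors, (-1) ^ (y.1 / d) * primitiveSum d) • psum y.1 ^ y.2 =
        (if 2 ∣ r then -2 * (-psum 2) ^ (r / 2) else 0) + psum 1 ^ r := by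
  have hcollapse : ∀ y ∈ r.divisorsAntidiagonal, ((-1 : ℂ) ^ (y.1 * y.2 + y.2 + 1) *
      ∑ d ∈ y.1.divisors, (-1) ^ (y.1 / d) * primitiveSum d) • psum y.1 ^ y.2 =
        (if y.1 = 2 then -2 * (-psum 2) ^ y.2 else 0) + if y.1 = 1 then psum 1 ^ y.2 else 0 := by
    intro y hy
    rw [sum_primitiveSum_sign (Nat.ne_zero_of_mem_divisorsAntidiagonal hy).1]
    by_cases h1 : y.1 = 1
    · simp [h1, pow_succ, ← two_mul]
    · by_cases h2 : y.1 = 2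
      · simp [h2, pow_succ, pow_add, pow_mul, neg_pow (psum 2), Algebra.smul_def,
          map_ofNat (algebraMap ℂ Series) 2]
        ring
      · simp [h1, h2]
  rw [sum_congr rfl hcollapse, sum_add_distrib,
    sum_divisorsAntidiagonal_ite (fun e => -2 * (-psum 2) ^ e) 2 hr,
    sum_divisorsAntidiagonal_ite (psum 1 ^ ·) 1 hr, if_pos (one_dvd r), Nat.div_one]

theorem hsymm_mul_partitionSeries_whitney {g : ℕ → Series}
    (hg : ∀ j : ℕ, j ≠ 0 → (j : ℂ) • g j =
      ∑ x ∈ j.divisorsAntidiagonal, ((-1) ^ (j + x.2) * primitiveSum x.1) • psum x.1 ^ x.2) :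
    (PowerSeries.mk fun m => hsymm (m : ℕ)) * partitionSeries whitneySign (Function.update g 1 0) =
      (1 + C (psum 2) * X ^ 2) * PowerSeries.mk fun r => psum 1 ^ r := by
  rw [hsymm_mul_partitionSeries_update (by simp [whitneySign])
    (eq_psum_one_of_smul_eq (η := fun j e => (-1) ^ (j + e)) (by simp) hg)]
  have hsign (d e k : ℕ) : whitneySign (d * e) ^ k * (-1) ^ (d * e + e) =
      (-1) ^ (d * (k + 1) * e + e + 1) * (-1) ^ (k + 1) := by
    rw [whitneySign, ← pow_mul, ← pow_add, ← pow_add]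
    exact neg_one_pow_congr (by simp only [parity_simps]; tauto)
  have heuler := eulerOp_partitionSeries_of_primitiveSum (v := fun k => (-1) ^ k)
    (u := fun n e => (-1) ^ (n * e + e + 1)) (η := fun j e => (-1) ^ (j + e)) hg hsign
  refine eq_of_eulerOp (heuler.trans ?_)
    (eulerOp_mul (eulerOp_one_add_C_mul_X_sq (psum 2)) (eulerOp_mk_pow _)) (by simp)
    (by simp [coeff_zero_partitionSeries])
  congr 1
  ext1 r
  rw [map_add, coeff_mk, coeff_mk, coeff_mk]
  obtain rfl | hr := eq_or_ne r 0
  · simp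
  · rw [sum_primitiveSum_sign_smul_psum hr]
    simp [hr]

end PartitionSeries

section FixedColourings

open Finset Equiv

/-! ### Colourings fixed by a permutation -/

theorem apply_eq_of_sameCycle {α β : Type*} {w : Perm α} {c : α → β} (hc : c ∘ w = c) {x y : α}
    (h : w.SameCycle x y) : c x = c y := by
  obtain ⟨k, rfl⟩ := h
  have happly (z : α) : c (w z) = c z := congrFun hc z
  induction k with
  | zero => rw [zpow_zero, Perm.one_apply]
  | succ k ih => rw [ih, add_comm, zpow_add, zpow_one, Perm.mul_apply, happly]
  | pred k ih => rw [ih, ← happly ((w ^ (-(k : ℤ) - 1)) x), ← Perm.mul_apply, ← zpow_one_add,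
      add_sub_cancel]

theorem sum_prod_apply_comp {α β ι R : Type*} [Fintype α] [Fintype β] [Fintype ι] [DecidableEq ι]
    [CommSemiring R] (π : α → ι) (x : β → R) :
    ∑ d : ι → β, ∏ i, x (d (π i)) = ∏ o, ∑ b, x b ^ #{i | π i = o} := by
  classical
  rw [prod_univ_sum, Fintype.piFinset_univ]
  refine sum_congr rfl fun d _ => ?_
  rw [← prod_fiberwise univ π]
  refine prod_congr rfl fun o _ => prod_eq_pow_card fun i hi => ?_
  rw [(mem_filter.1 hi).2]

variable {α : Type*} [Fintype α] [DecidableEq α]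

theorem prod_parts_partition {R : Type*} [CommMonoid R] (w : Perm α) (P : ℕ → R) :
    (w.partition.parts.map P).prod =
      (∏ c ∈ w.cycleFactorsFinset, P (#c.support)) * P 1 ^ (Fintype.card α - #w.support) := by
  rw [Perm.parts_partition, Multiset.map_add, Multiset.prod_add, Multiset.map_replicate,
    Multiset.prod_replicate, Perm.cycleType_def, Multiset.map_map]
  rfl

/-- The cycle of a permutation containing a given element. The nontrivial cycles are encoded by the
cyclic factors and the trivial ones by the fixed points. -/
def cycleRep (w : Perm α) (x : α) :
    {c : Perm α // c ∈ w.cycleFactorsFinset} ⊕ {x : α // w x = x} :=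
  if h : w x = x then Sum.inr ⟨x, h⟩
  else Sum.inl ⟨w.cycleOf x, Perm.cycleOf_mem_cycleFactorsFinset_iff.2 (Perm.mem_support.2 h)⟩

theorem cycleRep_eq_inl {w : Perm α} {x : α} {c : {c : Perm α // c ∈ w.cycleFactorsFinset}} :
    cycleRep w x = Sum.inl c ↔ x ∈ (c : Perm α).support := by
  obtain ⟨c, hc⟩ := c
  unfold cycleRep
  split_ifs with h
  · simp only [false_iff]
    exact fun hx => Perm.mem_support.1 (Perm.mem_cycleFactorsFinset_support_le hc hx) h
  · rw [Sum.inl.injEq, Subtype.mk.injEq]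
    constructor
    · rintro rfl
      exact Perm.mem_support_cycleOf_iff.2 ⟨Perm.SameCycle.refl _ _, Perm.mem_support.2 h⟩
    · exact fun hx => (Perm.cycle_is_cycleOf hx hc).symm

theorem cycleRep_eq_inr {w : Perm α} {x : α} {y : {x : α // w x = x}} :
    cycleRep w x = Sum.inr y ↔ x = y := by
  obtain ⟨y, hy⟩ := y
  unfold cycleRep
  split_ifs with h
  · simp
  · simp only [false_iff]
    rintro rfl
    exact h hy

theorem cycleRep_surjective (w : Perm α) : Function.Surjective (cycleRep w) := by
  rintro (⟨c, hc⟩ | y)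
  · obtain ⟨x, hx⟩ : c.support.Nonempty :=
      (Perm.mem_cycleFactorsFinset_iff.1 hc).1.nonempty_support
    exact ⟨x, cycleRep_eq_inl.2 hx⟩
  · exact ⟨y, cycleRep_eq_inr.2 rfl⟩

theorem sameCycle_of_cycleRep_eq {w : Perm α} {x y : α} (h : cycleRep w x = cycleRep w y) :
    w.SameCycle x y := by
  rcases hy : cycleRep w y with c | z
  · have hx := cycleRep_eq_inl.1 (h.trans hy)
    have hyx : y ∈ (w.cycleOf x).support := by
      rw [← Perm.cycle_is_cycleOf hx c.2]
      exact cycleRep_eq_inl.1 hy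
    exact (Perm.mem_support_cycleOf_iff.1 hyx).1
  · rw [cycleRep_eq_inr.1 (h.trans hy), cycleRep_eq_inr.1 hy]

theorem cycleRep_comp (w : Perm α) : cycleRep w ∘ w = cycleRep w := by
  funext x
  rw [Function.comp_apply]
  rcases hx : cycleRep w x with c | z
  · rw [cycleRep_eq_inl] at hx ⊢
    rw [← (Perm.mem_cycleFactorsFinset_iff.1 c.2).2 x hx]
    exact Perm.apply_mem_support.2 hx
  · rw [cycleRep_eq_inr] at hx ⊢
    rw [hx, z.2]

theorem sum_fixed_eq_sum_comp_cycleRep {β R : Type*} [Fintype β] [DecidableEq β] [AddCommMonoid R]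
    (w : Perm α) (f : (α → β) → R) :
    ∑ c : α → β with c ∘ w = c, f c = ∑ d : _ → β, f (d ∘ cycleRep w) := by
  symm
  refine sum_bij (fun d _ => d ∘ cycleRep w) ?_ ?_ ?_ fun _ _ => rfl
  · intro d _
    rw [mem_filter, Function.comp_assoc, cycleRep_comp]
    exact ⟨mem_univ _, rfl⟩
  · exact fun d _ d' _ h => (cycleRep_surjective w).injective_comp_right h
  · intro c hc
    refine ⟨c ∘ Function.surjInv (cycleRep_surjective w), mem_univ _, funext fun i => ?_⟩
    exact apply_eq_of_sameCycle (mem_filter.1 hc).2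
      (sameCycle_of_cycleRep_eq (Function.surjInv_eq (cycleRep_surjective w) _))

theorem sum_fixed_prod_eq_prod_parts {β R : Type*} [Fintype β] [DecidableEq β] [CommSemiring R]
    (w : Perm α) (x : β → R) :
    ∑ c : α → β with c ∘ w = c, ∏ i, x (c i) =
      (w.partition.parts.map fun k => ∑ b, x b ^ k).prod := by
  have hcycle (c : {c : Perm α // c ∈ w.cycleFactorsFinset}) :
      #{i | cycleRep w i = Sum.inl c} = #(c : Perm α).support := by
    simp_rw [cycleRep_eq_inl, filter_univ_mem]
  have hfixed (y : {x : α // w x = x}) : #{i | cycleRep w i = Sum.inr y} = 1 := by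
    simp_rw [cycleRep_eq_inr, filter_eq', if_pos (mem_univ _), card_singleton]
  have hcard : Fintype.card {x : α // w x = x} = Fintype.card α - #w.support := by
    rw [Fintype.card_subtype, ← card_compl]
    congr 1
    ext i
    simp
  rw [sum_fixed_eq_sum_comp_cycleRep]
  refine (sum_prod_apply_comp (cycleRep w) x).trans ?_
  simp only [Fintype.prod_sum_type, hcycle, hfixed, pow_one, prod_const, card_univ, hcard]
  rw [prod_parts_partition, prod_coe_sort w.cycleFactorsFinset fun c => ∑ b, x b ^ #c.support]
  simp only [pow_one]

end FixedColourings

section Frobenius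

open Finset Equiv

/-! ### The Frobenius characteristic -/

/-- The product of the power sums of the cycle lengths of a permutation. -/
def cyclePsum {n : ℕ} (w : Perm (Fin n)) : Series := (w.partition.parts.map psum).prod

theorem ch_eq (n : ℕ) (f : Perm (Fin n) → ℂ) :
    ch n f = ((n.factorial : ℂ)⁻¹) • ∑ w, f w • cyclePsum w := rfl

/-- The number of times that each colour occurs in a colouring. -/
def content {n : ℕ} {β : Type*} (c : Fin n → β) : β →₀ ℕ := ∑ i, Finsupp.single (c i) 1

theorem content_apply {n : ℕ} {β : Type*} [DecidableEq β] (c : Fin n → β) (b : β) :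
    content c b = (univ.filter fun i => c i = b).card := by
  rw [content, Finsupp.finsetSum_apply, card_filter]
  exact sum_congr rfl fun i _ => Finsupp.single_apply

theorem content_comp_perm {n : ℕ} {β : Type*} (c : Fin n → β) (w : Perm (Fin n)) :
    content (c ∘ w) = content c :=
  Equiv.sum_comp w fun i => Finsupp.single (c i) 1

/-- The character of the permutation representation on the colourings of content `a`. -/
def colouringChar {n M : ℕ} (a : Fin M →₀ ℕ) (w : Perm (Fin n)) : ℂ :=
  ((univ.filter fun c : Fin n → Fin M => c ∘ w = c ∧ content c = a).card : ℂ)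

theorem truncVars_cyclePsum {n : ℕ} (M : ℕ) (w : Perm (Fin n)) :
    truncVars M (cyclePsum w) =
      ∑ c : Fin n → Fin M with c ∘ w = c, MvPowerSeries.monomial (content c) (1 : ℂ) := by
  have hmonomial (c : Fin n → Fin M) : MvPowerSeries.monomial (content c) (1 : ℂ) =
      ∏ i, MvPowerSeries.X (R := ℂ) (c i) := by
    simp only [MvPowerSeries.X, MvPowerSeries.prod_monomial, prod_const_one, content]
  simp_rw [hmonomial]
  rw [sum_fixed_prod_eq_prod_parts, cyclePsum, map_multiset_prod, Multiset.map_map]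
  exact congrArg _ (Multiset.map_congr rfl fun k hk =>
    truncVars_psum M (w.partition.parts_pos hk).ne')

theorem coeff_truncVars_cyclePsum {n M : ℕ} (w : Perm (Fin n)) (a : Fin M →₀ ℕ) :
    MvPowerSeries.coeff a (truncVars M (cyclePsum w)) = colouringChar a w := by
  classical
  rw [truncVars_cyclePsum, map_sum, colouringChar, ← filter_filter, card_filter, Nat.cast_sum]
  refine sum_congr rfl fun c _ => ?_
  rw [MvPowerSeries.coeff_monomial, Nat.cast_ite, Nat.cast_one, Nat.cast_zero]
  exact if_congr eq_comm rfl rfl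

theorem coeff_truncVars_ch {n M : ℕ} (f : Perm (Fin n) → ℂ) (a : Fin M →₀ ℕ) :
    MvPowerSeries.coeff a (truncVars M (ch n f)) =
      (n.factorial : ℂ)⁻¹ * ∑ w, f w * colouringChar a w := by
  rw [ch_eq, map_smul, map_sum, MvPowerSeries.coeff_smul, map_sum]
  congr 1
  refine sum_congr rfl fun w _ => ?_
  rw [map_smul, MvPowerSeries.coeff_smul, coeff_truncVars_cyclePsum]

/-- The Frobenius characteristic as a linear map. -/
def chLinear (n : ℕ) : (Perm (Fin n) → ℂ) →ₗ[ℂ] Series where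
  toFun := ch n
  map_add' f g := by simp only [ch_eq, Pi.add_apply, add_smul, sum_add_distrib, smul_add]
  map_smul' a f := by
    simp only [ch_eq, Pi.smul_apply, smul_assoc, ← smul_sum, RingHom.id_apply]
    rw [smul_comm]

theorem ch_sum {ι : Type*} (n : ℕ) (s : Finset ι) (f : ι → Perm (Fin n) → ℂ) :
    ch n (∑ i ∈ s, f i) = ∑ i ∈ s, ch n (f i) :=
  map_sum (chLinear n) f s

theorem ch_smul (n : ℕ) (a : ℂ) (f : Perm (Fin n) → ℂ) : ch n (a • f) = a • ch n f :=
  map_smul (chLinear n) a f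

theorem ch_zero (n : ℕ) : ch n 0 = 0 :=
  map_zero (chLinear n)

/-- The space of class functions. -/
def classFunctions (G : Type) [Group G] : Submodule ℂ (G → ℂ) where
  carrier := {f | IsClassFunction f}
  zero_mem' _ _ := rfl
  add_mem' hf hg x y := congrArg₂ (· + ·) (hf x y) (hg x y)
  smul_mem' a _ hf x y := congrArg (a * ·) (hf x y)

theorem IsClassFunction.smul {G : Type} [Group G] {f : G → ℂ} (hf : IsClassFunction f) (a : ℂ) :
    IsClassFunction (a • f) :=
  (classFunctions G).smul_mem a hf

theorem IsClassFunction.sum {G : Type} {ι : Type*} [Group G] {s : Finset ι} {f : ι → G → ℂ}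
    (hf : ∀ i ∈ s, IsClassFunction (f i)) : IsClassFunction (∑ i ∈ s, f i) :=
  (classFunctions G).sum_mem hf

theorem IsClassFunction.eq_of_partition_eq {n : ℕ} {f : Perm (Fin n) → ℂ} (hf : IsClassFunction f)
    {v w : Perm (Fin n)} (h : v.partition = w.partition) : f v = f w := by
  obtain ⟨u, rfl⟩ := isConj_iff.1 (Perm.partition_eq_of_isConj.2 h)
  exact (hf v u).symm

/-- The exponents of the power sum product of a partition, where the variable number `k` stands for
`p_{k+1}`. -/
def partsExponent (s : Multiset ℕ) : ℕ →₀ ℕ := Multiset.toFinsupp (s.map Nat.pred)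

theorem map_succ_map_pred {s : Multiset ℕ} (hs : ∀ k ∈ s, 0 < k) :
    (s.map Nat.pred).map Nat.succ = s := by
  rw [Multiset.map_map]
  exact (Multiset.map_congr rfl fun k hk => Nat.succ_pred_eq_of_pos (hs k hk)).trans s.map_id

theorem partsExponent_injective (n : ℕ) :
    Function.Injective fun l : n.Partition => partsExponent l.parts := by
  intro l m h
  ext1
  rw [← map_succ_map_pred fun _ => l.parts_pos, Multiset.toFinsupp.injective h,
    map_succ_map_pred fun _ => m.parts_pos]

theorem aeval_monomial_partsExponent {s : Multiset ℕ} (hs : ∀ k ∈ s, 0 < k) :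
    MvPolynomial.aeval (R := ℂ) (fun k : ℕ => psum (k + 1))
      (MvPolynomial.monomial (partsExponent s) 1) = (s.map psum).prod := by
  conv_rhs => rw [← map_succ_map_pred hs, Multiset.map_map, Finset.prod_multiset_map_count]
  rw [MvPolynomial.aeval_monomial, map_one, one_mul, Finsupp.prod, partsExponent,
    Multiset.toFinsupp_support]
  simp only [Multiset.toFinsupp_apply, Function.comp_apply, Nat.succ_eq_add_one]

theorem linearIndependent_prod_psum (n : ℕ) :
    LinearIndependent ℂ fun l : n.Partition => (l.parts.map psum).prod := by
  have hmonomials := (MvPolynomial.basisMonomials ℕ ℂ).linearIndependent.map'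
    (MvPolynomial.aeval fun k : ℕ => psum (k + 1)).toLinearMap
    (LinearMap.ker_eq_bot.2 algebraicIndependent_psum)
  have hprod : (fun l : n.Partition => (l.parts.map psum).prod) =
      ((MvPolynomial.aeval fun k : ℕ => psum (k + 1)).toLinearMap ∘
        MvPolynomial.basisMonomials ℕ ℂ) ∘ fun l : n.Partition => partsExponent l.parts :=
    funext fun l => (aeval_monomial_partsExponent fun _ => l.parts_pos).symm
  rw [hprod]
  exact hmonomials.comp _ (partsExponent_injective n)

theorem ch_eq_sum_partition (n : ℕ) (f : Perm (Fin n) → ℂ) :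
    ch n f = ∑ l : (Fintype.card (Fin n)).Partition,
      ((n.factorial : ℂ)⁻¹ * ∑ w with w.partition = l, f w) • (l.parts.map psum).prod := by
  rw [ch_eq, ← sum_fiberwise univ Perm.partition, smul_sum]
  refine sum_congr rfl fun l _ => ?_
  rw [mul_smul, sum_smul]
  refine congrArg _ (sum_congr rfl fun w hw => ?_)
  rw [cyclePsum, (mem_filter.1 hw).2]

theorem card_partition_eq_ne_zero {n : ℕ} (v : Perm (Fin n)) :
    (#{w : Perm (Fin n) | w.partition = v.partition} : ℂ) ≠ 0 :=
  Nat.cast_ne_zero.2 (card_ne_zero_of_mem (mem_filter.2 ⟨mem_univ v, rfl⟩))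

theorem ch_injective {n : ℕ} {f g : Perm (Fin n) → ℂ} (hf : IsClassFunction f)
    (hg : IsClassFunction g) (h : ch n f = ch n g) : f = g := by
  funext v
  have hsum {f : Perm (Fin n) → ℂ} (hf : IsClassFunction f) :
      ∑ w with w.partition = v.partition, f w =
        #{w : Perm (Fin n) | w.partition = v.partition} * f v := by
    rw [sum_congr rfl fun w hw => hf.eq_of_partition_eq (mem_filter.1 hw).2, sum_const,
      nsmul_eq_mul]
  rw [ch_eq_sum_partition, ch_eq_sum_partition] at h
  have hcoeff : (fun l => (n.factorial : ℂ)⁻¹ * ∑ w with w.partition = l, f w) =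
      fun l => (n.factorial : ℂ)⁻¹ * ∑ w with w.partition = l, g w :=
    (linearIndependent_prod_psum _).fintypeLinearCombination_injective h
  have hv := mul_left_cancel₀ (inv_ne_zero (Nat.cast_ne_zero.2 n.factorial_ne_zero))
    (congrFun hcoeff v.partition)
  rw [hsum hf, hsum hg] at hv
  exact mul_left_cancel₀ (card_partition_eq_ne_zero v) hv

/-! ### The image of the Frobenius characteristic -/

/-- The symmetric functions of degree `n`: the span of the power sum products of degree `n`. -/
def symSpan (n : ℕ) : Submodule ℂ Series :=
  Submodule.span ℂ {F | ∃ s : Multiset ℕ, (∀ k ∈ s, 0 < k) ∧ s.sum = n ∧ F = (s.map psum).prod}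

instance : SetLike.GradedMonoid symSpan where
  one_mem := Submodule.subset_span ⟨0, by simp, rfl, by simp⟩
  mul_mem a b F G hF hG := by
    have h := Submodule.mul_mem_mul hF hG
    rw [symSpan, symSpan, Submodule.span_mul_span] at h
    refine Submodule.span_mono ?_ h
    rintro _ ⟨_, ⟨s, hs, rfl, rfl⟩, _, ⟨t, ht, rfl, rfl⟩, rfl⟩
    exact ⟨s + t, fun k hk => (Multiset.mem_add.1 hk).elim (hs k) (ht k), Multiset.sum_add s t,
      by simp only [Multiset.map_add, Multiset.prod_add]⟩

theorem expand_mem_symSpan {n k : ℕ} (hk : k ≠ 0) {F : Series} (hF : F ∈ symSpan n) :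
    MvPowerSeries.expand k hk F ∈ symSpan (k * n) := by
  suffices hle : symSpan n ≤ (symSpan (k * n)).comap (MvPowerSeries.expand k hk).toLinearMap from
    hle hF
  refine Submodule.span_le.2 ?_
  rintro _ ⟨s, hs, rfl, rfl⟩
  refine Submodule.subset_span ⟨s.map (k * ·), ?_, ?_, ?_⟩
  · intro i hi
    obtain ⟨j, hj, rfl⟩ := Multiset.mem_map.1 hi
    exact Nat.mul_pos (Nat.pos_of_ne_zero hk) (hs j hj)
  · rw [Multiset.sum_map_mul_left, Multiset.map_id']
  · rw [AlgHom.toLinearMap_apply, map_multiset_prod, Multiset.map_map, Multiset.map_map]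
    exact congrArg _ (Multiset.map_congr rfl fun j _ => expand_psum hk j)

theorem aeval_newtonPoly_mem_symSpan {j : ℕ} {q : ℕ → Series}
    (hq : ∀ k, q k ∈ symSpan (j * (k + 1))) (ε : ℂ) (m : ℕ) :
    MvPolynomial.aeval q (newtonPoly ε m) ∈ symSpan (j * m) := by
  induction m using Nat.strong_induction_on with
  | _ m ih =>
    obtain _ | m := m
    · rw [aeval_newtonPoly_zero]
      exact SetLike.one_mem_graded symSpan
    · have hm : ((m : ℂ) + 1) ≠ 0 := Nat.cast_add_one_ne_zero m
      rw [← Submodule.smul_mem_iff _ hm, aeval_newtonPoly_succ q ε m]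
      refine Submodule.sum_mem _ fun k hk => Submodule.smul_mem _ _ ?_
      rw [mem_range] at hk
      have hmul := SetLike.mul_mem_graded (hq k) (ih (m - k) (by lia))
      rwa [← mul_add, show k + 1 + (m - k) = m + 1 by lia] at hmul

theorem ch_mem_symSpan (n : ℕ) (f : Perm (Fin n) → ℂ) : ch n f ∈ symSpan n := by
  rw [ch_eq]
  refine Submodule.smul_mem _ _ (Submodule.sum_mem _ fun w _ => Submodule.smul_mem _ _ ?_)
  exact Submodule.subset_span ⟨_, fun _ => w.partition.parts_pos,
    w.partition.parts_sum.trans (Fintype.card_fin n), rfl⟩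

theorem exists_perm_of_parts {n : ℕ} {s : Multiset ℕ} (hs : ∀ k ∈ s, 0 < k) (hsum : s.sum = n) :
    ∃ w : Perm (Fin n), w.partition.parts = s := by
  have hadd : s.filter (2 ≤ ·) + s.filter (¬ 2 ≤ ·) = s := Multiset.filter_add_not _ _
  have hone : s.filter (¬ 2 ≤ ·) = Multiset.replicate (Multiset.card (s.filter (¬ 2 ≤ ·))) 1 := by
    refine Multiset.eq_replicate.2 ⟨rfl, fun b hb => ?_⟩
    rw [Multiset.mem_filter] at hb
    have := hs b hb.1
    lia
  have hsplit : (s.filter (2 ≤ ·)).sum + Multiset.card (s.filter (¬ 2 ≤ ·)) = n := by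
    rw [← hsum, ← congrArg Multiset.sum hadd, Multiset.sum_add, Nat.add_left_cancel_iff, hone,
      Multiset.sum_replicate, Multiset.card_replicate, smul_eq_mul, mul_one]
  obtain ⟨w, hw⟩ := (Perm.exists_with_cycleType_iff (Fin n) (m := s.filter (2 ≤ ·))).2
    ⟨by rw [Fintype.card_fin]; lia, fun a ha => (Multiset.mem_filter.1 ha).2⟩
  refine ⟨w, ?_⟩
  rw [Perm.parts_partition, ← Perm.sum_cycleType, hw, Fintype.card_fin, ← hsplit,
    Nat.add_sub_cancel_left, ← hone, hadd]

theorem symSpan_le_map_classFunctions (n : ℕ) :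
    symSpan n ≤ (classFunctions (Perm (Fin n))).map (chLinear n) := by
  refine Submodule.span_le.2 ?_
  rintro _ ⟨s, hs, hsum, rfl⟩
  obtain ⟨v, rfl⟩ := exists_perm_of_parts hs hsum
  let f : Perm (Fin n) → ℂ := fun w => if w.partition = v.partition then 1 else 0
  have hf : IsClassFunction f := fun g h => by
    have hconj : (h * g * h⁻¹).partition = g.partition :=
      (Perm.partition_eq_of_isConj.1 (isConj_iff.2 ⟨h, rfl⟩)).symm
    simp only [f, hconj]
  have hch : ch n f = ((n.factorial : ℂ)⁻¹ *
      #{w : Perm (Fin n) | w.partition = v.partition}) • cyclePsum v := by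
    rw [ch_eq, mul_smul, Nat.cast_smul_eq_nsmul, ← sum_const, sum_filter]
    refine congrArg _ (sum_congr rfl fun w _ => ?_)
    dsimp only [f]
    split_ifs with hw
    · rw [one_smul, cyclePsum, hw, cyclePsum]
    · rw [zero_smul]
  have hscalar := mul_ne_zero (inv_ne_zero (Nat.cast_ne_zero.2 n.factorial_ne_zero))
    (card_partition_eq_ne_zero v)
  exact (Submodule.smul_mem_iff _ hscalar).1 ⟨f, hf, hch⟩

theorem classFunctionOf_spec {n : ℕ} {F : Series} (hF : F ∈ symSpan n) :
    IsClassFunction (classFunctionOf n F) ∧ ch n (classFunctionOf n F) = F := by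
  have hexists : ∃ f : Perm (Fin n) → ℂ, IsClassFunction f ∧ ch n f = F :=
    symSpan_le_map_classFunctions n hF
  rw [classFunctionOf, dif_pos hexists]
  exact hexists.choose_spec

/-! ### The hat characters -/

theorem sum_mul_count {n : ℕ} (l : n.Partition) : ∑ j ∈ Icc 1 n, j * l.parts.count j = n :=
  (sum_congr rfl fun _ _ => mul_comm _ _).trans
    (mem_finsuppAntidiag.1 l.toFinsuppAntidiag_mem_finsuppAntidiag).1

theorem prod_plethysm_mem_symSpan {n : ℕ} (l : n.Partition) {g : ℕ → Series}
    (hg : ∀ j, g j ∈ symSpan j) (ε : ℕ → ℂ) :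
    ∏ j ∈ Icc 1 n, MvPolynomial.aeval (psumPlethysm (g j)) (newtonPoly (ε j) (l.parts.count j)) ∈
      symSpan n := by
  have hpower (j k : ℕ) : psumPlethysm (g j) k ∈ symSpan (j * (k + 1)) := by
    rw [mul_comm]
    exact expand_mem_symSpan _ (hg j)
  have hprod := SetLike.prod_mem_graded symSpan (fun j => j * l.parts.count j)
    (fun j => MvPolynomial.aeval (psumPlethysm (g j)) (newtonPoly (ε j) (l.parts.count j)))
    (F := Icc 1 n) fun j _ => aeval_newtonPoly_mem_symSpan (hpower j) _ _
  rwa [sum_mul_count] at hprod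

theorem lieChar_eq {n : ℕ} (l : n.Partition) :
    lieChar l = classFunctionOf n (∏ j ∈ Icc 1 n, MvPolynomial.aeval (psumPlethysm (ell j))
      (newtonPoly 1 (l.parts.count j))) := by
  rw [lieChar]
  congr 1
  exact prod_congr rfl fun j _ => plethysm_hsymm _ _

theorem whitneyChar_eq {n : ℕ} (l : n.Partition) :
    whitneyChar l = classFunctionOf n (∏ j ∈ Icc 1 n, MvPolynomial.aeval
      (psumPlethysm (piSymm j)) (newtonPoly (whitneySign j) (l.parts.count j))) := by
  rw [whitneyChar, ← prod_filter_mul_prod_filter_not (Icc 1 n) Odd]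
  simp_rw [Nat.not_odd_iff_even]
  congr 2
  · refine prod_congr rfl fun j hj => ?_
    rw [plethysm_hsymm, whitneySign, (mem_filter.1 hj).2.add_one.neg_one_pow]
    rfl
  · refine prod_congr rfl fun j hj => ?_
    rw [plethysm_esymm, whitneySign, (mem_filter.1 hj).2.add_one.neg_one_pow]
    rfl

theorem rank_le {n : ℕ} (l : n.Partition) : rank l ≤ n := by
  conv_rhs => rw [← l.parts_sum, ← Multiset.map_id l.parts]
  exact Multiset.sum_map_le_sum_map _ _ fun k _ => Nat.sub_le k 1

theorem sum_hatPartitions {A : Type*} [AddCommMonoid A] (n : ℕ) (f : n.Partition → A) :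
    ∑ i ∈ range (n + 1), ∑ l ∈ hatPartitions i n, f l =
      ∑ l : n.Partition with 1 ∉ l.parts, f l := by
  rw [← sum_fiberwise_of_maps_to (g := rank) (t := range (n + 1))]
  · refine sum_congr rfl fun i _ => ?_
    rw [hatPartitions, filter_filter]
  · intro l _
    exact mem_range.2 (Nat.lt_succ_of_le (rank_le l))

theorem isClassFunction_sum_hat {n : ℕ} {g : ℕ → Series} (hg : ∀ j, g j ∈ symSpan j) (ε : ℕ → ℂ)
    {f : n.Partition → Perm (Fin n) → ℂ}
    (hf : ∀ l, f l = classFunctionOf n (∏ j ∈ Icc 1 n, MvPolynomial.aeval (psumPlethysm (g j))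
      (newtonPoly (ε j) (l.parts.count j)))) :
    IsClassFunction (∑ i ∈ range (n + 1), ∑ l ∈ hatPartitions i n, f l) := by
  rw [sum_hatPartitions]
  refine IsClassFunction.sum fun l _ => ?_
  rw [hf]
  exact (classFunctionOf_spec (prod_plethysm_mem_symSpan l hg ε)).1

theorem ch_sum_hat {n : ℕ} {g : ℕ → Series} (hg : ∀ j, g j ∈ symSpan j) (ε : ℕ → ℂ)
    {f : n.Partition → Perm (Fin n) → ℂ}
    (hf : ∀ l, f l = classFunctionOf n (∏ j ∈ Icc 1 n, MvPolynomial.aeval (psumPlethysm (g j))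
      (newtonPoly (ε j) (l.parts.count j)))) :
    ch n (∑ i ∈ range (n + 1), ∑ l ∈ hatPartitions i n, f l) =
      PowerSeries.coeff n (partitionSeries ε (Function.update g 1 0)) := by
  rw [sum_hatPartitions, ch_sum, coeff_partitionSeries_update]
  refine sum_congr rfl fun l _ => ?_
  rw [hf]
  exact (classFunctionOf_spec (prod_plethysm_mem_symSpan l hg ε)).2

end Frobenius

section LieCharacters

open Finset Equiv

/-! ### The Frobenius characteristic of the Lie characters -/

theorem sum_inducedCharacter_smul {G : Type} {M : Type*} [Group G] [Fintype G] [AddCommGroup M]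
    [Module ℂ M] (H : Subgroup G) [Fintype H] (ψ : H → ℂ) {F : G → M}
    (hF : ∀ g x, F (x * g * x⁻¹) = F g) :
    ∑ g, inducedCharacter H ψ g • F g =
      ((Nat.card H : ℂ)⁻¹ * Fintype.card G) • ∑ h : H, ψ h • F h := by
  classical
  have hconj (x : G) : ∑ g, (if h : x⁻¹ * g * x ∈ H then ψ ⟨x⁻¹ * g * x, h⟩ else 0) • F g =
      ∑ h : H, ψ h • F h := by
    symm
    refine sum_of_injOn (fun h : H => x * h * x⁻¹) (fun a _ b _ h => by simpa using h)
      (fun _ _ => mem_univ _) ?_ ?_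
    · intro g _ hg
      rw [dif_neg, zero_smul]
      exact fun h => hg ⟨⟨x⁻¹ * g * x, h⟩, mem_univ _, by group⟩
    · intro h _
      have hcancel : x⁻¹ * (x * h * x⁻¹) * x = h := by group
      simp only [hcancel, h.2, dite_true, hF]
  simp only [inducedCharacter, mul_smul, ← smul_sum, sum_smul]
  rw [sum_comm, sum_congr rfl fun x _ => hconj x, sum_const, card_univ, Nat.cast_smul_eq_nsmul]

theorem cyclePsum_conj {n : ℕ} (w x : Perm (Fin n)) : cyclePsum (x * w * x⁻¹) = cyclePsum w := by
  rw [cyclePsum, cyclePsum, ← Perm.partition_eq_of_isConj.1 (isConj_iff.2 ⟨x, rfl⟩)]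

theorem ch_mul_inducedCharacter {n : ℕ} (H : Subgroup (Perm (Fin n))) [Fintype H] (ψ : H → ℂ)
    {t : Perm (Fin n) → ℂ} (ht : IsClassFunction t) :
    ch n (fun w => t w * inducedCharacter H ψ w) =
      (Nat.card H : ℂ)⁻¹ • ∑ h : H, ψ h • t h • cyclePsum (h : Perm (Fin n)) := by
  simp only [ch_eq, mul_comm (t _), mul_smul]
  rw [sum_inducedCharacter_smul H ψ (F := fun w => t w • cyclePsum w)
    fun w x => by rw [ht, cyclePsum_conj], smul_smul, Fintype.card_perm, Fintype.card_fin,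
    mul_left_comm, inv_mul_cancel₀ (Nat.cast_ne_zero.2 n.factorial_ne_zero), mul_one]

section Semiregular

variable {n : ℕ} {w : Perm (Fin n)}

theorem eq_orderOf_of_mem_parts (h : ∀ (m : ℕ) (x : Fin n), (w ^ m) x = x → w ^ m = 1) {l : ℕ}
    (hl : l ∈ w.partition.parts) : l = orderOf w := by
  rw [Perm.parts_partition, Multiset.mem_add] at hl
  obtain hl | hl := hl
  · refine Nat.dvd_antisymm (Perm.dvd_of_mem_cycleType hl) ?_
    rw [Perm.cycleType_def, Multiset.mem_map] at hl
    obtain ⟨c, hc, rfl⟩ := hl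
    rw [← Finset.mem_def] at hc
    have hcycle := (Perm.mem_cycleFactorsFinset_iff.1 hc).1
    obtain ⟨x, hx⟩ := hcycle.nonempty_support
    refine orderOf_dvd_of_pow_eq_one (h _ x ?_)
    rw [← Perm.cycleOf_pow_apply_self, ← Perm.cycle_is_cycleOf hx hc, Function.comp_apply,
      ← hcycle.orderOf, pow_orderOf_eq_one, Perm.one_apply]
  · rw [Multiset.mem_replicate, Fintype.card_fin] at hl
    obtain ⟨hcard, rfl⟩ := hl
    obtain ⟨x, hx⟩ : ∃ x, x ∉ w.support := by
      by_contra! hall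
      rw [eq_univ_of_forall hall, card_univ, Fintype.card_fin, Nat.sub_self] at hcard
      exact hcard rfl
    have hone := h 1 x (by rw [pow_one, Perm.notMem_support.1 hx])
    rw [← pow_one w, hone, orderOf_one]

theorem parts_of_semiregular (h : ∀ (m : ℕ) (x : Fin n), (w ^ m) x = x → w ^ m = 1) :
    w.partition.parts = Multiset.replicate (n / orderOf w) (orderOf w) := by
  have hparts := Multiset.eq_replicate_of_mem fun _ => eq_orderOf_of_mem_parts h
  have hsum := w.partition.parts_sum.trans (Fintype.card_fin n)
  rw [hparts, Multiset.sum_replicate, smul_eq_mul] at hsum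
  rwa [Nat.div_eq_of_eq_mul_left (orderOf_pos w) hsum.symm]

end Semiregular

theorem sign_eq_neg_one_pow {n : ℕ} (w : Perm (Fin n)) :
    ((Perm.sign w : ℤ) : ℂ) = (-1) ^ (n + Multiset.card w.partition.parts) := by
  rw [Perm.sign_of_cycleType, Perm.parts_partition, Multiset.card_add, Multiset.card_replicate,
    Perm.sum_cycleType, Fintype.card_fin]
  obtain ⟨k, hk⟩ := Nat.exists_eq_add_of_le (w.support.card_le_univ.trans_eq (Fintype.card_fin n))
  push_cast
  refine neg_one_pow_congr ?_
  have hsub : n - #w.support = k := by lia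
  rw [hsub]
  have hparity : Even n ↔ Even (#w.support + k) := by rw [← hk]
  simp only [parity_simps] at hparity ⊢
  tauto

theorem orderOf_finRotate {n : ℕ} (hn : n ≠ 0) : orderOf (finRotate n) = n := by
  match n with
  | 1 => exact orderOf_eq_one_iff.2 (Subsingleton.elim _ _)
  | n + 2 => rw [isCycle_finRotate.orderOf, support_finRotate, card_univ, Fintype.card_fin]

theorem finRotate_semiregular {n : ℕ} (m : ℕ) (x : Fin n) (h : (finRotate n ^ m) x = x) :
    finRotate n ^ m = 1 := by
  match n with
  | 0 => exact x.elim0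
  | 1 => exact Subsingleton.elim _ _
  | n + 2 =>
    refine (isCycle_finRotate.pow_eq_one_iff' (x := x) ?_).2 h
    rw [← Perm.mem_support, support_finRotate]
    exact mem_univ x

theorem parts_finRotate_pow {n : ℕ} (hn : n ≠ 0) {ζ : ℂ} (hζ : IsPrimitiveRoot ζ n) (k : ℕ) :
    (finRotate n ^ k).partition.parts =
      Multiset.replicate (n / orderOf (ζ ^ k)) (orderOf (ζ ^ k)) := by
  have horder : orderOf (finRotate n ^ k) = orderOf (ζ ^ k) := by
    refine orderOf_eq_orderOf_iff.2 fun m => ?_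
    rw [← pow_mul, ← pow_mul, hζ.pow_eq_one_iff_dvd, ← orderOf_dvd_iff_pow_eq_one,
      orderOf_finRotate hn]
  rw [← horder]
  refine parts_of_semiregular fun m x hx => ?_
  rw [← pow_mul] at hx ⊢
  exact finRotate_semiregular _ x hx

theorem sum_cyclicSubgroup {A : Type*} [AddCommMonoid A] {n : ℕ} (hn : n ≠ 0)
    [Fintype (cyclicSubgroup n)] (f : cyclicSubgroup n → A) :
    ∑ h, f h = ∑ k ∈ range n, f (cyclicGenerator n ^ k) := by
  classical
  have horder : orderOf (cyclicGenerator n) = n := by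
    rw [← Subgroup.orderOf_coe]
    exact orderOf_finRotate hn
  rw [← IsCyclic.image_range_orderOf (mem_zpowers_cyclicGenerator n), horder, sum_image]
  convert pow_injOn_Iio_orderOf (x := cyclicGenerator n) using 1
  rw [horder, coe_range]

theorem ch_mul_lieCharacter {n : ℕ} (hn : n ≠ 0) {t : Perm (Fin n) → ℂ} (ht : IsClassFunction t)
    {η : ℕ → ℂ} (htη : ∀ w, t w = η (Multiset.card w.partition.parts)) :
    (n : ℂ) • ch n (fun w => t w * lieCharacter n w) =
      ∑ x ∈ n.divisorsAntidiagonal, (η x.2 * primitiveSum x.1) • psum x.1 ^ x.2 := by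
  classical
  have hcard : Nat.card (cyclicSubgroup n) = n := by
    rw [cyclicSubgroup, Nat.card_zpowers, orderOf_finRotate hn]
  have hζ := Complex.isPrimitiveRoot_exp n hn
  set ζ := Complex.exp (2 * Real.pi * Complex.I / n)
  have hterm (k : ℕ) : ((cyclicCharacter n (cyclicGenerator n ^ k) : ℂˣ) : ℂ) •
      t (finRotate n ^ k) • cyclePsum (finRotate n ^ k) = ζ ^ k • η (n / orderOf (ζ ^ k)) •
        psum (orderOf (ζ ^ k)) ^ (n / orderOf (ζ ^ k)) := by
    rw [map_pow, cyclicCharacter, monoidHomOfForallMemZpowers_apply_gen, Units.val_pow_eq_pow_val,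
      htη, cyclePsum, parts_finRotate_pow hn hζ, Multiset.card_replicate, Multiset.map_replicate,
      Multiset.prod_replicate]
    rfl
  unfold lieCharacter
  rw [ch_mul_inducedCharacter _ _ ht, hcard, smul_inv_smul₀ (Nat.cast_ne_zero.2 hn),
    sum_cyclicSubgroup hn]
  refine (sum_congr rfl fun k _ => hterm k).trans ?_
  rw [← sum_primitiveRoots hn hζ fun z =>
      z • η (n / orderOf z) • psum (orderOf z) ^ (n / orderOf z),
    Nat.sum_divisorsAntidiagonal fun d e => (η e * primitiveSum d) • psum d ^ e]
  refine sum_congr rfl fun d _ => ?_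
  rw [primitiveSum, mul_comm, mul_smul, sum_smul]
  refine sum_congr rfl fun z hz => ?_
  rw [← (isPrimitiveRoot_of_mem_primitiveRoots hz).eq_orderOf]

theorem smul_ell {n : ℕ} (hn : n ≠ 0) : (n : ℂ) • ell n =
    ∑ x ∈ n.divisorsAntidiagonal, (1 * primitiveSum x.1) • psum x.1 ^ x.2 := by
  have h := ch_mul_lieCharacter hn (t := fun _ => 1) (fun _ _ => rfl) (η := fun _ => 1)
    fun _ => rfl
  simpa only [ell, one_mul] using h

theorem smul_piSymm {n : ℕ} (hn : n ≠ 0) : (n : ℂ) • piSymm n =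
    ∑ x ∈ n.divisorsAntidiagonal, ((-1) ^ (n + x.2) * primitiveSum x.1) • psum x.1 ^ x.2 :=
  ch_mul_lieCharacter hn
    (fun g h => by
      rw [map_mul, map_mul, Perm.sign_inv, mul_right_comm, Int.units_mul_self, one_mul])
    (η := fun e => (-1) ^ (n + e)) sign_eq_neg_one_pow

/-! ### The generating functions of the hat characters -/

theorem isClassFunction_lieHat (n : ℕ) : IsClassFunction (lieHat n) :=
  isClassFunction_sum_hat (fun j => ch_mem_symSpan j _) (fun _ => 1) lieChar_eq

theorem isClassFunction_whitneyHat (n : ℕ) : IsClassFunction (whitneyHat n) :=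
  isClassFunction_sum_hat (fun j => ch_mem_symSpan j _) whitneySign whitneyChar_eq

/-- The generating function of the characteristics of the `lieHat n`. -/
def lieHatSeries : PowerSeries Series := PowerSeries.mk fun n => ch n (lieHat n)

/-- The generating function of the characteristics of the `whitneyHat n`. -/
def whitneyHatSeries : PowerSeries Series := PowerSeries.mk fun n => ch n (whitneyHat n)

theorem lieHatSeries_eq :
    lieHatSeries = partitionSeries (fun _ => 1) (Function.update ell 1 0) := by
  ext1 n
  rw [lieHatSeries, PowerSeries.coeff_mk]
  exact ch_sum_hat (fun j => ch_mem_symSpan j _) (fun _ => 1) lieChar_eq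

theorem whitneyHatSeries_eq :
    whitneyHatSeries = partitionSeries whitneySign (Function.update piSymm 1 0) := by
  ext1 n
  rw [whitneyHatSeries, PowerSeries.coeff_mk]
  exact ch_sum_hat (fun j => ch_mem_symSpan j _) whitneySign whitneyChar_eq

theorem hsymm_mul_lieHatSeries :
    (PowerSeries.mk fun m => hsymm (m : ℕ)) * lieHatSeries =
      PowerSeries.mk fun r => psum 1 ^ r := by
  rw [lieHatSeries_eq]
  exact hsymm_mul_partitionSeries_lie fun _ => smul_ell

theorem hsymm_mul_whitneyHatSeries :
    (PowerSeries.mk fun m => hsymm (m : ℕ)) * whitneyHatSeries =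
      (1 + PowerSeries.C (psum 2) * PowerSeries.X ^ 2) * PowerSeries.mk fun r => psum 1 ^ r := by
  rw [whitneyHatSeries_eq]
  exact hsymm_mul_partitionSeries_whitney fun _ => smul_piSymm

end LieCharacters

section JacobiTrudi

open Finset

/-! ### Jacobi-Trudi determinants and the Pieri rule -/

/-- The Jacobi-Trudi matrix with rows `h_{b_i}, h_{b_i + 1}, …`. -/
def jtMatrix {N : ℕ} (b : Fin N → ℤ) : Matrix (Fin N) (Fin N) Series :=
  Matrix.of fun i j => hsymm (b i + (j : ℤ))

theorem jtMatrix_apply {N : ℕ} (b : Fin N → ℤ) (i j : Fin N) :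
    jtMatrix b i j = hsymm (b i + (j : ℤ)) := rfl

/-- The Jacobi-Trudi determinant of the first `N` terms of a sequence of row lengths. -/
def jtDet (N : ℕ) (r : ℕ → ℕ) : Series :=
  (jtMatrix fun i : Fin N => (r i : ℤ) - (i : ℤ)).det

theorem det_of_last_row {R : Type*} [CommRing R] {N : ℕ}
    (A : Matrix (Fin (N + 1)) (Fin (N + 1)) R) (h : ∀ j : Fin N, A (Fin.last N) j.castSucc = 0) :
    A.det = A (Fin.last N) (Fin.last N) * (A.submatrix Fin.castSucc Fin.castSucc).det := by
  rw [Matrix.det_succ_row A (Fin.last N), Fin.sum_univ_castSucc,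
    sum_eq_zero fun j _ => by rw [h, mul_zero, zero_mul], zero_add, Even.neg_one_pow ⟨_, rfl⟩,
    one_mul, Fin.succAbove_last]

theorem jtDet_succ {N : ℕ} {r : ℕ → ℕ} (h : r N = 0) : jtDet (N + 1) r = jtDet N r := by
  rw [jtDet, det_of_last_row]
  · rw [jtMatrix_apply, Fin.val_last, h, sub_add_cancel, Nat.cast_zero, hsymm_zero, one_mul]
    rfl
  · intro j
    refine hsymm_of_neg ?_
    simp [h, j.2]

theorem jtDet_eq {N M : ℕ} (hNM : N ≤ M) {r : ℕ → ℕ} (h : ∀ i, N ≤ i → r i = 0) :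
    jtDet M r = jtDet N r := by
  induction M, hNM using Nat.le_induction with
  | base => rfl
  | succ M hM ih => rw [jtDet_succ (h M hM), ih]

theorem rowLen_eq_zero_iff {μ : YoungDiagram} {i : ℕ} : μ.rowLen i = 0 ↔ μ.colLen 0 ≤ i := by
  rw [← not_lt, ← YoungDiagram.mem_iff_lt_colLen, YoungDiagram.mem_iff_lt_rowLen, not_lt,
    Nat.le_zero]

theorem schur_eq_jtDet {μ : YoungDiagram} {N : ℕ} (h : μ.rowLen N = 0) :
    schur μ = jtDet N μ.rowLen := by
  rw [jtDet_eq (rowLen_eq_zero_iff.1 h) fun i hi => rowLen_eq_zero_iff.2 hi]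
  rfl

theorem jtDet_congr {N : ℕ} {r r' : ℕ → ℕ} (h : ∀ i < N, r i = r' i) : jtDet N r = jtDet N r' := by
  rw [jtDet, jtDet]
  congr 2
  funext i
  rw [h i i.2]

/-- Both sides are the trace of `adjugate A * B`. -/
theorem sum_det_updateRow {R ι : Type*} [CommRing R] [Fintype ι] [DecidableEq ι]
    (A B : Matrix ι ι R) :
    ∑ i, (A.updateRow i (B i)).det = ∑ j, (A.updateCol j fun i => B i j).det := by
  have hrow (i : ι) : (A.updateRow i (B i)).det = ∑ j, A.adjugate j i * B i j := by
    rw [← Matrix.det_transpose, ← Matrix.updateCol_transpose, ← Matrix.cramer_apply,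
      Matrix.cramer_eq_adjugate_mulVec, ← Matrix.adjugate_transpose]
    rfl
  have hcol (j : ι) : (A.updateCol j fun i => B i j).det = ∑ i, A.adjugate j i * B i j := by
    rw [← Matrix.cramer_apply, Matrix.cramer_eq_adjugate_mulVec]
    rfl
  simp_rw [hrow, hcol]
  exact sum_comm

theorem jtMatrix_updateRow {N : ℕ} (b : Fin N → ℤ) (i : Fin N) :
    (jtMatrix b).updateRow i (fun j => hsymm (b i + (j : ℤ) + 1)) =
      jtMatrix (Function.update b i (b i + 1)) := by
  ext1 k j
  rw [Matrix.updateRow_apply, jtMatrix_apply, jtMatrix_apply, Function.update_apply]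
  split_ifs
  · rw [add_right_comm]
  · rfl

theorem det_jtMatrix_updateCol_castSucc {N : ℕ} (b : Fin (N + 1) → ℤ) (j : Fin N) :
    ((jtMatrix b).updateCol j.castSucc fun i => hsymm (b i + (j.castSucc : ℕ) + 1)).det = 0 := by
  have hne : j.castSucc ≠ j.succ := Fin.castSucc_lt_succ.ne
  refine Matrix.det_zero_of_column_eq hne fun k => ?_
  rw [Matrix.updateCol_self, Matrix.updateCol_ne hne.symm, jtMatrix_apply, Fin.val_castSucc,
    Fin.val_succ, Nat.cast_succ, add_assoc]

/-- Shifting the column `j < N` of a Jacobi-Trudi matrix makes it equal to its successor, so that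
of the column shifts only the last one contributes. -/
theorem sum_det_jtMatrix_update {N : ℕ} (b : Fin (N + 1) → ℤ) :
    ∑ i, (jtMatrix (Function.update b i (b i + 1))).det =
      ((jtMatrix b).updateCol (Fin.last N) fun i => hsymm (b i + (N : ℤ) + 1)).det := by
  simp_rw [← jtMatrix_updateRow]
  rw [sum_det_updateRow (jtMatrix b) fun i j => hsymm (b i + (j : ℤ) + 1), Fin.sum_univ_castSucc,
    sum_eq_zero fun j _ => det_jtMatrix_updateCol_castSucc b j, zero_add]
  rfl

theorem det_jtMatrix_updateCol_last {N : ℕ} {r : ℕ → ℕ} (h : r N = 0) :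
    ((jtMatrix fun i : Fin (N + 1) => (r i : ℤ) - (i : ℤ)).updateCol (Fin.last N) fun i =>
      hsymm ((r i : ℤ) - (i : ℤ) + (N : ℤ) + 1)).det = hsymm 1 * jtDet N r := by
  rw [det_of_last_row]
  · congr 1
    · rw [Matrix.updateCol_self, Fin.val_last, h, sub_add_cancel, Nat.cast_zero, zero_add]
    · rw [jtDet]
      congr 1
      ext1 i j
      rw [Matrix.submatrix_apply, Matrix.updateCol_ne (Fin.castSucc_ne_last j)]
      rfl
  · intro j
    rw [Matrix.updateCol_ne (Fin.castSucc_ne_last j)]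
    refine hsymm_of_neg ?_
    simp [h, j.2]

/-- A row of the given row lengths can be extended by one cell. -/
def Addable (r : ℕ → ℕ) (i : ℕ) : Prop := ∀ k, k + 1 = i → r i < r k

theorem jtDet_update_of_not_addable {N i : ℕ} {r : ℕ → ℕ} (hr : Antitone r) (hi : i < N)
    (hadd : ¬Addable r i) : jtDet N (Function.update r i (r i + 1)) = 0 := by
  simp only [Addable, not_forall, not_lt] at hadd
  obtain ⟨k, rfl, hle⟩ := hadd
  have heq : r k = r (k + 1) := le_antisymm hle (hr k.le_succ)
  refine Matrix.det_zero_of_row_eq (i := ⟨k, k.lt_succ_self.trans hi⟩) (j := ⟨k + 1, hi⟩)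
    (by simp) ?_
  funext j
  rw [jtMatrix_apply, jtMatrix_apply, Function.update_self,
    Function.update_of_ne k.lt_succ_self.ne, heq]
  push_cast
  ring_nf

open Classical in
theorem pieri {N : ℕ} {r : ℕ → ℕ} (hr : Antitone r) (h : r N = 0) :
    hsymm 1 * jtDet N r = ∑ i ∈ range (N + 1),
      if Addable r i then jtDet (N + 1) (Function.update r i (r i + 1)) else 0 := by
  rw [← det_jtMatrix_updateCol_last h, ← sum_det_jtMatrix_update, sum_range]
  refine sum_congr rfl fun i _ => ?_
  have hextend : (fun k : Fin (N + 1) => (Function.update r i (r i + 1) k : ℤ) - (k : ℤ)) =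
      Function.update (fun k : Fin (N + 1) => (r k : ℤ) - (k : ℤ)) i (r i - (i : ℤ) + 1) := by
    funext k
    obtain rfl | hne := eq_or_ne k i
    · rw [Function.update_self, Function.update_self]
      push_cast
      ring
    · rw [Function.update_of_ne hne, Function.update_of_ne (Fin.val_ne_of_ne hne)]
  rw [← hextend, ← jtDet]
  split_ifs with hadd
  · rfl
  · exact jtDet_update_of_not_addable hr i.2 hadd

/-! ### Hooks -/

/-- The row lengths of the hook with first row `a` and `m` rows in total. -/
def hookRows (a m : ℕ) (i : ℕ) : ℕ := if i < m then if i = 0 then a else 1 else 0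

/-- The Schur function of a column, which is `e_n`. -/
def colSchur (n : ℕ) : Series := jtDet n (hookRows 1 n)

theorem jtDet_hookRows_one (a : ℕ) : jtDet 1 (hookRows a 1) = hsymm a := by
  rw [jtDet, Matrix.det_unique, jtMatrix_apply]
  simp [hookRows]

theorem colSchur_zero : colSchur 0 = 1 := by
  rw [colSchur, jtDet, Matrix.det_isEmpty]

theorem colSchur_one : colSchur 1 = hsymm 1 := jtDet_hookRows_one 1

/-- The Laplace expansion along the first column, which starts with `h_a, 1, 0, …`. -/
theorem jtDet_hookRows_succ (a m : ℕ) :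
    jtDet (m + 2) (hookRows a (m + 2)) =
      hsymm a * colSchur (m + 1) - jtDet (m + 1) (hookRows (a + 1) (m + 1)) := by
  set A := jtMatrix fun i : Fin (m + 2) => (hookRows a (m + 2) i : ℤ) - (i : ℤ) with hA
  have htop : A 0 0 = hsymm a := by simp [hA, jtMatrix_apply, hookRows]
  have hone : A 1 0 = 1 := by simp [hA, jtMatrix_apply, hookRows, hsymm_zero]
  have hzero (i : Fin m) : A i.succ.succ 0 = 0 := by
    refine hsymm_of_neg ?_
    simp only [hookRows, Fin.val_succ, Fin.val_zero]
    split_ifs <;> lia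
  have hsucc (i : Fin m) : (1 : Fin (m + 2)).succAbove i.succ = i.succ.succ :=
    Fin.succAbove_of_lt_succ _ _ (by simp [Fin.lt_def])
  have hminor_zero : (A.submatrix (Fin.succAbove 0) Fin.succ).det = colSchur (m + 1) := by
    rw [colSchur, jtDet]
    congr 1
    ext1 i j
    simp only [hA, Matrix.submatrix_apply, Fin.zero_succAbove, jtMatrix_apply, hookRows]
    congr 1
    simp
    ring
  have hminor_one : (A.submatrix (Fin.succAbove 1) Fin.succ).det =
      jtDet (m + 1) (hookRows (a + 1) (m + 1)) := by
    rw [jtDet]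
    congr 1
    ext1 i j
    simp only [hA, Matrix.submatrix_apply, jtMatrix_apply, hookRows]
    congr 1
    refine Fin.cases ?_ (fun i => ?_) i
    · simp
      ring
    · rw [hsucc]
      simp
      ring
  rw [jtDet, ← hA, Matrix.det_succ_column_zero, Fin.sum_univ_succ, Fin.sum_univ_succ,
    sum_eq_zero fun i _ => by rw [hzero, mul_zero, zero_mul], Fin.succ_zero_eq_one, htop, hone,
    hminor_zero, hminor_one, Fin.val_zero, Fin.val_one]
  ring

theorem jtDet_hookRows_eq_sum (m : ℕ) : ∀ a, jtDet (m + 1) (hookRows a (m + 1)) =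
    ∑ k ∈ range (m + 1), (-1) ^ k * hsymm ((a + k : ℕ) : ℤ) * colSchur (m - k) := by
  induction m with
  | zero => intro a; simp [jtDet_hookRows_one, colSchur_zero]
  | succ m ih =>
    intro a
    rw [jtDet_hookRows_succ, ih, sum_range_succ' _ (m + 1)]
    simp only [pow_zero, one_mul, Nat.sub_zero, add_zero, Nat.add_sub_add_right]
    rw [sub_eq_add_neg, add_comm, ← sum_neg_distrib]
    congr 1
    refine sum_congr rfl fun k _ => ?_
    rw [add_right_comm, add_assoc, pow_succ]
    ring

/-- The generating function of the Schur functions of columns, with signs. -/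
def colSeries : PowerSeries Series := PowerSeries.mk fun n => (-1) ^ n * colSchur n

theorem colSeries_mul_hsymm : colSeries * (PowerSeries.mk fun m => hsymm (m : ℕ)) = 1 := by
  ext1 n
  rw [colSeries, mul_comm, PowerSeries.coeff_mul, PowerSeries.coeff_one,
    Nat.sum_antidiagonal_eq_sum_range_succ_mk]
  simp only [PowerSeries.coeff_mk]
  rcases n with _ | n
  · simp [hsymm_zero, colSchur_zero]
  rw [sum_range_succ', if_neg n.succ_ne_zero]
  simp only [Nat.sub_zero, Nat.cast_zero, hsymm_zero, one_mul, Nat.add_sub_add_right]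
  have hcol : colSchur (n + 1) = _ := jtDet_hookRows_eq_sum n 1
  rw [hcol, mul_sum, ← sum_add_distrib]
  refine sum_eq_zero fun k hk => ?_
  obtain ⟨e, rfl⟩ := Nat.exists_eq_add_of_le (mem_range_succ_iff.1 hk)
  have hsign : (-1 : Series) ^ (k + e + 1) * (-1) ^ k = -(-1) ^ e := by
    have hsq : (-1 : Series) ^ k * (-1) ^ k = 1 := by
      rw [← mul_pow, neg_one_mul, neg_neg, one_pow]
    rw [pow_succ, pow_add]
    linear_combination -(-1 : Series) ^ e * hsq
  rw [Nat.add_sub_cancel_left, add_comm 1 k]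
  linear_combination (hsymm ((k + 1 : ℕ) : ℤ) * colSchur e) * hsign

theorem hsymm_one : hsymm 1 = psum 1 := by
  simpa [hsymm_zero] using hsymm_newton 0

theorem psum_two : psum 2 = 2 * hsymm 2 - hsymm 1 ^ 2 := by
  have hnewton := hsymm_newton 1
  rw [sum_range_succ, sum_range_one] at hnewton
  simp only [Nat.sub_self, Nat.sub_zero, Nat.cast_zero, hsymm_zero, zero_add, Nat.cast_one,
    hsymm_one, Nat.cast_ofNat, one_add_one_eq_two, ofNat_smul_eq_nsmul,
    nsmul_eq_mul] at hnewton
  rw [hsymm_one, hnewton]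
  ring

/-- The row lengths of the shape `(2, 2, 1, …, 1)` with `m + 2` rows. -/
def twoTwoRows (m : ℕ) (i : ℕ) : ℕ := if i < 2 then 2 else if i < m + 2 then 1 else 0

theorem antitone_hookRows {a : ℕ} (ha : a ≠ 0) (m : ℕ) : Antitone (hookRows a m) := by
  intro i j hij
  simp only [hookRows]
  split_ifs <;> lia

theorem addable_hookRows_two {m i : ℕ} :
    Addable (hookRows 2 (m + 2)) i ↔ i = 0 ∨ i = 1 ∨ i = m + 2 := by
  rcases i with _ | i
  · simp [Addable]
  · simp only [Addable, hookRows, Nat.add_right_cancel_iff, forall_eq]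
    split_ifs <;> lia

theorem hsymm_one_mul_hook (m : ℕ) :
    hsymm 1 * jtDet (m + 2) (hookRows 2 (m + 2)) =
      jtDet (m + 2) (hookRows 3 (m + 2)) + jtDet (m + 2) (twoTwoRows m) +
        jtDet (m + 3) (hookRows 2 (m + 3)) := by
  classical
  set r := hookRows 2 (m + 2) with hr
  have hfirst : jtDet (m + 3) (Function.update r 0 (r 0 + 1)) =
      jtDet (m + 2) (hookRows 3 (m + 2)) := by
    rw [jtDet_succ (N := m + 2) (by simp [hr, hookRows])]
    refine jtDet_congr fun i _ => ?_
    simp only [hr, Function.update_apply, hookRows]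
    split_ifs <;> lia
  have hsecond : jtDet (m + 3) (Function.update r 1 (r 1 + 1)) =
      jtDet (m + 2) (twoTwoRows m) := by
    rw [jtDet_succ (N := m + 2) (by simp [hr, hookRows])]
    refine jtDet_congr fun i _ => ?_
    simp only [hr, Function.update_apply, hookRows, twoTwoRows]
    split_ifs <;> lia
  have hlast : jtDet (m + 3) (Function.update r (m + 2) (r (m + 2) + 1)) =
      jtDet (m + 3) (hookRows 2 (m + 3)) := by
    refine jtDet_congr fun i _ => ?_
    simp only [hr, Function.update_apply, hookRows]
    split_ifs <;> lia
  rw [pieri (antitone_hookRows two_ne_zero _) (by simp [hookRows]), sum_range_succ,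
    sum_range_succ', sum_range_succ', sum_eq_zero, zero_add, zero_add,
    if_pos (addable_hookRows_two.2 (.inr (.inl rfl))), if_pos (addable_hookRows_two.2 (.inl rfl)),
    if_pos (addable_hookRows_two.2 (.inr (.inr rfl))), hfirst, hsecond, hlast,
    add_comm (jtDet _ (twoTwoRows m))]
  intro i hi
  rw [mem_range] at hi
  rw [if_neg]
  rw [addable_hookRows_two]
  lia

theorem colSchur_add_psum_two (m : ℕ) :
    colSchur (m + 3) + psum 2 * colSchur (m + 1) =
      jtDet (m + 1) (hookRows 3 (m + 1)) -
        match m with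
        | 0 => 0
        | m + 1 => jtDet (m + 2) (twoTwoRows m) := by
  have hcol (m : ℕ) : colSchur (m + 2) =
      hsymm 1 * colSchur (m + 1) - jtDet (m + 1) (hookRows 2 (m + 1)) :=
    jtDet_hookRows_succ 1 m
  have hhook (m : ℕ) : jtDet (m + 2) (hookRows 2 (m + 2)) =
      hsymm 2 * colSchur (m + 1) - jtDet (m + 1) (hookRows 3 (m + 1)) :=
    jtDet_hookRows_succ 2 m
  rw [psum_two]
  rcases m with _ | m
  · have htwo : colSchur 2 = hsymm 1 * hsymm 1 - hsymm 2 := by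
      rw [hcol, colSchur_one, jtDet_hookRows_one, Nat.cast_ofNat]
    have hthree := hcol 1
    rw [hhook 0] at hthree
    simp only [zero_add, Nat.reduceAdd, colSchur_one] at hthree ⊢
    linear_combination hthree + hsymm 1 * htwo
  · have hpieri := hsymm_one_mul_hook m
    have hthree := hcol (m + 2)
    simp only [add_assoc, Nat.reduceAdd] at hpieri hthree ⊢
    linear_combination hthree + hsymm 1 * hcol (m + 1) - hpieri - 2 * hhook (m + 1)

end JacobiTrudi

section VirtualCharacters

open Finset

/-! ### Virtual characters of a finite group -/

variable {G : Type} [Group G]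

section Representation

variable {V : Type*} [AddCommGroup V] [Module ℂ V] {ρ : Representation ℂ G V}

theorem isIrreducible_of_equiv {W : Type*} [AddCommGroup W] [Module ℂ W]
    {σ : Representation ℂ G W} (e : ρ.Equiv σ) (hρ : ρ.IsIrreducible) : σ.IsIrreducible := by
  rw [Representation.irreducible_iff_isSimpleModule_asModule] at hρ ⊢
  let f := Representation.IntertwiningMap.equivLinearMapAsModule ρ σ e.toIntertwiningMap
  exact (LinearEquiv.ofBijective f e.toLinearEquiv.bijective).isSimpleModule_iff.1 hρ

theorem exists_isCompl_of_not_isIrreducible [Finite G] [Nontrivial V] (hρ : ¬ρ.IsIrreducible) :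
    ∃ p q : Subrepresentation ρ, IsCompl p q ∧ p ≠ ⊤ ∧ q ≠ ⊤ := by
  have : Nontrivial (Subrepresentation ρ) := ⟨⊥, ⊤, fun h =>
    (bot_ne_top : (⊥ : Submodule ℂ V) ≠ ⊤) (congrArg Subrepresentation.toSubmodule h)⟩
  obtain ⟨p, hbot, htop⟩ : ∃ p : Subrepresentation ρ, p ≠ ⊥ ∧ p ≠ ⊤ := by
    by_contra! hcon
    exact hρ { eq_bot_or_eq_top := fun p => or_iff_not_imp_left.2 (hcon p) }
  have : NeZero (Nat.card G : ℂ) := ⟨Nat.cast_ne_zero.2 Nat.card_pos.ne'⟩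
  obtain ⟨q, hpq⟩ := exists_isCompl p
  refine ⟨p, q, hpq, htop, ?_⟩
  rintro rfl
  exact hbot (disjoint_top.1 hpq.disjoint)

variable [FiniteDimensional ℂ V]

theorem isIrreducibleCharacter_of_isIrreducible (hρ : ρ.IsIrreducible) :
    IsIrreducibleCharacter ρ.character := by
  let e := (Module.finBasis ℂ V).equivFun
  let σ : Representation ℂ G (Fin (Module.finrank ℂ V) → ℂ) :=
    (e.conjRingEquiv : Module.End ℂ V →* Module.End ℂ _).comp ρ
  let f : ρ.Equiv σ := .mk e fun g => by ext1 v; simp [σ]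
  exact ⟨_, σ, isIrreducible_of_equiv f hρ, (Representation.char_iso f).symm⟩

theorem character_eq_add_of_isCompl {p q : Subrepresentation ρ} (h : IsCompl p q) :
    ρ.character = p.toRepresentation.character + q.toRepresentation.character := by
  have hsub : IsCompl p.toSubmodule q.toSubmodule := by
    refine ⟨disjoint_iff.2 ?_, codisjoint_iff.2 ?_⟩
    · rw [← Subrepresentation.toSubmodule_inf, h.inf_eq_bot]
      rfl
    · rw [← Subrepresentation.toSubmodule_sup, h.sup_eq_top]
      rfl
  have hinternal : DirectSum.IsInternal fun b : Bool => cond b p.toSubmodule q.toSubmodule :=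
    (DirectSum.isInternal_submodule_iff_isCompl _ (i := true) (j := false) (by decide)
      (by ext b; cases b <;> simp)).2 hsub
  funext g
  have htrace := LinearMap.trace_eq_sum_trace_restrict hinternal (f := ρ g) (by
    rintro (_ | _)
    · exact q.apply_mem_toSubmodule g
    · exact p.apply_mem_toSubmodule g)
  rwa [Fintype.sum_bool] at htrace

end Representation

variable (G) in
/-- The group of virtual characters. -/
def virtualCharacters : AddSubgroup (G → ℂ) := AddSubgroup.closure {χ | IsIrreducibleCharacter χ}

theorem character_mem_virtualCharacters [Finite G] {V : Type*} [AddCommGroup V] [Module ℂ V]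
    [FiniteDimensional ℂ V] (ρ : Representation ℂ G V) : ρ.character ∈ virtualCharacters G := by
  induction hd : Module.finrank ℂ V using Nat.strong_induction_on generalizing V with
  | _ d ih =>
  by_cases hρ : ρ.IsIrreducible
  · exact AddSubgroup.subset_closure (isIrreducibleCharacter_of_isIrreducible hρ)
  obtain hV | hV := subsingleton_or_nontrivial V
  · have hzero : ρ.character = 0 := by
      funext g
      rw [Representation.character, Subsingleton.elim (ρ g) 0, map_zero, Pi.zero_apply]
    rw [hzero]
    exact zero_mem _
  · obtain ⟨p, q, hpq, hp, hq⟩ := exists_isCompl_of_not_isIrreducible hρ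
    have hlt (r : Subrepresentation ρ) (hr : r ≠ ⊤) : Module.finrank ℂ r.toSubmodule < d := by
      rw [← hd]
      exact Submodule.finrank_lt fun h => hr (Subrepresentation.toSubmodule_injective h)
    rw [character_eq_add_of_isCompl hpq]
    exact add_mem (ih _ (hlt p hp) _ rfl) (ih _ (hlt q hq) _ rfl)

theorem card_fixed_mem_virtualCharacters [Finite G] {X : Type*} [Fintype X] [DecidableEq X]
    (φ : G →* Equiv.Perm X) :
    (fun g => ((univ.filter fun x => φ g x = x).card : ℂ)) ∈ virtualCharacters G := by
  let ρ : Representation ℂ G (X → ℂ) :=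
    { toFun := fun g => LinearMap.funLeft ℂ ℂ (φ g⁻¹)
      map_one' := by ext; simp [LinearMap.funLeft]
      map_mul' := fun a b => by ext; simp [LinearMap.funLeft] }
  have hcharacter : ρ.character = fun g => ((univ.filter fun x => φ g x = x).card : ℂ) := by
    funext g
    rw [Representation.character, LinearMap.trace_eq_matrix_trace ℂ (Pi.basisFun ℂ X),
      Matrix.trace, card_filter, Nat.cast_sum]
    refine sum_congr rfl fun x _ => ?_
    have hfix : (φ g).symm x = x ↔ φ g x = x := by rw [Equiv.symm_apply_eq, eq_comm]
    rw [Matrix.diag_apply, LinearMap.toMatrix_apply]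
    simp [ρ, LinearMap.funLeft, Pi.single_apply, hfix]
  rw [← hcharacter]
  exact character_mem_virtualCharacters ρ

theorem exists_sum_irreducible {f : G → ℂ} (hf : f ∈ virtualCharacters G) :
    ∃ (s : Finset (G → ℂ)) (a : (G → ℂ) → ℤ), (∀ χ ∈ s, IsIrreducibleCharacter χ) ∧
      f = ∑ χ ∈ s, (a χ : ℂ) • χ := by
  rw [virtualCharacters, ← Submodule.span_int_eq_addSubgroupClosure, Submodule.mem_toAddSubgroup,
    Submodule.mem_span_set] at hf
  obtain ⟨c, hc, rfl⟩ := hf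
  refine ⟨c.support, c, fun χ hχ => hc hχ, sum_congr rfl fun χ _ => ?_⟩
  rw [Int.cast_smul_eq_zsmul]

variable [Fintype G]

/-- The bilinear form on functions for which the irreducible characters are orthonormal. -/
def charForm (f g : G → ℂ) : ℂ := (Nat.card G : ℂ)⁻¹ * ∑ w, f w * g w⁻¹

open Classical in
theorem charForm_irreducible {χ ψ : G → ℂ} (hχ : IsIrreducibleCharacter χ)
    (hψ : IsIrreducibleCharacter ψ) : charForm χ ψ = if χ = ψ then 1 else 0 := by
  have : Invertible (Nat.card G : ℂ) :=
    invertibleOfNonzero (Nat.cast_ne_zero.2 Nat.card_pos.ne')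
  obtain ⟨d, ρ, hρ, rfl⟩ := hχ
  split_ifs with heq
  · rw [← heq, charForm, Representation.char_orthonormal, if_pos ⟨Representation.Equiv.refl ρ⟩]
  · obtain ⟨d', σ, hσ, rfl⟩ := hψ
    rw [charForm, Representation.char_orthonormal, if_neg]
    rintro ⟨e⟩
    exact heq (Representation.char_iso e).symm

theorem charForm_sum {ι : Type*} (s : Finset ι) (a : ι → ℂ) (f : ι → G → ℂ) (g : G → ℂ) :
    charForm (∑ i ∈ s, a i • f i) g = ∑ i ∈ s, a i * charForm (f i) g := by
  simp only [charForm, Finset.sum_apply, Pi.smul_apply, smul_eq_mul, sum_mul, mul_sum]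
  rw [sum_comm]
  refine sum_congr rfl fun i _ => sum_congr rfl fun w _ => ?_
  ring

theorem sum_charForm {ι : Type*} (s : Finset ι) (a : ι → ℂ) (f : ι → G → ℂ) (g : G → ℂ) :
    charForm g (∑ i ∈ s, a i • f i) = ∑ i ∈ s, a i * charForm g (f i) := by
  simp only [charForm, Finset.sum_apply, Pi.smul_apply, smul_eq_mul, mul_sum]
  rw [sum_comm]
  refine sum_congr rfl fun i _ => sum_congr rfl fun w _ => ?_
  ring

theorem charForm_sum_irreducible {s : Finset (G → ℂ)} (hs : ∀ χ ∈ s, IsIrreducibleCharacter χ)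
    (a : (G → ℂ) → ℂ) :
    charForm (∑ χ ∈ s, a χ • χ) (∑ χ ∈ s, a χ • χ) = ∑ χ ∈ s, a χ ^ 2 := by
  classical
  rw [charForm_sum]
  refine sum_congr rfl fun χ hχ => ?_
  rw [sum_charForm, sum_congr rfl fun ψ hψ => by rw [charForm_irreducible (hs χ hχ) (hs ψ hψ)],
    sum_mul_boole, if_pos hχ, sq]

theorem exists_eq_of_sum_sq_eq_one {ι : Type*} {s : Finset ι} {a : ι → ℤ}
    (h : ∑ i ∈ s, a i ^ 2 = 1) :
    ∃ i ∈ s, (a i = 1 ∨ a i = -1) ∧ ∀ j ∈ s, j ≠ i → a j = 0 := by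
  classical
  obtain ⟨i, hi, hne⟩ : ∃ i ∈ s, a i ^ 2 ≠ 0 := exists_ne_zero_of_sum_ne_zero (h ▸ one_ne_zero)
  rw [← add_sum_erase s _ hi] at h
  have hrest : 0 ≤ ∑ j ∈ s.erase i, a j ^ 2 := sum_nonneg fun _ _ => sq_nonneg _
  have hone : a i ^ 2 = 1 := le_antisymm (by lia) (lt_of_le_of_ne (sq_nonneg _) hne.symm)
  have hzero : ∑ j ∈ s.erase i, a j ^ 2 = 0 := by lia
  refine ⟨i, hi, by simpa using hone, fun j hj hji => ?_⟩
  exact pow_eq_zero_iff two_ne_zero |>.1 <|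
    (sum_eq_zero_iff_of_nonneg fun _ _ => sq_nonneg _).1 hzero j (mem_erase.2 ⟨hji, hj⟩)

theorem isIrreducibleCharacter_of_virtual {f : G → ℂ} (hf : f ∈ virtualCharacters G)
    (hnorm : charForm f f = 1) (hpos : ∃ m : ℕ, 0 < m ∧ f 1 = m) : IsIrreducibleCharacter f := by
  obtain ⟨s, a, hs, rfl⟩ := exists_sum_irreducible hf
  rw [charForm_sum_irreducible hs fun χ => (a χ : ℂ)] at hnorm
  obtain ⟨χ, hχ, hunit, hother⟩ := exists_eq_of_sum_sq_eq_one (s := s) (a := a)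
    (by exact_mod_cast hnorm)
  rw [sum_eq_single_of_mem χ hχ fun ψ hψ hne => by rw [hother ψ hψ hne, Int.cast_zero, zero_smul]]
    at hpos ⊢
  obtain hone | hneg := hunit
  · rw [hone, Int.cast_one, one_smul]
    exact hs χ hχ
  · obtain ⟨m, hm, hdeg⟩ := hpos
    obtain ⟨d, ρ, -, hρ⟩ := hs χ hχ
    rw [hneg, Pi.smul_apply, ← hρ, Representation.char_one] at hdeg
    have hsum : ((m + Module.finrank ℂ (Fin d → ℂ) : ℕ) : ℂ) = 0 := by
      push_cast
      rw [← hdeg]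
      simp
    have := Nat.cast_eq_zero.1 hsum
    lia

end VirtualCharacters

section

open Finset

/-! ### The bialternant formula -/

section Bialternant

variable {σ : Type*} [DecidableEq σ]

/-- The sum of the monomials of degree `m` in the variables of a given set. -/
def hsymmOn (S : Finset σ) (m : ℕ) : MvPowerSeries σ ℂ :=
  fun d => if d.degree = m ∧ d.support ⊆ S then 1 else 0

theorem coeff_hsymmOn (S : Finset σ) (m : ℕ) (d : σ →₀ ℕ) :
    MvPowerSeries.coeff d (hsymmOn S m) = if d.degree = m ∧ d.support ⊆ S then 1 else 0 := rfl

theorem hsymmOn_zero (S : Finset σ) : hsymmOn S 0 = 1 := by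
  ext d
  rw [coeff_hsymmOn, MvPowerSeries.coeff_one]
  refine if_congr ⟨fun h => (Finsupp.degree_eq_zero_iff d).1 h.1, ?_⟩ rfl rfl
  rintro rfl
  simp

theorem hsymmOn_empty_succ (m : ℕ) : hsymmOn (∅ : Finset σ) (m + 1) = 0 := by
  ext d
  rw [coeff_hsymmOn, if_neg, map_zero]
  rintro ⟨hdeg, hsupp⟩
  rw [subset_empty, Finsupp.support_eq_empty] at hsupp
  simp [hsupp] at hdeg

theorem support_single_add (i : σ) (e : σ →₀ ℕ) :
    (Finsupp.single i 1 + e).support = insert i e.support := by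
  ext x
  by_cases hxi : x = i <;> simp [hxi]

theorem hsymmOn_insert {S : Finset σ} {i : σ} (hi : i ∉ S) (m : ℕ) :
    hsymmOn (insert i S) (m + 1) =
      hsymmOn S (m + 1) + MvPowerSeries.X i * hsymmOn (insert i S) m := by
  ext d
  rw [map_add, MvPowerSeries.X, MvPowerSeries.coeff_monomial_mul, one_mul, coeff_hsymmOn,
    coeff_hsymmOn]
  by_cases hid : Finsupp.single i 1 ≤ d
  · obtain ⟨e, rfl⟩ := exists_add_of_le hid
    rw [if_pos hid, add_tsub_cancel_left, coeff_hsymmOn, support_single_add,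
      if_neg (c := _ ∧ _ ⊆ S) fun h => hi (h.2 (mem_insert_self _ _)), zero_add]
    refine if_congr (and_congr ?_ ?_) rfl rfl
    · rw [map_add, Finsupp.degree_single]
      lia
    · rw [insert_subset_iff, and_iff_right (mem_insert_self i S)]
  · rw [if_neg hid, add_zero]
    refine if_congr (and_congr_right fun _ => subset_insert_iff_of_notMem ?_) rfl rfl
    rw [Finsupp.single_le_iff] at hid
    rw [Finsupp.mem_support_iff]
    lia

theorem mk_hsymmOn_insert_mul {S : Finset σ} {i : σ} (hi : i ∉ S) :
    PowerSeries.mk (hsymmOn (insert i S)) *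
      (1 - PowerSeries.C (MvPowerSeries.X (R := ℂ) i) * PowerSeries.X) =
        PowerSeries.mk (hsymmOn S) := by
  rw [mul_sub, mul_one, mul_left_comm]
  ext1 m
  rw [map_sub, PowerSeries.coeff_C_mul, PowerSeries.coeff_mk, PowerSeries.coeff_mk]
  rcases m with _ | m
  · rw [PowerSeries.coeff_zero_mul_X, mul_zero, sub_zero, hsymmOn_zero, hsymmOn_zero]
  · rw [PowerSeries.coeff_succ_mul_X, PowerSeries.coeff_mk, hsymmOn_insert hi, add_sub_cancel_right]

theorem mk_hsymmOn_mul_prod (S : Finset σ) :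
    PowerSeries.mk (hsymmOn S) *
      ∏ i ∈ S, (1 - PowerSeries.C (MvPowerSeries.X (R := ℂ) i) * PowerSeries.X) = 1 := by
  induction S using Finset.induction_on with
  | empty =>
    rw [prod_empty, mul_one]
    ext1 m
    rw [PowerSeries.coeff_mk, PowerSeries.coeff_one]
    rcases m with _ | m
    · rw [hsymmOn_zero, if_pos rfl]
    · rw [hsymmOn_empty_succ, if_neg (Nat.succ_ne_zero m)]
  | insert i S hi ih => rw [prod_insert hi, ← mul_assoc, mk_hsymmOn_insert_mul hi, ih]

variable {N : ℕ}

theorem truncVars_hsymm (m : ℕ) : truncVars N (hsymm m) = hsymmOn univ m := by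
  ext d
  rw [coeff_truncVars_hsymm, coeff_hsymmOn]
  congr 1
  simp

/-- The polynomial `∏_{i ≠ j} (1 - X_i t)` in `t`, whose coefficients are up to sign the elementary
symmetric polynomials in the variables other than `X_j`. -/
def omitPoly (j : Fin N) : Polynomial (MvPowerSeries (Fin N) ℂ) :=
  ∏ i ∈ univ.erase j, (1 - Polynomial.C (MvPowerSeries.X (R := ℂ) i) * Polynomial.X)

theorem coe_omitPoly (j : Fin N) : (omitPoly j : PowerSeries (MvPowerSeries (Fin N) ℂ)) =
    ∏ i ∈ univ.erase j, (1 - PowerSeries.C (MvPowerSeries.X (R := ℂ) i) * PowerSeries.X) := by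
  rw [omitPoly, ← Polynomial.coeToPowerSeries.ringHom_apply, map_prod]
  exact prod_congr rfl fun i _ => by simp

theorem coeff_omitPoly_eq_zero (j : Fin N) {q : ℕ} (hq : N ≤ q) : (omitPoly j).coeff q = 0 := by
  have hfactor : ∀ i ∈ univ.erase j, (1 - Polynomial.C (MvPowerSeries.X (R := ℂ) i) *
      Polynomial.X : Polynomial (MvPowerSeries (Fin N) ℂ)).natDegree ≤ 1 := by
    intro i _
    compute_degree
  have hdeg : (omitPoly j).natDegree ≤ N - 1 := by
    refine (Polynomial.natDegree_prod_le _ _).trans ((sum_le_sum hfactor).trans_eq ?_)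
    rw [sum_const, card_erase_of_mem (mem_univ j), card_univ, Fintype.card_fin, smul_eq_mul,
      mul_one]
  have hN : 0 < N := j.pos
  exact Polynomial.coeff_eq_zero_of_natDegree_lt (by lia)

theorem mk_hsymmOn_mul_omitPoly (j : Fin N) :
    PowerSeries.mk (hsymmOn (univ : Finset (Fin N))) * (omitPoly j : PowerSeries _) =
      PowerSeries.mk fun m => MvPowerSeries.X (R := ℂ) j ^ m := by
  have hprod := mk_hsymmOn_mul_prod (univ : Finset (Fin N))
  rw [← mul_prod_erase univ _ (mem_univ j), ← coe_omitPoly, mul_comm (1 - _), ← mul_assoc] at hprod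
  exact left_inv_eq_right_inv hprod ((mul_comm _ _).trans (mk_pow_mul_one_sub _))

theorem X_pow_eq_sum_range (j : Fin N) (m : ℕ) :
    MvPowerSeries.X (R := ℂ) j ^ m =
      ∑ q ∈ range N, (omitPoly j).coeff q * truncVars N (hsymm ((m : ℤ) - q)) := by
  have h := congrArg (PowerSeries.coeff m) (mk_hsymmOn_mul_omitPoly j)
  rw [PowerSeries.coeff_mk, mul_comm, PowerSeries.coeff_mul,
    Nat.sum_antidiagonal_eq_sum_range_succ_mk] at h
  calc MvPowerSeries.X (R := ℂ) j ^ m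
    _ = ∑ q ∈ range (m + 1), (omitPoly j).coeff q * truncVars N (hsymm ((m : ℤ) - q)) := by
      rw [← h]
      refine sum_congr rfl fun q hq => ?_
      rw [PowerSeries.coeff_mk, Polynomial.coeff_coe, ← truncVars_hsymm,
        Nat.cast_sub (Nat.lt_succ_iff.1 (mem_range.1 hq))]
    _ = ∑ q ∈ range (m + 1 + N), (omitPoly j).coeff q * truncVars N (hsymm ((m : ℤ) - q)) := by
      refine sum_subset (range_mono (by lia)) fun q _ hq => ?_
      rw [mem_range, not_lt] at hq
      rw [hsymm_of_neg (by lia), map_zero, mul_zero]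
    _ = _ := by
      refine (sum_subset (range_mono (by lia)) fun q _ hq => ?_).symm
      rw [coeff_omitPoly_eq_zero j (by simpa using hq), zero_mul]

theorem X_pow_eq_sum_hsymm (j : Fin N) (m : ℕ) :
    MvPowerSeries.X (R := ℂ) j ^ m = ∑ k : Fin N,
      truncVars N (hsymm ((m : ℤ) - (N - 1) + (k : ℕ))) * (omitPoly j).coeff (N - 1 - k) := by
  rw [X_pow_eq_sum_range, ← sum_range_reflect, ← Fin.sum_univ_eq_sum_range]
  refine sum_congr rfl fun k _ => ?_
  rw [mul_comm]
  congr 3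
  have := k.2
  lia

theorem det_X_pow_eq (m : Fin N → ℕ) :
    (Matrix.of fun i j : Fin N => MvPowerSeries.X (R := ℂ) j ^ m i).det =
      truncVars N (jtMatrix fun i => (m i : ℤ) - (N - 1)).det *
        (Matrix.of fun k j : Fin N => (omitPoly j).coeff (N - 1 - k)).det := by
  rw [AlgHom.map_det, ← Matrix.det_mul]
  congr 1
  ext1 i j
  rw [Matrix.of_apply, X_pow_eq_sum_hsymm, Matrix.mul_apply]
  rfl

/-- The bialternant formula, for the Jacobi-Trudi determinant with rows `h_{b_i}, h_{b_i + 1}, …`,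
where `b_i = m_i - (N - 1)`. -/
theorem truncVars_jtMatrix_det_mul (m : Fin N → ℕ) :
    truncVars N (jtMatrix fun i => (m i : ℤ) - (N - 1)).det *
        (Matrix.of fun i j : Fin N => MvPowerSeries.X (R := ℂ) j ^ (N - 1 - (i : ℕ))).det =
      (Matrix.of fun i j : Fin N => MvPowerSeries.X (R := ℂ) j ^ m i).det := by
  -- For the staircase `N - 1, …, 1, 0` the Jacobi-Trudi matrix is upper unitriangular.
  have hone : (jtMatrix fun i : Fin N => ((N - 1 - (i : ℕ) : ℕ) : ℤ) - (N - 1)).det = 1 := by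
    rw [Matrix.det_of_isUpperTriangular]
    · refine prod_eq_one fun i _ => ?_
      rw [jtMatrix_apply, show ((N - 1 - (i : ℕ) : ℕ) : ℤ) - (N - 1) + (i : ℕ) = 0 by
        have := i.2; lia, hsymm_zero]
    · intro i j (hij : (j : ℕ) < i)
      rw [jtMatrix_apply]
      have := i.2
      exact hsymm_of_neg (by lia)
  rw [det_X_pow_eq m, det_X_pow_eq fun i => N - 1 - (i : ℕ), hone, map_one, one_mul]

end Bialternant

end

section

open Finset Equiv

/-! ### The permutation characters on colourings -/

theorem exists_content_eq {n : ℕ} {β : Type*} {m : β →₀ ℕ} (hm : m.degree = n) :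
    ∃ c : Fin n → β, content c = m := by
  induction n generalizing m with
  | zero =>
    rw [Finsupp.degree_eq_zero_iff] at hm
    exact ⟨Fin.elim0, by simp [content, hm]⟩
  | succ n ih =>
    obtain ⟨b, hb⟩ : ∃ b, m b ≠ 0 := by
      by_contra! h
      rw [Finsupp.ext (g := 0) h] at hm
      simp at hm
    obtain ⟨m', rfl⟩ := exists_add_of_le (Finsupp.single_le_iff.2 (Nat.one_le_iff_ne_zero.2 hb))
    rw [map_add, Finsupp.degree_single] at hm
    obtain ⟨c, rfl⟩ := ih (m := m') (by lia)
    exact ⟨Fin.cons b c, by simp [content, Fin.sum_univ_succ]⟩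

theorem exists_comp_perm_of_content_eq {n : ℕ} {β : Type*} {c c' : Fin n → β}
    (h : content c = content c') : ∃ u : Perm (Fin n), c' ∘ u = c := by
  classical
  have fiberEquiv (b : β) : Nonempty ({i // c i = b} ≃ {i // c' i = b}) := by
    refine ⟨Fintype.equivOfCardEq ?_⟩
    rw [Fintype.card_subtype, Fintype.card_subtype]
    exact (content_apply c b).symm.trans (h ▸ content_apply c' b)
  let e := fun b => (fiberEquiv b).some
  refine ⟨(Equiv.sigmaFiberEquiv c).symm.trans
    ((Equiv.sigmaCongrRight e).trans (Equiv.sigmaFiberEquiv c')), ?_⟩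
  funext i
  exact (e (c i) ⟨i, rfl⟩).2

theorem card_stabilizer_eq_of_content_eq {n : ℕ} {β : Type*} [DecidableEq β] {c c' : Fin n → β}
    (h : content c = content c') :
    (univ.filter fun w : Perm (Fin n) => c ∘ w = c).card =
      (univ.filter fun w : Perm (Fin n) => c' ∘ w = c).card := by
  obtain ⟨u, hu⟩ := exists_comp_perm_of_content_eq h
  refine card_equiv (Equiv.mulLeft u) fun w => ?_
  simp only [mem_filter, mem_univ, true_and, Equiv.coe_mulLeft, Perm.coe_mul]
  rw [← Function.comp_assoc, hu]

/-- Burnside's lemma for the colourings of a given content, which form one orbit. -/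
theorem sum_card_fixed_colourings {n : ℕ} {β : Type*} [Fintype β] [DecidableEq β] {m : β →₀ ℕ}
    (hm : m.degree = n) :
    ∑ w : Perm (Fin n), (univ.filter fun c : Fin n → β => c ∘ w = c ∧ content c = m).card =
      n.factorial := by
  obtain ⟨c₀, hc₀⟩ := exists_content_eq hm
  have hfiber (c : Fin n → β) :
      (∑ w : Perm (Fin n), if c ∘ w = c then if content c = m then 1 else 0 else 0) =
        ∑ w : Perm (Fin n), if c₀ ∘ w = c then 1 else 0 := by
    by_cases hc : content c = m
    · simp only [hc, if_true]
      rw [← card_filter, ← card_filter, card_stabilizer_eq_of_content_eq (hc.trans hc₀.symm)]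
    · simp only [hc, if_false, ite_self, sum_const_zero]
      refine (sum_eq_zero fun w _ => if_neg ?_).symm
      rintro rfl
      exact hc (by rw [content_comp_perm, hc₀])
  simp_rw [card_filter, ite_and]
  rw [sum_comm, sum_congr rfl fun c _ => hfiber c, sum_comm]
  simp [Fintype.card_perm]

theorem content_fst {n : ℕ} {β γ : Type*} [Finite γ] (e : Fin n → β × γ) (b : β) :
    content (fun i => (e i).1) b = ((content e).curry b).degree := by
  classical
  have := Fintype.ofFinite γ
  rw [Finsupp.degree_eq_sum, content_apply,
    card_eq_sum_card_fiberwise (f := fun i => (e i).2) (t := univ) (by simp)]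
  refine sum_congr rfl fun g _ => ?_
  simp only [Finsupp.curry_apply, content_apply, filter_filter, Prod.ext_iff]

theorem content_snd {n : ℕ} {β γ : Type*} [Fintype β] (e : Fin n → β × γ) :
    content (fun i => (e i).2) = ∑ b, (content e).curry b := by
  classical
  ext g
  rw [Finsupp.finsetSum_apply, content_apply,
    card_eq_sum_card_fiberwise (f := fun i => (e i).1) (t := univ) (by simp)]
  refine sum_congr rfl fun b _ => ?_
  simp only [Finsupp.curry_apply, content_apply, filter_filter, Prod.ext_iff, and_comm]

/-- The contingency tables with row sums `a` and column sums `b`, a table being given by its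
rows. -/
def contingencyTables {N M : ℕ} (a : Fin N →₀ ℕ) (b : Fin M →₀ ℕ) :
    Finset (Fin N →₀ Fin M →₀ ℕ) :=
  (finsuppAntidiag univ b).filter fun l => ∀ i, (l i).degree = a i

theorem mem_contingencyTables {N M : ℕ} {a : Fin N →₀ ℕ} {b : Fin M →₀ ℕ}
    {l : Fin N →₀ Fin M →₀ ℕ} :
    l ∈ contingencyTables a b ↔ ∑ i, l i = b ∧ ∀ i, (l i).degree = a i := by
  rw [contingencyTables, mem_filter, mem_finsuppAntidiag, and_iff_left (subset_univ _)]

theorem curry_content_mem_contingencyTables {n N M : ℕ} {a : Fin N →₀ ℕ} {b : Fin M →₀ ℕ}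
    {e : Fin n → Fin N × Fin M} : (content e).curry ∈ contingencyTables a b ↔
      content (fun i => (e i).1) = a ∧ content (fun i => (e i).2) = b := by
  rw [mem_contingencyTables, and_comm, content_snd, DFunLike.ext_iff (g := a)]
  simp_rw [content_fst]

theorem degree_curryEquiv_symm {n N M : ℕ} {a : Fin N →₀ ℕ} {b : Fin M →₀ ℕ} (ha : a.degree = n)
    {l : Fin N →₀ Fin M →₀ ℕ} (hl : l ∈ contingencyTables a b) :
    (Finsupp.curryEquiv.symm l).degree = n := by
  obtain ⟨m, rfl⟩ := Finsupp.curryEquiv.surjective l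
  rw [Equiv.symm_apply_apply, ← ha, Finsupp.degree_eq_sum, Finsupp.degree_eq_sum,
    Fintype.sum_prod_type]
  refine sum_congr rfl fun i _ => ?_
  rw [← (mem_contingencyTables.1 hl).2 i, Finsupp.degree_eq_sum]
  rfl

theorem colouringChar_mul {n N M : ℕ} (a : Fin N →₀ ℕ) (b : Fin M →₀ ℕ) (w : Perm (Fin n)) :
    colouringChar a w * colouringChar b w =
      ((univ.filter fun e : Fin n → Fin N × Fin M =>
        e ∘ w = e ∧ (content e).curry ∈ contingencyTables a b).card : ℂ) := by
  rw [colouringChar, colouringChar, ← Nat.cast_mul, ← card_product]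
  congr 1
  refine (card_equiv (Equiv.arrowProdEquivProdArrow _ _ _) fun e => ?_).symm
  simp only [mem_filter, mem_univ, true_and, mem_product, Equiv.arrowProdEquivProdArrow,
    Equiv.coe_fn_mk, curry_content_mem_contingencyTables, funext_iff, Function.comp_apply,
    Prod.ext_iff, forall_and]
  tauto

theorem card_fixed_pairs_eq_sum {n N M : ℕ} (a : Fin N →₀ ℕ) (b : Fin M →₀ ℕ)
    (w : Perm (Fin n)) :
    (univ.filter fun e : Fin n → Fin N × Fin M =>
        e ∘ w = e ∧ (content e).curry ∈ contingencyTables a b).card =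
      ∑ l ∈ contingencyTables a b, (univ.filter fun e : Fin n → Fin N × Fin M =>
        e ∘ w = e ∧ content e = Finsupp.curryEquiv.symm l).card := by
  rw [card_eq_sum_card_fiberwise (f := fun e => (content e).curry) (t := contingencyTables a b)
    fun e he => (mem_filter.1 he).2.2]
  refine sum_congr rfl fun l hl => ?_
  rw [filter_filter]
  refine congrArg card (filter_congr fun e _ => ?_)
  rw [Equiv.eq_symm_apply, Finsupp.curryEquiv_apply, and_assoc]
  refine and_congr_right fun _ => and_iff_right_of_imp ?_
  rintro rfl
  exact hl

theorem sum_colouringChar_mul {n N M : ℕ} {a : Fin N →₀ ℕ} (ha : a.degree = n)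
    (b : Fin M →₀ ℕ) :
    ∑ w : Perm (Fin n), colouringChar a w * colouringChar b w =
      n.factorial * (contingencyTables a b).card := by
  simp_rw [colouringChar_mul, card_fixed_pairs_eq_sum]
  rw [← Nat.cast_sum, sum_comm,
    sum_congr rfl fun l hl => sum_card_fixed_colourings (degree_curryEquiv_symm ha hl), sum_const,
    smul_eq_mul, mul_comm, Nat.cast_mul]

theorem ch_colouringChar {n N : ℕ} {a : Fin N →₀ ℕ} (ha : a.degree = n) :
    ch n (colouringChar a) = ∏ i, hsymm (a i) := by
  refine ext_truncVars fun M => ?_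
  ext b
  rw [coeff_truncVars_ch, sum_colouringChar_mul ha, ← mul_assoc,
    inv_mul_cancel₀ (Nat.cast_ne_zero.2 n.factorial_ne_zero), one_mul, map_prod,
    MvPowerSeries.coeff_prod, contingencyTables, card_filter, Nat.cast_sum]
  refine sum_congr rfl fun l _ => ?_
  simp_rw [coeff_truncVars_hsymm]
  rw [prod_ite_zero]
  simp

end

section

open Finset Equiv

/-! ### Virtual characters whose Frobenius characteristics are Jacobi-Trudi determinants -/

/-- The permutation character on the colourings of content `a`, where the entries of `a` may be
negative, in which case there are no such colourings. -/
def permChar (n : ℕ) {N : ℕ} (a : Fin N → ℤ) (w : Perm (Fin n)) : ℂ :=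
  ((univ.filter fun c : Fin n → Fin N => c ∘ w = c ∧ ∀ i, (content c i : ℤ) = a i).card : ℂ)

theorem permChar_eq_zero {n N : ℕ} {a : Fin N → ℤ} {i : Fin N} (h : a i < 0) :
    permChar n a = 0 := by
  funext w
  rw [permChar, Pi.zero_apply, Nat.cast_eq_zero, card_eq_zero, filter_eq_empty_iff]
  rintro c - ⟨-, hc⟩
  have := hc i
  lia

theorem permChar_eq_colouringChar {n N : ℕ} (a : Fin N →₀ ℕ) :
    permChar n (fun i => (a i : ℤ)) = colouringChar a := by
  funext w
  rw [permChar, colouringChar]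
  simp only [Nat.cast_inj, DFunLike.ext_iff]

theorem exists_neg_or_eq_natCast {N : ℕ} (a : Fin N → ℤ) :
    (∃ i, a i < 0) ∨ ∃ a' : Fin N →₀ ℕ, a = fun i => (a' i : ℤ) := by
  by_cases h : ∃ i, a i < 0
  · exact Or.inl h
  · push Not at h
    refine Or.inr ⟨Finsupp.equivFunOnFinite.symm fun i => (a i).toNat, funext fun i => ?_⟩
    simp [h i]

theorem ch_permChar {n N : ℕ} {a : Fin N → ℤ} (ha : ∑ i, a i = n) :
    ch n (permChar n a) = ∏ i, hsymm (a i) := by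
  rcases exists_neg_or_eq_natCast a with ⟨i, hi⟩ | ⟨a, rfl⟩
  · rw [permChar_eq_zero hi, ch_zero, prod_eq_zero (mem_univ i) (hsymm_of_neg hi)]
  · rw [permChar_eq_colouringChar, ch_colouringChar]
    rw [Finsupp.degree_eq_sum]
    beta_reduce at ha
    exact_mod_cast ha

theorem comp_inv_eq_iff {n : ℕ} {β : Type*} (c : Fin n → β) (w : Perm (Fin n)) :
    c ∘ ⇑w⁻¹ = c ↔ c ∘ w = c := by
  rw [Perm.inv_def, Equiv.comp_symm_eq, eq_comm]

theorem permChar_inv {n N : ℕ} (a : Fin N → ℤ) (w : Perm (Fin n)) :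
    permChar n a w⁻¹ = permChar n a w := by
  simp only [permChar, comp_inv_eq_iff]

theorem permChar_mem_virtualCharacters {n N : ℕ} (a : Fin N → ℤ) :
    permChar n a ∈ virtualCharacters (Perm (Fin n)) := by
  classical
  have hcont (w : Perm (Fin n)) {c : Fin n → Fin N} (hc : ∀ i, (content c i : ℤ) = a i) (i) :
      (content (c ∘ w) i : ℤ) = a i := by
    rw [content_comp_perm, hc]
  let X := {c : Fin n → Fin N // ∀ i, (content c i : ℤ) = a i}
  let φ : Perm (Fin n) →* Perm X :=
    { toFun := fun w =>
        { toFun := fun c => ⟨c.1 ∘ ⇑w⁻¹, hcont _ c.2⟩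
          invFun := fun c => ⟨c.1 ∘ ⇑w, hcont _ c.2⟩
          left_inv := fun c => Subtype.ext (funext fun i => by simp)
          right_inv := fun c => Subtype.ext (funext fun i => by simp) }
      map_one' := by ext; simp
      map_mul' := fun v w => by ext; simp }
  convert card_fixed_mem_virtualCharacters φ using 1
  funext w
  rw [permChar, ← Fintype.card_subtype, ← Fintype.card_subtype]
  congr 1
  refine Fintype.card_congr ⟨fun c => ⟨⟨c.1, c.2.2⟩, ?_⟩, fun c => ⟨c.1.1, ?_⟩,
    fun _ => rfl, fun _ => rfl⟩
  · exact Subtype.ext ((comp_inv_eq_iff _ _).2 c.2.1)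
  · exact ⟨(comp_inv_eq_iff _ _).1 (congrArg Subtype.val c.2), c.1.2⟩

theorem charForm_colouringChar {n N : ℕ} (f : Perm (Fin n) → ℂ) (a : Fin N →₀ ℕ) :
    charForm f (colouringChar a) = MvPowerSeries.coeff a (truncVars N (ch n f)) := by
  rw [coeff_truncVars_ch, charForm, Nat.card_eq_fintype_card, Fintype.card_perm, Fintype.card_fin]
  simp_rw [← permChar_eq_colouringChar, permChar_inv]

/-- The virtual character whose Frobenius characteristic is the Jacobi-Trudi determinant with rows
`h_{b_i}, h_{b_i + 1}, …`. -/
def jtChar (n : ℕ) {N : ℕ} (b : Fin N → ℤ) : Perm (Fin n) → ℂ :=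
  ∑ σ : Perm (Fin N), ((Perm.sign σ : ℤ) : ℂ) • permChar n fun i => b i + (σ i : ℕ)

theorem isClassFunction_of_mem_virtualCharacters {G : Type} [Group G] {f : G → ℂ}
    (hf : f ∈ virtualCharacters G) : IsClassFunction f := by
  obtain ⟨s, a, hs, rfl⟩ := exists_sum_irreducible hf
  refine IsClassFunction.sum fun χ hχ => ?_
  obtain ⟨d, ρ, -, rfl⟩ := hs χ hχ
  exact IsClassFunction.smul (fun g h => ρ.char_conj g h) _

theorem jtChar_mem_virtualCharacters {n N : ℕ} (b : Fin N → ℤ) :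
    jtChar n b ∈ virtualCharacters (Perm (Fin n)) := by
  refine sum_mem fun σ _ => ?_
  rw [Int.cast_smul_eq_zsmul]
  exact zsmul_mem (permChar_mem_virtualCharacters _) _

theorem ch_jtChar {n N : ℕ} {b : Fin N → ℤ} (hb : ∑ i, (b i + (i : ℕ)) = n) :
    ch n (jtChar n b) = (jtMatrix b).det := by
  rw [jtChar, ch_sum, ← Matrix.det_transpose, Matrix.det_apply]
  refine sum_congr rfl fun σ _ => ?_
  rw [ch_smul, Int.cast_smul_eq_zsmul, ch_permChar]
  · rfl
  · rw [← hb, sum_add_distrib, sum_add_distrib]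
    congr 1
    exact Equiv.sum_comp σ fun i : Fin N => ((i : ℕ) : ℤ)

theorem eq_one_of_strictAnti_comp {N : ℕ} {m m' : Fin N → ℕ} (hm : StrictAnti m)
    (hm' : StrictAnti m') {σ : Perm (Fin N)} (h : m ∘ σ = m') : σ = 1 := by
  subst h
  have hσ : StrictMono σ := fun i j hij => hm.lt_iff_gt.1 (hm' hij)
  have hrefl : hσ.orderIsoOfSurjective σ σ.surjective = OrderIso.refl _ := Subsingleton.elim _ _
  ext1 i
  exact DFunLike.congr_fun hrefl i

theorem prod_X_pow_eq_monomial {N : ℕ} (a : Fin N → ℕ) :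
    ∏ j, MvPowerSeries.X (R := ℂ) j ^ a j =
      MvPowerSeries.monomial (Finsupp.equivFunOnFinite.symm a) 1 := by
  rw [MvPowerSeries.monomial_one_eq, Finsupp.prod_fintype _ _ fun _ => pow_zero _]
  rfl

theorem coeff_det_X_pow {N : ℕ} {m m' : Fin N → ℕ} (hm : StrictAnti m) (hm' : StrictAnti m') :
    MvPowerSeries.coeff (Finsupp.equivFunOnFinite.symm m')
      (Matrix.of fun i j : Fin N => MvPowerSeries.X (R := ℂ) j ^ m i).det =
        if m = m' then 1 else 0 := by
  have hterm (σ : Perm (Fin N)) : MvPowerSeries.coeff (Finsupp.equivFunOnFinite.symm m')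
      (Perm.sign σ • ∏ i, MvPowerSeries.X (R := ℂ) i ^ m (σ i)) =
        if m ∘ σ = m' then ((Perm.sign σ : ℤ) : ℂ) else 0 := by
    rw [prod_X_pow_eq_monomial fun i => m (σ i), Units.smul_def, map_zsmul,
      MvPowerSeries.coeff_monomial, zsmul_eq_mul, mul_ite, mul_one, mul_zero]
    exact if_congr ((EmbeddingLike.apply_eq_iff_eq _).trans eq_comm) rfl rfl
  simp only [Matrix.det_apply, Matrix.of_apply, map_sum, hterm]
  rw [sum_eq_single_of_mem 1 (mem_univ _) fun σ _ hσ =>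
    if_neg fun h => hσ (eq_one_of_strictAnti_comp hm hm' h)]
  simp

theorem charForm_permChar_sub {n N : ℕ} (f : Perm (Fin n) → ℂ) {m k : Fin N → ℕ}
    (hk : ∀ i, k i < N) :
    charForm f (permChar n fun i => (m i : ℤ) - (N - 1) + k i) =
      MvPowerSeries.coeff (Finsupp.equivFunOnFinite.symm m)
        (truncVars N (ch n f) * ∏ i, MvPowerSeries.X (R := ℂ) i ^ (N - 1 - k i)) := by
  rw [prod_X_pow_eq_monomial fun i => N - 1 - k i, MvPowerSeries.coeff_mul_monomial, mul_one]
  split_ifs with hle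
  · rw [← charForm_colouringChar, ← permChar_eq_colouringChar]
    congr 2
    funext i
    have hmi : N - 1 - k i ≤ m i := hle i
    have hki := hk i
    rw [Finsupp.tsub_apply, Finsupp.equivFunOnFinite_symm_apply_apply,
      Finsupp.equivFunOnFinite_symm_apply_apply]
    lia
  · rw [Finsupp.le_def] at hle
    push Not at hle
    obtain ⟨i, hi⟩ := hle
    rw [Finsupp.equivFunOnFinite_symm_apply_apply, Finsupp.equivFunOnFinite_symm_apply_apply] at hi
    rw [permChar_eq_zero (i := i) (by lia)]
    simp [charForm]

theorem charForm_jtChar_right {n N : ℕ} (f : Perm (Fin n) → ℂ) (m : Fin N → ℕ) :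
    charForm f (jtChar n fun i => (m i : ℤ) - (N - 1)) =
      MvPowerSeries.coeff (Finsupp.equivFunOnFinite.symm m) (truncVars N (ch n f) *
        (Matrix.of fun i j : Fin N => MvPowerSeries.X (R := ℂ) j ^ (N - 1 - (i : ℕ))).det) := by
  rw [jtChar, sum_charForm, Matrix.det_apply, mul_sum, map_sum]
  refine sum_congr rfl fun σ _ => ?_
  rw [charForm_permChar_sub f fun i => (σ i).2, Units.smul_def, mul_smul_comm, map_zsmul,
    zsmul_eq_mul]
  rfl

theorem charForm_jtChar {n N : ℕ} {m m' : Fin N → ℕ} (hm : StrictAnti m) (hm' : StrictAnti m')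
    (hsum : ∑ i, ((m i : ℤ) - (N - 1) + (i : ℕ)) = n) :
    charForm (jtChar n fun i => (m i : ℤ) - (N - 1)) (jtChar n fun i => (m' i : ℤ) - (N - 1)) =
      if m = m' then 1 else 0 := by
  rw [charForm_jtChar_right, ch_jtChar hsum, truncVars_jtMatrix_det_mul, coeff_det_X_pow hm hm']

end

section

open Finset

/-! ### Removing the largest entry of a standard tableau -/

theorem mem_of_addable {μ : YoungDiagram} {i x y : ℕ} (hi : Addable μ.rowLen i) (hx : x ≤ i)
    (hy : y ≤ μ.rowLen i) (hne : ¬(x = i ∧ y = μ.rowLen i)) : (x, y) ∈ μ := by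
  rw [YoungDiagram.mem_iff_lt_rowLen]
  rcases hx.eq_or_lt with rfl | hx
  · exact hy.lt_of_ne fun h => hne ⟨rfl, h⟩
  · obtain ⟨k, rfl⟩ : ∃ k, i = k + 1 := ⟨i - 1, by lia⟩
    exact hy.trans_lt ((hi k rfl).trans_le (μ.rowLen_anti x k (by lia)))

/-- The Young diagram obtained by adding a cell at the end of row `i`. -/
def addCell (μ : YoungDiagram) {i : ℕ} (hi : Addable μ.rowLen i) : YoungDiagram where
  cells := insert (i, μ.rowLen i) μ.cells
  isLowerSet := by
    rintro ⟨x, y⟩ ⟨x', y'⟩ hle hmem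
    obtain ⟨hx, hy⟩ := Prod.mk_le_mk.1 hle
    simp only [coe_insert, Set.mem_insert_iff, Prod.mk.injEq] at hmem ⊢
    rcases hmem with ⟨rfl, rfl⟩ | hmem
    · exact or_iff_not_imp_left.2 (mem_of_addable hi hx hy)
    · exact Or.inr (μ.up_left_mem hx hy hmem)

theorem mem_addCell {μ : YoungDiagram} {i : ℕ} (hi : Addable μ.rowLen i) {c : ℕ × ℕ} :
    c ∈ addCell μ hi ↔ c = (i, μ.rowLen i) ∨ c ∈ μ := by
  rw [← YoungDiagram.mem_cells, addCell, mem_insert, YoungDiagram.mem_cells]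

namespace StandardTableau

variable {n : ℕ}

theorem ext_entry {Q R : StandardTableau n} (h : ∀ x y, Q.entry x y = R.entry x y) : Q = R := by
  have hentry : Q.entry = R.entry := funext fun x => funext fun y => h x y
  refine StandardTableau.ext (SetLike.ext fun ⟨i, j⟩ => ?_) hentry
  rw [Q.mem_shape_iff, R.mem_shape_iff, hentry]

theorem entry_injective (Q : StandardTableau n) {x y x' y' : ℕ} (h : (x, y) ∈ Q.shape)
    (h' : Q.entry x y = Q.entry x' y') : x = x' ∧ y = y' := by
  have hne := (Q.mem_shape_iff x y).1 h
  rw [h', ← Q.mem_shape_iff] at hne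
  exact Prod.mk.inj (Q.bijOn.injOn (x₁ := (x, y)) (x₂ := (x', y')) h hne h')

theorem mem_shape_of_entry_eq (Q : StandardTableau n) {x y k : ℕ} (h : Q.entry x y = k)
    (hk : k ≠ 0) : (x, y) ∈ Q.shape := (Q.mem_shape_iff x y).2 (h ▸ hk)

theorem entry_mono (Q : StandardTableau n) {x x' y y' : ℕ} (hx : x' ≤ x) (hy : y' ≤ y)
    (h : (x, y) ∈ Q.shape) : Q.entry x' y' ≤ Q.entry x y := by
  have hrow : Q.entry x' y' ≤ Q.entry x' y := by
    rcases hy.eq_or_lt with rfl | hy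
    · exact le_rfl
    · exact (Q.row_strict _ _ _ hy (Q.shape.up_left_mem hx le_rfl h)).le
  have hcol : Q.entry x' y ≤ Q.entry x y := by
    rcases hx.eq_or_lt with rfl | hx
    · exact le_rfl
    · exact (Q.col_strict _ _ _ hx h).le
  exact hrow.trans hcol

theorem entry_lt_entry (Q : StandardTableau n) {x x' y y' : ℕ} (hlt : (x', y') < (x, y))
    (h : (x, y) ∈ Q.shape) : Q.entry x' y' < Q.entry x y := by
  obtain ⟨hx, hy⟩ := Prod.mk_le_mk.1 hlt.le
  refine (Q.entry_mono hx hy h).lt_of_ne fun heq => hlt.ne' ?_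
  obtain ⟨rfl, rfl⟩ := Q.entry_injective h heq.symm
  rfl

/-- The entries of the tableau obtained from `Q` by adding the entry `n + 1` at the end of row
`i`. -/
def extendEntry (Q : StandardTableau n) (i x y : ℕ) : ℕ :=
  if x = i ∧ y = Q.shape.rowLen i then n + 1 else Q.entry x y

theorem extendEntry_last (Q : StandardTableau n) (i : ℕ) :
    Q.extendEntry i i (Q.shape.rowLen i) = n + 1 := if_pos ⟨rfl, rfl⟩

theorem last_notMem_shape (Q : StandardTableau n) (i : ℕ) : (i, Q.shape.rowLen i) ∉ Q.shape := by
  simp [YoungDiagram.mem_iff_lt_rowLen]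

theorem extendEntry_of_mem (Q : StandardTableau n) {i x y : ℕ} (h : (x, y) ∈ Q.shape) :
    Q.extendEntry i x y = Q.entry x y := by
  refine if_neg ?_
  rintro ⟨rfl, rfl⟩
  exact Q.last_notMem_shape x h

theorem extendEntry_lt_extendEntry (Q : StandardTableau n) {i x x' y y' : ℕ}
    (hi : Addable Q.shape.rowLen i) (hlt : (x', y') < (x, y))
    (h : (x, y) ∈ addCell Q.shape hi) : Q.extendEntry i x' y' < Q.extendEntry i x y := by
  obtain ⟨hx, hy⟩ := Prod.mk_le_mk.1 hlt.le
  rcases (mem_addCell hi).1 h with hlast | hold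
  · obtain ⟨rfl, rfl⟩ := Prod.mk.inj hlast
    have hold : (x', y') ∈ Q.shape :=
      mem_of_addable hi hx hy fun h => hlt.ne (Prod.ext h.1 h.2)
    rw [extendEntry_last, extendEntry_of_mem Q hold]
    exact Nat.lt_succ_of_le (Q.entry_le _ _)
  · rw [extendEntry_of_mem Q hold, extendEntry_of_mem Q (Q.shape.up_left_mem hx hy hold)]
    exact Q.entry_lt_entry hlt hold

theorem bijOn_extendEntry (Q : StandardTableau n) {i : ℕ} (hi : Addable Q.shape.rowLen i) :
    Set.BijOn (fun c : ℕ × ℕ => Q.extendEntry i c.1 c.2) (addCell Q.shape hi).cells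
      (Set.Icc 1 (n + 1)) := by
  have hIcc : Set.Icc 1 (n + 1) =
      insert (Q.extendEntry i i (Q.shape.rowLen i)) (Set.Icc 1 n) := by
    rw [extendEntry_last]
    exact (Set.insert_Icc_right_eq_Icc_succ (Nat.le_add_left 1 n)).symm
  rw [hIcc, addCell, coe_insert]
  refine (Q.bijOn.congr fun c hc => ?_).insert (a := (i, Q.shape.rowLen i)) ?_
  · exact (extendEntry_of_mem Q hc).symm
  · simp [extendEntry_last]

/-- The tableau obtained by adding the largest entry at the end of row `i`. -/
def extend (Q : StandardTableau n) {i : ℕ} (hi : Addable Q.shape.rowLen i) :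
    StandardTableau (n + 1) where
  shape := addCell Q.shape hi
  entry := Q.extendEntry i
  bijOn := Q.bijOn_extendEntry hi
  row_strict _ _ _ hlt := Q.extendEntry_lt_extendEntry hi (Prod.mk_lt_mk_iff_right.2 hlt)
  col_strict _ _ _ hlt := Q.extendEntry_lt_extendEntry hi (Prod.mk_lt_mk_iff_left.2 hlt)
  zeros x y h := by
    rw [mem_addCell, not_or] at h
    exact (if_neg fun hlast => h.1 (Prod.ext hlast.1 hlast.2)).trans (Q.zeros x y h.2)

/-- The tableau obtained by removing the largest entry. -/
def restrict (Q : StandardTableau (n + 1)) : StandardTableau n where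
  shape :=
    { cells := Q.shape.cells.filter fun c => Q.entry c.1 c.2 ≤ n
      isLowerSet := by
        rintro ⟨x, y⟩ ⟨x', y'⟩ hle hmem
        obtain ⟨hx, hy⟩ := Prod.mk_le_mk.1 hle
        simp only [coe_filter, Set.mem_ofPred_eq, YoungDiagram.mem_cells] at hmem ⊢
        exact ⟨Q.shape.up_left_mem hx hy hmem.1, (Q.entry_mono hx hy hmem.1).trans hmem.2⟩ }
  entry x y := if Q.entry x y ≤ n then Q.entry x y else 0
  bijOn := by
    have hcells : ((Q.shape.cells.filter fun c : ℕ × ℕ => Q.entry c.1 c.2 ≤ n :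
        Finset (ℕ × ℕ)) : Set (ℕ × ℕ)) =
        ↑Q.shape.cells ∩ (fun c : ℕ × ℕ => Q.entry c.1 c.2) ⁻¹' Set.Icc 1 n := by
      ext c
      rw [mem_coe, mem_filter]
      exact and_congr_right fun hc => (and_iff_right (Q.entry_mem hc).1).symm
    rw [hcells]
    refine (Q.bijOn.subset_right (Set.Icc_subset_Icc_right n.le_succ)).congr fun c hc => ?_
    exact (if_pos hc.2.2).symm
  row_strict x y₁ y₂ hlt h := by
    obtain ⟨hmem, hle⟩ := mem_filter.1 h
    have hentry := Q.row_strict x y₁ y₂ hlt hmem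
    rwa [if_pos hle, if_pos (hentry.le.trans hle)]
  col_strict x₁ x₂ y hlt h := by
    obtain ⟨hmem, hle⟩ := mem_filter.1 h
    have hentry := Q.col_strict x₁ x₂ y hlt hmem
    rwa [if_pos hle, if_pos (hentry.le.trans hle)]
  zeros x y h := by
    refine ite_eq_right_iff.2 fun hle => Q.zeros x y fun hmem => h (mem_filter.2 ⟨hmem, hle⟩)

theorem mem_shape_restrict {Q : StandardTableau (n + 1)} {x y : ℕ} :
    (x, y) ∈ Q.restrict.shape ↔ (x, y) ∈ Q.shape ∧ Q.entry x y ≤ n := mem_filter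

/-- `Q` arises from `Q'` by adding the entry `n + 1` at the end of row `i`. -/
def IsExtension (Q' : StandardTableau n) (i : ℕ) (Q : StandardTableau (n + 1)) : Prop :=
  Addable Q'.shape.rowLen i ∧
    ∀ x y, Q.entry x y = if x = i ∧ y = Q'.shape.rowLen i then n + 1 else Q'.entry x y

theorem isExtension_extend (Q : StandardTableau n) {i : ℕ} (hi : Addable Q.shape.rowLen i) :
    IsExtension Q i (Q.extend hi) := ⟨hi, fun _ _ => rfl⟩

theorem rowLen_restrict {Q : StandardTableau (n + 1)} {i j : ℕ} (hij : Q.entry i j = n + 1) :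
    Q.restrict.shape.rowLen i = j := by
  have hmem := Q.mem_shape_of_entry_eq hij n.succ_ne_zero
  refine eq_of_forall_lt_iff fun y => ?_
  rw [← YoungDiagram.mem_iff_lt_rowLen, mem_shape_restrict]
  constructor
  · rintro ⟨hy, hle⟩
    by_contra! hjy
    have := Q.entry_mono le_rfl hjy hy
    lia
  · intro hyj
    have := Q.row_strict i y j hyj hmem
    exact ⟨Q.shape.up_left_mem le_rfl hyj.le hmem, by lia⟩

theorem exists_isExtension_restrict (Q : StandardTableau (n + 1)) :
    ∃ i, IsExtension Q.restrict i Q := by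
  obtain ⟨⟨i, j⟩, hmem, (hij : Q.entry i j = n + 1)⟩ := Q.bijOn.surjOn (a := n + 1) (by simp)
  refine ⟨i, ?_, fun x y => ?_⟩
  · rintro k rfl
    have := Q.col_strict k (k + 1) j k.lt_succ_self hmem
    rw [rowLen_restrict hij, ← YoungDiagram.mem_iff_lt_rowLen, mem_shape_restrict]
    exact ⟨Q.shape.up_left_mem k.le_succ le_rfl hmem, by lia⟩
  · rw [rowLen_restrict hij]
    split_ifs with hlast
    · rw [hlast.1, hlast.2, hij]
    · refine (if_pos (not_lt.1 fun hlt => hlast ?_)).symm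
      have hxy : Q.entry x y = n + 1 := (Q.entry_le x y).antisymm hlt
      exact Q.entry_injective (Q.mem_shape_of_entry_eq hxy n.succ_ne_zero) (hxy.trans hij.symm)

/-- The row of the largest entry. -/
def lastRow (Q : StandardTableau (n + 1)) : ℕ := Q.exists_isExtension_restrict.choose

theorem isExtension_restrict (Q : StandardTableau (n + 1)) :
    IsExtension Q.restrict Q.lastRow Q := Q.exists_isExtension_restrict.choose_spec

namespace IsExtension

variable {Q' R' : StandardTableau n} {i k : ℕ} {Q R : StandardTableau (n + 1)}

theorem eq_of_eq (hQ : IsExtension Q' i Q) (hR : IsExtension Q' i R) : Q = R :=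
  ext_entry fun x y => by rw [hQ.2, hR.2]

theorem entry_eq_succ_iff (hQ : IsExtension Q' i Q) {x y : ℕ} :
    Q.entry x y = n + 1 ↔ x = i ∧ y = Q'.shape.rowLen i := by
  rw [hQ.2]
  split_ifs with hlast
  · simp [hlast]
  · have := Q'.entry_le x y
    simp only [hlast, iff_false]
    lia

theorem entry_eq_iff (hQ : IsExtension Q' i Q) {x y v : ℕ} (hv : v ≠ 0) (hvn : v ≤ n) :
    Q.entry x y = v ↔ Q'.entry x y = v := by
  rw [hQ.2]
  split_ifs with hlast
  · have hzero : Q'.entry x y = 0 := by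
      rw [hlast.1, hlast.2]
      exact Q'.zeros _ _ (Q'.last_notMem_shape i)
    lia
  · rfl

theorem unique (hQ : IsExtension Q' i Q) (hR : IsExtension R' k Q) : Q' = R' ∧ i = k := by
  refine ⟨ext_entry fun x y => ?_,
    (hR.entry_eq_succ_iff.1 (hQ.entry_eq_succ_iff.2 ⟨rfl, rfl⟩)).1⟩
  have hiff {v : ℕ} (hv : v ≠ 0) (hvn : v ≤ n) : Q'.entry x y = v ↔ R'.entry x y = v :=
    (hQ.entry_eq_iff hv hvn).symm.trans (hR.entry_eq_iff hv hvn)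
  by_cases hQ' : Q'.entry x y = 0
  · by_contra hne
    have hR' : R'.entry x y ≠ 0 := fun h => hne (hQ'.trans h.symm)
    exact hne ((hiff hR' (R'.entry_le x y)).2 rfl)
  · exact ((hiff hQ' (Q'.entry_le x y)).1 rfl).symm

theorem rowLen_eq (hQ : IsExtension Q' i Q) :
    Q.shape.rowLen = Function.update Q'.shape.rowLen i (Q'.shape.rowLen i + 1) := by
  funext x
  refine eq_of_forall_lt_iff fun y => ?_
  rw [← YoungDiagram.mem_iff_lt_rowLen, Q.mem_shape_iff, hQ.2, Function.update_apply]
  by_cases hx : x = i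
  · subst hx
    rw [if_pos rfl]
    split_ifs with hlast
    · simp [hlast.2]
    · rw [← Q'.mem_shape_iff, YoungDiagram.mem_iff_lt_rowLen]
      have : y ≠ Q'.shape.rowLen x := fun h => hlast ⟨rfl, h⟩
      lia
  · rw [if_neg hx, if_neg fun h => hx h.1, ← Q'.mem_shape_iff, YoungDiagram.mem_iff_lt_rowLen]

end IsExtension

theorem rowLen_eq_zero (Q : StandardTableau n) {i : ℕ} (hi : n ≤ i) : Q.shape.rowLen i = 0 := by
  by_contra h
  have hmem : (i, 0) ∈ Q.shape := YoungDiagram.mem_iff_lt_rowLen.2 (Nat.pos_of_ne_zero h)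
  exact ((Q.row_lt_entry i 0 hmem).trans_le (Q.entry_le i 0)).not_ge hi

theorem lastRow_mem_range (Q : StandardTableau (n + 1)) : Q.lastRow ∈ range (n + 1) := by
  have hlast := Q.isExtension_restrict.entry_eq_succ_iff.2 ⟨rfl, rfl⟩
  have := Q.row_lt_entry _ _ (Q.mem_shape_of_entry_eq hlast n.succ_ne_zero)
  exact mem_range.2 (by lia)

theorem sum_rowLen (Q : StandardTableau n) {N : ℕ} (hN : n ≤ N) :
    ∑ i ∈ range N, Q.shape.rowLen i = n := by
  induction n with
  | zero => exact sum_eq_zero fun i _ => Q.rowLen_eq_zero (Nat.zero_le i)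
  | succ n ih =>
    have hlast : Q.lastRow ∈ range N := range_mono hN Q.lastRow_mem_range
    have hrestrict := ih Q.restrict (by lia)
    rw [sum_eq_add_sum_sdiff_singleton_of_mem hlast] at hrestrict
    rw [Q.isExtension_restrict.rowLen_eq, sum_update_of_mem hlast]
    lia

instance : Fintype (StandardTableau n) := Fintype.ofFinite _

instance : Unique (StandardTableau 0) where
  default := ⟨⊥, fun _ _ => 0, by simp, by simp, by simp, by simp⟩
  uniq Q := ext_entry fun x y => Nat.le_zero.1 (Q.entry_le x y)

theorem schur_shape (Q : StandardTableau n) {N : ℕ} (hN : n ≤ N) :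
    schur Q.shape = jtDet N Q.shape.rowLen := schur_eq_jtDet (Q.rowLen_eq_zero hN)

open Classical in
theorem hsymm_one_mul_schur_shape (Q : StandardTableau n) :
    hsymm 1 * schur Q.shape = ∑ i ∈ range (n + 1), if Addable Q.shape.rowLen i then
      jtDet (n + 1) (Function.update Q.shape.rowLen i (Q.shape.rowLen i + 1)) else 0 := by
  rw [Q.schur_shape le_rfl,
    pieri (fun i j hij => Q.shape.rowLen_anti i j hij) (Q.rowLen_eq_zero le_rfl)]

theorem sum_restrict_mul_schur (G : StandardTableau n → Series) :
    ∑ Q : StandardTableau (n + 1), G Q.restrict * schur Q.shape =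
      hsymm 1 * ∑ Q : StandardTableau n, G Q * schur Q.shape := by
  classical
  simp_rw [mul_sum, mul_left_comm (hsymm 1), hsymm_one_mul_schur_shape, mul_sum, mul_ite, mul_zero]
  rw [← sum_product', ← sum_filter]
  refine sum_bij (fun Q _ => (Q.restrict, Q.lastRow)) ?maps ?injective ?surjective ?values
  case maps =>
    intro Q _
    exact mem_filter.2 ⟨mem_product.2 ⟨mem_univ _, Q.lastRow_mem_range⟩, Q.isExtension_restrict.1⟩
  case injective =>
    intro Q _ R _ h
    have hQ := Q.isExtension_restrict
    rw [(Prod.mk.inj h).1, (Prod.mk.inj h).2] at hQ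
    exact hQ.eq_of_eq R.isExtension_restrict
  case surjective =>
    rintro ⟨Q, i⟩ h
    obtain ⟨hrestrict, hlastRow⟩ := (isExtension_restrict _).unique
      (Q.isExtension_extend (mem_filter.1 h).2)
    exact ⟨_, mem_univ _, Prod.ext hrestrict hlastRow⟩
  case values =>
    intro Q _
    rw [Q.schur_shape le_rfl, Q.isExtension_restrict.rowLen_eq]

end StandardTableau

end

section

open Finset Equiv StandardTableau

/-! ### The irreducible characters of the symmetric groups -/

variable {n : ℕ}

theorem sum_schur_shape (n : ℕ) : ∑ Q : StandardTableau n, schur Q.shape = psum 1 ^ n := by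
  induction n with
  | zero =>
    rw [Fintype.sum_unique, schur_shape _ le_rfl, pow_zero]
    exact Matrix.det_isEmpty
  | succ n ih =>
    have hrec := sum_restrict_mul_schur fun _ : StandardTableau n => 1
    simp only [one_mul] at hrec
    rw [hrec, ih, hsymm_one, pow_succ']

theorem cyclePsum_one (n : ℕ) : cyclePsum (1 : Perm (Fin n)) = psum 1 ^ n := by
  rw [cyclePsum, Perm.parts_partition]
  simp

theorem ch_single_one (n : ℕ) :
    ch n (Pi.single 1 (n.factorial : ℂ)) = psum 1 ^ n := by
  rw [ch_eq, sum_eq_single_of_mem 1 (mem_univ _)]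
  · rw [Pi.single_eq_same, smul_smul, inv_mul_cancel₀ (Nat.cast_ne_zero.2 n.factorial_ne_zero),
      one_smul, cyclePsum_one]
  · intro w _ hw
    rw [Pi.single_eq_of_ne hw, zero_smul]

theorem isClassFunction_single_one (n : ℕ) :
    IsClassFunction (Pi.single 1 (n.factorial : ℂ) : Perm (Fin n) → ℂ) := by
  intro g h
  simp only [Pi.single_apply]
  refine if_congr ?_ rfl rfl
  rw [mul_inv_eq_one, mul_eq_left]

/-- The exponents of the bialternant of the shape of a tableau. -/
def bialternantExponent (Q : StandardTableau n) (i : Fin n) : ℕ :=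
  Q.shape.rowLen i + (n - 1 - i)

theorem strictAnti_bialternantExponent (Q : StandardTableau n) :
    StrictAnti (bialternantExponent Q) := by
  intro i j hij
  have hrow := Q.shape.rowLen_anti i j hij.le
  rw [Fin.lt_def] at hij
  rw [bialternantExponent, bialternantExponent]
  lia

/-- The virtual character with Frobenius characteristic the Schur function of the shape of a
tableau. -/
def shapeChar (Q : StandardTableau n) : Perm (Fin n) → ℂ :=
  jtChar n fun i : Fin n => (bialternantExponent Q i : ℤ) - (n - 1)

theorem bialternantExponent_sub (Q : StandardTableau n) (i : Fin n) :
    (bialternantExponent Q i : ℤ) - (n - 1) = Q.shape.rowLen i - (i : ℕ) := by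
  have := i.isLt
  rw [bialternantExponent]
  lia

theorem sum_bialternantExponent (Q : StandardTableau n) :
    ∑ i, ((bialternantExponent Q i : ℤ) - (n - 1) + (i : ℕ)) = n := by
  simp_rw [bialternantExponent_sub, sub_add_cancel]
  rw [← Nat.cast_sum, Nat.cast_inj, ← Finset.sum_range Q.shape.rowLen]
  exact Q.sum_rowLen le_rfl

theorem ch_shapeChar (Q : StandardTableau n) : ch n (shapeChar Q) = schur Q.shape := by
  rw [shapeChar, ch_jtChar (sum_bialternantExponent Q), Q.schur_shape le_rfl, jtDet]
  simp_rw [bialternantExponent_sub]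

theorem isClassFunction_shapeChar (Q : StandardTableau n) : IsClassFunction (shapeChar Q) :=
  isClassFunction_of_mem_virtualCharacters (jtChar_mem_virtualCharacters _)

theorem sum_shapeChar (n : ℕ) :
    ∑ Q : StandardTableau n, shapeChar Q = Pi.single 1 (n.factorial : ℂ) := by
  refine ch_injective (IsClassFunction.sum fun Q _ => isClassFunction_shapeChar Q)
    (isClassFunction_single_one n) ?_
  rw [ch_sum, ch_single_one, ← sum_schur_shape]
  exact sum_congr rfl fun Q _ => ch_shapeChar Q

theorem charForm_shapeChar (Q R : StandardTableau n) :
    charForm (shapeChar Q) (shapeChar R) =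
      if bialternantExponent Q = bialternantExponent R then 1 else 0 :=
  charForm_jtChar (strictAnti_bialternantExponent Q) (strictAnti_bialternantExponent R)
    (sum_bialternantExponent Q)

theorem charForm_single_one (f : Perm (Fin n) → ℂ) :
    charForm f (Pi.single 1 (n.factorial : ℂ)) = f 1 := by
  rw [charForm, sum_eq_single_of_mem 1 (mem_univ _), Nat.card_perm, Nat.card_fin]
  · rw [inv_one, Pi.single_eq_same, mul_left_comm,
      inv_mul_cancel₀ (Nat.cast_ne_zero.2 n.factorial_ne_zero), mul_one]
  · intro w _ hw
    rw [Pi.single_eq_of_ne (inv_ne_one.2 hw), mul_zero]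

theorem shapeChar_one (Q : StandardTableau n) :
    shapeChar Q 1 = #{R : StandardTableau n | bialternantExponent Q = bialternantExponent R} := by
  have hlinear := sum_charForm univ (fun _ => (1 : ℂ)) (shapeChar (n := n)) (shapeChar Q)
  simp only [one_smul, one_mul] at hlinear
  rw [← charForm_single_one (shapeChar Q), ← sum_shapeChar, hlinear, card_filter, Nat.cast_sum]
  refine sum_congr rfl fun R _ => ?_
  rw [charForm_shapeChar, Nat.cast_ite, Nat.cast_one, Nat.cast_zero]

theorem isIrreducibleCharacter_shapeChar (Q : StandardTableau n) :
    IsIrreducibleCharacter (shapeChar Q) := by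
  refine isIrreducibleCharacter_of_virtual (jtChar_mem_virtualCharacters _) ?norm
    ⟨_, ?positive, shapeChar_one Q⟩
  case norm => rw [charForm_shapeChar, if_pos rfl]
  case positive => exact card_pos.2 ⟨Q, mem_filter.2 ⟨mem_univ Q, rfl⟩⟩

theorem irreducibleCharacter_spec (Q : StandardTableau n) :
    IsIrreducibleCharacter (irreducibleCharacter n Q.shape) ∧
      ch n (irreducibleCharacter n Q.shape) = schur Q.shape := by
  have hex : ∃ χ : Perm (Fin n) → ℂ, IsIrreducibleCharacter χ ∧ ch n χ = schur Q.shape :=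
    ⟨_, isIrreducibleCharacter_shapeChar Q, ch_shapeChar Q⟩
  rw [irreducibleCharacter, dif_pos hex]
  exact hex.choose_spec

theorem IsIrreducibleCharacter.isClassFunction {G : Type} [Group G] {χ : G → ℂ}
    (hχ : IsIrreducibleCharacter χ) : IsClassFunction χ := by
  obtain ⟨d, ρ, -, rfl⟩ := hχ
  exact fun g h => ρ.char_conj g h

theorem eq_sum_irreducibleCharacter {f : Perm (Fin n) → ℂ} (hf : IsClassFunction f)
    (s : Finset (StandardTableau n)) (hch : ch n f = ∑ Q ∈ s, schur Q.shape) :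
    f = ∑ Q ∈ s, irreducibleCharacter n Q.shape := by
  refine ch_injective hf (IsClassFunction.sum fun Q _ =>
    (irreducibleCharacter_spec Q).1.isClassFunction) ?_
  rw [hch, ch_sum]
  exact sum_congr rfl fun Q _ => (irreducibleCharacter_spec Q).2.symm

end

section

open Finset

namespace StandardTableau

/-! ### First ascents and the removal of the largest entry -/

variable {n m : ℕ}

theorem firstAscentFrom_mem (Q : StandardTableau n) (hm : m ≤ n) :
    m ≤ Q.firstAscentFrom m ∧ Q.IsAscent (Q.firstAscentFrom m) :=
  Nat.sInf_mem (s := {k | m ≤ k ∧ Q.IsAscent k}) ⟨n, hm, Or.inl rfl⟩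

theorem firstAscentFrom_le (Q : StandardTableau n) {k : ℕ} (hm : m ≤ k) (h : Q.IsAscent k) :
    Q.firstAscentFrom m ≤ k :=
  Nat.sInf_le (s := {k | m ≤ k ∧ Q.IsAscent k}) ⟨hm, h⟩

theorem firstAscentFrom_le_size (Q : StandardTableau n) (hm : m ≤ n) : Q.firstAscentFrom m ≤ n :=
  Q.firstAscentFrom_le hm (Or.inl rfl)

theorem firstAscentFrom_self (Q : StandardTableau n) : Q.firstAscentFrom n = n :=
  le_antisymm (Q.firstAscentFrom_le_size le_rfl) (Q.firstAscentFrom_mem le_rfl).1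

theorem isAscent_iff_of_lt {Q : StandardTableau n} {k : ℕ} (hk : k < n) :
    Q.IsAscent k ↔ k ≠ 0 ∧ ∃ x y x' y', Q.entry x y = k ∧ Q.entry x' y' = k + 1 ∧ x' ≤ x := by
  rw [IsAscent, or_iff_right hk.ne]
  constructor
  · rintro ⟨x, y, x', y', hxy, -, hk, hk', hle⟩
    exact ⟨hk ▸ (Q.mem_shape_iff x y).1 hxy, x, y, x', y', hk, hk', hle⟩
  · rintro ⟨hk0, x, y, x', y', hk, hk', hle⟩
    exact ⟨x, y, x', y', Q.mem_shape_of_entry_eq hk hk0, Q.mem_shape_of_entry_eq hk' k.succ_ne_zero,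
      hk, hk', hle⟩

theorem addable_zero (r : ℕ → ℕ) : Addable r 0 := fun k hk => absurd hk k.succ_ne_zero

theorem addable_succ_iff {r : ℕ → ℕ} {i : ℕ} : Addable r (i + 1) ↔ r (i + 1) < r i := by
  simp [Addable]

theorem le_of_addable {μ : YoungDiagram} {i j : ℕ} (hi : Addable μ.rowLen i)
    (hj : μ.rowLen j = 0) : i ≤ j := by
  by_contra! hlt
  obtain ⟨k, rfl⟩ := Nat.exists_eq_add_one_of_ne_zero (Nat.ne_zero_of_lt hlt)
  have hk := (addable_succ_iff.1 hi).trans_le (μ.rowLen_anti j k (Nat.le_of_lt_succ hlt))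
  exact Nat.not_lt_zero _ (hk.trans_eq hj)

namespace IsExtension

variable {Q' : StandardTableau n} {i : ℕ} {Q : StandardTableau (n + 1)}

theorem isAscent_iff (hQ : IsExtension Q' i Q) {k : ℕ} (hk : k < n) :
    Q.IsAscent k ↔ Q'.IsAscent k := by
  rw [isAscent_iff_of_lt hk, isAscent_iff_of_lt (hk.trans n.lt_succ_self)]
  refine and_congr_right fun hk0 => exists_congr fun x => exists_congr fun y =>
    exists_congr fun x' => exists_congr fun y' => ?_
  rw [hQ.entry_eq_iff hk0 hk.le, hQ.entry_eq_iff k.succ_ne_zero hk]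

theorem isAscent_size_iff (hQ : IsExtension Q' i Q) {x y : ℕ} (hxy : (x, y) ∈ Q'.shape)
    (hentry : Q'.entry x y = n) : Q.IsAscent n ↔ i ≤ x := by
  have hn : n ≠ 0 := hentry ▸ (Q'.mem_shape_iff _ _).1 hxy
  have hentry' : Q.entry x y = n := (hQ.entry_eq_iff hn le_rfl).2 hentry
  rw [isAscent_iff_of_lt n.lt_succ_self]
  constructor
  · rintro ⟨-, a, b, a', b', hab, hab', hle⟩
    obtain ⟨rfl, -⟩ := hQ.entry_eq_succ_iff.1 hab'
    rwa [(Q.entry_injective (Q.mem_shape_of_entry_eq hab hn) (hab.trans hentry'.symm)).1] at hle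
  · exact fun hi => ⟨hn, x, y, i, _, hentry', hQ.entry_eq_succ_iff.2 ⟨rfl, rfl⟩, hi⟩

theorem firstAscentFrom_eq_of_lt (hQ : IsExtension Q' i Q) (hm : m ≤ n)
    (hlt : Q'.firstAscentFrom m < n) : Q.firstAscentFrom m = Q'.firstAscentFrom m := by
  obtain ⟨hle, hasc⟩ := Q.firstAscentFrom_mem (hm.trans n.le_succ)
  obtain ⟨hle', hasc'⟩ := Q'.firstAscentFrom_mem hm
  have hfirst := Q.firstAscentFrom_le hle' ((hQ.isAscent_iff hlt).2 hasc')
  exact hfirst.antisymm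
    (Q'.firstAscentFrom_le hle ((hQ.isAscent_iff (hfirst.trans_lt hlt)).1 hasc))

theorem firstAscentFrom_eq (hQ : IsExtension Q' i Q) (hm : m ≤ n) :
    Q.firstAscentFrom m = Q'.firstAscentFrom m ∨
      Q.firstAscentFrom m = n + 1 ∧ Q'.firstAscentFrom m = n := by
  obtain hlt | heq := (Q'.firstAscentFrom_le_size hm).lt_or_eq
  · exact Or.inl (hQ.firstAscentFrom_eq_of_lt hm hlt)
  obtain ⟨hle, hasc⟩ := Q.firstAscentFrom_mem (hm.trans n.le_succ)
  have hsize := Q.firstAscentFrom_le_size (hm.trans n.le_succ)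
  have hge : n ≤ Q.firstAscentFrom m := by
    by_contra! hlt
    exact (Q'.firstAscentFrom_le hle ((hQ.isAscent_iff hlt).1 hasc)).not_gt (hlt.trans_eq heq.symm)
  lia

theorem firstAscentFrom_eq_succ_iff_not_isAscent (hQ : IsExtension Q' i Q) (hm : m ≤ n)
    (hend : Q'.firstAscentFrom m = n) : Q.firstAscentFrom m = n + 1 ↔ ¬ Q.IsAscent n := by
  constructor
  · intro hsucc hasc
    exact n.not_succ_le_self (hsucc.symm.trans_le (Q.firstAscentFrom_le hm hasc))
  · intro hasc
    refine ((hQ.firstAscentFrom_eq hm).resolve_left fun heq => hasc ?_).1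
    have hfirst := (Q.firstAscentFrom_mem (hm.trans n.le_succ)).2
    rwa [heq, hend] at hfirst

theorem firstAscentFrom_eq_succ_iff (hQ : IsExtension Q' i Q) (hm : m ≤ n) {x y : ℕ}
    (hxy : (x, y) ∈ Q'.shape) (hentry : Q'.entry x y = n) (hlast : Q'.shape.rowLen (x + 1) = 0)
    (hend : Q'.firstAscentFrom m = n) : Q.firstAscentFrom m = n + 1 ↔ i = x + 1 := by
  rw [hQ.firstAscentFrom_eq_succ_iff_not_isAscent hm hend, hQ.isAscent_size_iff hxy hentry, not_le]
  exact ⟨fun hlt => (le_of_addable hQ.1 hlast).antisymm hlt, fun heq => heq ▸ x.lt_succ_self⟩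

end IsExtension

/-! ### Tableaux determined by their initial part and first ascent -/

/-- There is a unique tableau with property `P`. The lengths of its rows are given by `r`,
its last row is row `t` or empty, and contains the largest entry. -/
def UniqueTableau (P : StandardTableau n → Prop) (r : ℕ → ℕ) (t : ℕ) : Prop :=
  ∃ Q : StandardTableau n, (∀ R, P R ↔ R = Q) ∧ Q.shape.rowLen = r ∧ r (t + 1) = 0 ∧
    (0 < n → ∃ y, Q.entry t y = n)

theorem UniqueTableau.congr {P P' : StandardTableau n → Prop} {r : ℕ → ℕ} {t : ℕ}
    (h : UniqueTableau P r t) (hP : ∀ Q, P' Q ↔ P Q) : UniqueTableau P' r t := by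
  obtain ⟨Q, hQ, hshape⟩ := h
  exact ⟨Q, fun R => (hP R).trans (hQ R), hshape⟩

theorem uniqueTableau_zero : UniqueTableau (fun _ : StandardTableau 0 => True) (fun _ => 0) 0 :=
  ⟨default, fun R => iff_of_true trivial (Subsingleton.elim R default),
    funext fun i => rowLen_eq_zero _ i.zero_le, rfl, fun hpos => absurd hpos (lt_irrefl 0)⟩

theorem UniqueTableau.extend {P' : StandardTableau n → Prop} {r : ℕ → ℕ} {t : ℕ}
    (h : UniqueTableau P' r t) {P : StandardTableau (n + 1) → Prop} {x : ℕ}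
    (hx : Addable r x) (hx' : r (x + 1) = 0)
    (hrestrict : ∀ Q' i Q, IsExtension Q' i Q → P Q → P' Q')
    (hrow : ∀ Q' i Q, IsExtension Q' i Q → P' Q' → Q'.shape.rowLen = r →
      (0 < n → ∃ y, Q'.entry t y = n) → (P Q ↔ i = x)) :
    UniqueTableau P (Function.update r x (r x + 1)) x := by
  obtain ⟨Q', hQ', rfl, -, hn⟩ := h
  have hQ := Q'.isExtension_extend hx
  have hiff {i : ℕ} {Q} (hQ : IsExtension Q' i Q) : P Q ↔ i = x :=
    hrow _ _ _ hQ ((hQ' _).2 rfl) rfl hn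
  refine ⟨Q'.extend hx, fun R => ⟨fun hR => ?_, ?_⟩, hQ.rowLen_eq, ?_,
    fun _ => ⟨_, hQ.entry_eq_succ_iff.2 ⟨rfl, rfl⟩⟩⟩
  · have hext := R.isExtension_restrict
    rw [(hQ' _).1 (hrestrict _ _ _ hext hR)] at hext
    rw [(hiff hext).1 hR] at hext
    exact hext.eq_of_eq hQ
  · rintro rfl
    exact (hiff hQ).2 rfl
  · rw [Function.update_of_ne x.succ_ne_self, hx']

open Classical in
theorem UniqueTableau.sum_eq {P : StandardTableau n → Prop} {r : ℕ → ℕ} {t N : ℕ}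
    (h : UniqueTableau P r t) (hN : r N = 0) :
    ∑ Q : StandardTableau n, (if P Q then 1 else 0) * schur Q.shape = jtDet N r := by
  obtain ⟨Q, hQ, rfl, -⟩ := h
  rw [sum_eq_single_of_mem Q (mem_univ _), if_pos ((hQ Q).2 rfl), one_mul, schur_eq_jtDet hN]
  intro R _ hR
  rw [if_neg (hR ∘ (hQ R).1), zero_mul]

/-- A property of standard tableaux of all sizes that depends only on the entries `1, …, m`, for
tableaux of size at least `m`. -/
def IsInitial (m : ℕ) (B : ∀ n, StandardTableau n → Prop) : Prop :=
  ∀ n, m ≤ n → ∀ (Q' : StandardTableau n) i Q, IsExtension Q' i Q → (B (n + 1) Q ↔ B n Q')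

theorem UniqueTableau.extend_firstAscentFrom {B : ∀ n, StandardTableau n → Prop}
    (hB : IsInitial m B) (hm : m ≤ n) (hn : 0 < n) {r : ℕ → ℕ} {t : ℕ} (hr : 0 < r t)
    (ht : r (t + 2) = 0)
    (h : UniqueTableau (fun Q : StandardTableau n => B n Q ∧ Q.firstAscentFrom m = n) r t) :
    UniqueTableau (fun Q : StandardTableau (n + 1) => B (n + 1) Q ∧ Q.firstAscentFrom m = n + 1)
      (Function.update r (t + 1) 1) (t + 1) := by
  have hlast : r (t + 1) = 0 := h.choose_spec.2.2.1
  have hadd : Addable r (t + 1) := addable_succ_iff.2 (hlast.trans_lt hr)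
  have hext := h.extend (P := fun Q => B (n + 1) Q ∧ Q.firstAscentFrom m = n + 1) hadd ht
    ?restrict ?row
  case restrict =>
    rintro Q' i Q hQ ⟨hBQ, hasc⟩
    refine ⟨(hB n hm _ _ _ hQ).1 hBQ, ?_⟩
    obtain heq | ⟨-, hend⟩ := hQ.firstAscentFrom_eq hm
    · exact absurd (Q'.firstAscentFrom_le_size hm) (by lia)
    · exact hend
  case row =>
    rintro Q' i Q hQ ⟨hBQ', hasc⟩ hrow hentry
    obtain ⟨y, hy⟩ := hentry hn
    rw [hB n hm _ _ _ hQ, and_iff_right hBQ']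
    exact hQ.firstAscentFrom_eq_succ_iff hm (Q'.mem_shape_of_entry_eq hy hn.ne') hy
      (by rw [hrow, hlast]) hasc
  rwa [hlast] at hext

end StandardTableau

end

section

open Finset

namespace StandardTableau

/-! ### The tableaux whose first ascent is at the end -/

variable {n m : ℕ}

theorem UniqueTableau.extend_cell {P' : StandardTableau n → Prop} {r : ℕ → ℕ} {t : ℕ}
    (h : UniqueTableau P' r t) {P : StandardTableau (n + 1) → Prop} (x y : ℕ)
    (hx : Addable r x) (hx' : r (x + 1) = 0) (hy : r x = y)
    (hP : ∀ Q' i Q, IsExtension Q' i Q → (P Q ↔ P' Q' ∧ Q.entry x y = n + 1)) :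
    UniqueTableau P (Function.update r x (y + 1)) x := by
  subst hy
  refine h.extend hx hx' (fun Q' i Q hQ hPQ => ((hP _ _ _ hQ).1 hPQ).1) ?_
  rintro Q' i Q hQ hQ' rfl -
  rw [hP _ _ _ hQ, and_iff_right hQ', hQ.entry_eq_succ_iff]
  exact ⟨fun hlast => hlast.1.symm, fun hi => hi ▸ ⟨rfl, rfl⟩⟩

theorem update_hookRows_zero (a m : ℕ) :
    Function.update (hookRows a (m + 1)) 0 (a + 1) = hookRows (a + 1) (m + 1) := by
  funext i
  simp only [Function.update_apply, hookRows]
  lia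

theorem update_hookRows_last (a m : ℕ) :
    Function.update (hookRows a (m + 1)) (m + 1) 1 = hookRows a (m + 2) := by
  funext i
  simp only [Function.update_apply, hookRows]
  lia

theorem update_hookRows_two_one : Function.update (hookRows 2 2) 1 2 = twoTwoRows 0 := by
  funext i
  simp only [Function.update_apply, hookRows, twoTwoRows]
  lia

theorem update_twoTwoRows_last (m : ℕ) :
    Function.update (twoTwoRows m) (m + 2) 1 = twoTwoRows (m + 1) := by
  funext i
  simp only [Function.update_apply, twoTwoRows]
  lia

/-- The entries `1, 2` form the tableau `12`. -/
def StartsRowTwo (Q : StandardTableau n) : Prop := Q.entry 0 0 = 1 ∧ Q.entry 0 1 = 2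

/-- The entries `1, 2, 3` form the tableau `123`. -/
def StartsRowThree (Q : StandardTableau n) : Prop := Q.StartsRowTwo ∧ Q.entry 0 2 = 3

/-- The entries `1, 2, 3` form the tableau `12/3`. -/
def StartsHook (Q : StandardTableau n) : Prop := Q.StartsRowTwo ∧ Q.entry 1 0 = 3

/-- The entries `1, 2, 3, 4` form the tableau `123/4`. -/
def StartsThreeOne (Q : StandardTableau n) : Prop := Q.StartsRowThree ∧ Q.entry 1 0 = 4

/-- The entries `1, 2, 3, 4` form the tableau `12/34`. -/
def StartsTwoTwo (Q : StandardTableau n) : Prop := Q.StartsHook ∧ Q.entry 1 1 = 4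

/-- The entries `1, 2, 3, 4` form one of the tableaux `12/3/4` and `124/3`. -/
def StartsFree (Q : StandardTableau n) : Prop :=
  Q.StartsHook ∧ (Q.entry 2 0 = 4 ∨ Q.entry 0 2 = 4)

theorem isInitial_startsRowTwo : IsInitial 2 fun _ Q => Q.StartsRowTwo := fun _ hn _ _ _ hQ =>
  and_congr (hQ.entry_eq_iff one_ne_zero (Nat.one_le_of_lt hn)) (hQ.entry_eq_iff two_ne_zero hn)

theorem isInitial_startsRowThree : IsInitial 3 fun _ Q => Q.StartsRowThree := fun n hn _ _ _ hQ =>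
  and_congr (isInitial_startsRowTwo n (Nat.le_of_succ_le hn) _ _ _ hQ)
    (hQ.entry_eq_iff three_ne_zero hn)

theorem isInitial_startsHook : IsInitial 3 fun _ Q => Q.StartsHook := fun n hn _ _ _ hQ =>
  and_congr (isInitial_startsRowTwo n (Nat.le_of_succ_le hn) _ _ _ hQ)
    (hQ.entry_eq_iff three_ne_zero hn)

theorem isInitial_startsThreeOne : IsInitial 4 fun _ Q => Q.StartsThreeOne := fun n hn _ _ _ hQ =>
  and_congr (isInitial_startsRowThree n (Nat.le_of_succ_le hn) _ _ _ hQ)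
    (hQ.entry_eq_iff four_ne_zero hn)

theorem isInitial_startsTwoTwo : IsInitial 4 fun _ Q => Q.StartsTwoTwo := fun n hn _ _ _ hQ =>
  and_congr (isInitial_startsHook n (Nat.le_of_succ_le hn) _ _ _ hQ)
    (hQ.entry_eq_iff four_ne_zero hn)

theorem isInitial_startsFree : IsInitial 4 fun _ Q => Q.StartsFree := fun n hn _ _ _ hQ =>
  and_congr (isInitial_startsHook n (Nat.le_of_succ_le hn) _ _ _ hQ)
    (or_congr (hQ.entry_eq_iff four_ne_zero hn) (hQ.entry_eq_iff four_ne_zero hn))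

theorem uniqueTableau_one :
    UniqueTableau (fun Q : StandardTableau 1 => Q.entry 0 0 = 1) (hookRows 1 1) 0 := by
  have hrows : hookRows 1 1 = Function.update (fun _ => 0) 0 1 := by
    funext i
    simp only [Function.update_apply, hookRows]
    lia
  rw [hrows]
  exact uniqueTableau_zero.extend_cell 0 0 (addable_zero _) rfl rfl fun _ _ _ _ =>
    (and_iff_right trivial).symm

theorem uniqueTableau_startsRowTwo :
    UniqueTableau (fun Q : StandardTableau 2 => Q.StartsRowTwo) (hookRows 2 1) 0 := by
  rw [← update_hookRows_zero 1 0]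
  exact uniqueTableau_one.extend_cell 0 1 (addable_zero _) rfl rfl fun _ _ _ hQ =>
    and_congr (hQ.entry_eq_iff one_ne_zero le_rfl) Iff.rfl

theorem uniqueTableau_startsRowThree :
    UniqueTableau (fun Q : StandardTableau 3 => Q.StartsRowThree) (hookRows 3 1) 0 := by
  rw [← update_hookRows_zero 2 0]
  exact uniqueTableau_startsRowTwo.extend_cell 0 2 (addable_zero _) rfl rfl fun _ _ _ hQ =>
    and_congr (isInitial_startsRowTwo 2 le_rfl _ _ _ hQ) Iff.rfl

theorem uniqueTableau_startsHook :
    UniqueTableau (fun Q : StandardTableau 3 => Q.StartsHook) (hookRows 2 2) 1 := by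
  rw [← update_hookRows_last 2 0]
  exact uniqueTableau_startsRowTwo.extend_cell 1 0 (addable_succ_iff.2 two_pos) rfl rfl
    fun _ _ _ hQ => and_congr (isInitial_startsRowTwo 2 le_rfl _ _ _ hQ) Iff.rfl

theorem uniqueTableau_startsThreeOne :
    UniqueTableau (fun Q : StandardTableau 4 => Q.StartsThreeOne) (hookRows 3 2) 1 := by
  rw [← update_hookRows_last 3 0]
  exact uniqueTableau_startsRowThree.extend_cell 1 0 (addable_succ_iff.2 three_pos) rfl rfl
    fun _ _ _ hQ => and_congr (isInitial_startsRowThree 3 le_rfl _ _ _ hQ) Iff.rfl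

theorem uniqueTableau_startsTwoTwo :
    UniqueTableau (fun Q : StandardTableau 4 => Q.StartsTwoTwo) (twoTwoRows 0) 1 := by
  rw [← update_hookRows_two_one]
  exact uniqueTableau_startsHook.extend_cell 1 1 (addable_succ_iff.2 one_lt_two) rfl rfl
    fun _ _ _ hQ => and_congr (isInitial_startsHook 3 le_rfl _ _ _ hQ) Iff.rfl

theorem firstAscentFrom_zero_pos (Q : StandardTableau n) (hn : 0 < n) :
    0 < Q.firstAscentFrom 0 := by
  by_contra! hle
  have hasc := (Q.firstAscentFrom_mem n.zero_le).2
  rw [Nat.le_zero.1 hle, isAscent_iff_of_lt hn] at hasc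
  exact hasc.1 rfl

theorem firstAscentFrom_zero_of_size_one (Q : StandardTableau 1) : Q.firstAscentFrom 0 = 1 :=
  (Q.firstAscentFrom_le_size (Nat.zero_le 1)).antisymm (Q.firstAscentFrom_zero_pos one_pos)

theorem entry_of_size_one (Q : StandardTableau 1) : Q.entry 0 0 = 1 :=
  Q.isExtension_restrict.entry_eq_succ_iff.2
    ⟨(Nat.lt_one_iff.1 (mem_range.1 Q.lastRow_mem_range)).symm,
      (Q.restrict.rowLen_eq_zero (Nat.zero_le _)).symm⟩

theorem uniqueTableau_column (n : ℕ) :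
    UniqueTableau (fun Q : StandardTableau (n + 1) => True ∧ Q.firstAscentFrom 0 = n + 1)
      (hookRows 1 (n + 1)) n := by
  induction n with
  | zero =>
    refine uniqueTableau_one.congr fun Q => ?_
    simp [Q.firstAscentFrom_zero_of_size_one, Q.entry_of_size_one]
  | succ n ih =>
    rw [← update_hookRows_last 1 n]
    exact ih.extend_firstAscentFrom (B := fun _ _ => True) (fun _ _ _ _ _ _ => Iff.rfl)
      (Nat.zero_le _) n.succ_pos (by simp [hookRows]) (by simp [hookRows])

theorem uniqueTableau_threeOne (k : ℕ) :
    UniqueTableau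
      (fun Q : StandardTableau (k + 4) => Q.StartsThreeOne ∧ Q.firstAscentFrom 4 = k + 4)
      (hookRows 3 (k + 2)) (k + 1) := by
  induction k with
  | zero =>
    exact uniqueTableau_startsThreeOne.congr fun Q => and_iff_left Q.firstAscentFrom_self
  | succ k ih =>
    rw [← update_hookRows_last 3 (k + 1)]
    exact ih.extend_firstAscentFrom isInitial_startsThreeOne (Nat.le_add_left 4 k) (by lia)
      (by simp [hookRows]) (by simp [hookRows])

theorem uniqueTableau_twoTwo (k : ℕ) :
    UniqueTableau
      (fun Q : StandardTableau (k + 4) => Q.StartsTwoTwo ∧ Q.firstAscentFrom 4 = k + 4)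
      (twoTwoRows k) (k + 1) := by
  induction k with
  | zero =>
    exact uniqueTableau_startsTwoTwo.congr fun Q => and_iff_left Q.firstAscentFrom_self
  | succ k ih =>
    rw [← update_twoTwoRows_last k]
    exact ih.extend_firstAscentFrom isInitial_startsTwoTwo (Nat.le_add_left 4 k) (by lia)
      (by simp only [twoTwoRows]; lia) (by simp [twoTwoRows])

end StandardTableau

end

section

open Finset

namespace StandardTableau

/-! ### Whitney-generating tableaux of small and of large size -/

variable {n : ℕ}

theorem entry_ne_of_lt (Q : StandardTableau n) {v : ℕ} (hv : n < v) (x y : ℕ) :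
    Q.entry x y ≠ v :=
  ((Q.entry_le x y).trans_lt hv).ne

theorem isWhitneyGenerating_one (Q : StandardTableau 1) : ¬ Q.IsWhitneyGenerating := by
  simp [IsWhitneyGenerating, Q.entry_ne_of_lt one_lt_two]

theorem isWhitneyGenerating_two (Q : StandardTableau 2) :
    Q.IsWhitneyGenerating ↔ Q.StartsRowTwo := by
  simp [IsWhitneyGenerating, StartsRowTwo, Q.entry_ne_of_lt (Nat.lt_succ_self 2)]

theorem isWhitneyGenerating_three (Q : StandardTableau 3) :
    Q.IsWhitneyGenerating ↔ Q.StartsHook := by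
  simp [IsWhitneyGenerating, StartsHook, StartsRowTwo, Q.entry_ne_of_lt (Nat.lt_succ_self 3),
    and_assoc]

theorem isWhitneyGenerating_iff (Q : StandardTableau n) (hn : 4 ≤ n) :
    Q.IsWhitneyGenerating ↔ Q.StartsFree ∨ (Q.StartsTwoTwo ∧ Odd (Q.firstAscentFrom 4)) ∨
      (Q.StartsThreeOne ∧ Even (Q.firstAscentFrom 4)) := by
  have hn0 : n ≠ 0 := by lia
  have hn2 : n ≠ 2 := by lia
  have hn3 : n ≠ 3 := by lia
  simp only [IsWhitneyGenerating, StartsFree, StartsTwoTwo, StartsThreeOne, StartsHook,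
    StartsRowThree, StartsRowTwo, hn0, hn2, hn3, false_and, false_or]
  tauto

theorem not_startsHook_of_startsRowThree (Q : StandardTableau n) (h : Q.StartsRowThree) :
    ¬ Q.StartsHook := fun hhook => by
  have := Q.entry_injective (Q.mem_shape_of_entry_eq h.2 three_ne_zero) (h.2.trans hhook.2.symm)
  lia

theorem not_startsTwoTwo_of_startsFree (Q : StandardTableau n) (h : Q.StartsFree) :
    ¬ Q.StartsTwoTwo := fun htwo => by
  rcases h.2 with hfour | hfour
  all_goals
    have := Q.entry_injective (Q.mem_shape_of_entry_eq hfour four_ne_zero)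
      (hfour.trans htwo.2.symm)
    lia

theorem UniqueTableau.exists_entry_iff {P : StandardTableau n → Prop} {r : ℕ → ℕ} {t : ℕ}
    (h : UniqueTableau P r t) {Q : StandardTableau (n + 1)} (hQ : P Q.restrict) :
    ∃ i ≤ t + 1, ∀ x y, Q.entry x y = n + 1 ↔ x = i ∧ y = r i := by
  obtain ⟨R, hR, rfl, hlast, -⟩ := h
  have hext := Q.isExtension_restrict
  rw [(hR _).1 hQ] at hext
  exact ⟨Q.lastRow, le_of_addable hext.1 hlast, fun _ _ => hext.entry_eq_succ_iff⟩

theorem startsRowTwo_restrict_iff (Q : StandardTableau 3) :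
    Q.restrict.StartsRowTwo ↔ Q.StartsHook ∨ Q.StartsRowThree := by
  have hinitial : Q.StartsRowTwo ↔ Q.restrict.StartsRowTwo :=
    isInitial_startsRowTwo 2 le_rfl _ _ _ Q.isExtension_restrict
  rw [StartsHook, StartsRowThree, ← and_or_left, hinitial]
  refine (and_iff_left_of_imp fun h => ?_).symm
  obtain ⟨i, hi, hlast⟩ := uniqueTableau_startsRowTwo.exists_entry_iff h
  simp only [Nat.reduceAdd] at hlast
  rw [hlast, hlast]
  interval_cases i <;> simp [hookRows]

theorem startsHook_restrict_iff (Q : StandardTableau 4) :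
    Q.restrict.StartsHook ↔ Q.StartsFree ∨ Q.StartsTwoTwo := by
  have hinitial : Q.StartsHook ↔ Q.restrict.StartsHook :=
    isInitial_startsHook 3 le_rfl _ _ _ Q.isExtension_restrict
  rw [StartsFree, StartsTwoTwo, ← and_or_left, hinitial]
  refine (and_iff_left_of_imp fun h => ?_).symm
  obtain ⟨i, hi, hlast⟩ := uniqueTableau_startsHook.exists_entry_iff h
  simp only [Nat.reduceAdd] at hlast
  rw [hlast, hlast, hlast]
  interval_cases i <;> simp [hookRows]

/-! ### Recursions for the sums of Schur functions over the tableaux -/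

open Classical in
/-- The indicator function of a proposition, as a coefficient of Schur functions. -/
def indicator (p : Prop) : Series := if p then 1 else 0

theorem indicator_congr {p q : Prop} (h : p ↔ q) : indicator p = indicator q := by rw [h]

theorem indicator_pos {p : Prop} (h : p) : indicator p = 1 := if_pos h

theorem indicator_neg {p : Prop} (h : ¬ p) : indicator p = 0 := if_neg h

theorem indicator_or {p q : Prop} (h : p → ¬ q) :
    indicator (p ∨ q) = indicator p + indicator q := by
  by_cases hp : p
  · rw [indicator_pos hp, indicator_pos (Or.inl hp), indicator_neg (h hp), add_zero]
  · rw [indicator_neg hp, zero_add]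
    exact indicator_congr (or_iff_right hp)

theorem indicator_and (p q : Prop) : indicator (p ∧ q) = indicator p * indicator q := by
  by_cases hp : p
  · rw [indicator_pos hp, one_mul]
    exact indicator_congr (and_iff_right hp)
  · rw [indicator_neg hp, indicator_neg (hp ∘ And.left), zero_mul]

theorem indicator_not (p : Prop) : indicator (¬ p) = 1 - indicator p := by
  by_cases hp : p
  · rw [indicator_pos hp, indicator_neg (not_not_intro hp), sub_self]
  · rw [indicator_pos hp, indicator_neg hp, sub_zero]

theorem indicator_odd (n : ℕ) : indicator (Odd n) = 1 - indicator (Even n) := by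
  rw [← Nat.not_even_iff_odd, indicator_not]

theorem indicator_even_succ (n : ℕ) :
    indicator (Even (n + 1)) - indicator (Even n) = (-1) ^ (n + 1) := by
  rw [Nat.even_add_one, indicator_not]
  obtain h | h := n.even_or_odd
  · rw [indicator_pos h, h.add_one.neg_one_pow]
    ring
  · rw [indicator_neg (Nat.not_even_iff_odd.2 h), h.add_one.neg_one_pow]
    ring

theorem sum_toFinset_eq_sum_indicator {α : Type*} [Fintype α] (P : α → Prop) (f : α → Series) :
    ∑ a ∈ (Set.toFinite {a | P a}).toFinset, f a = ∑ a, indicator (P a) * f a := by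
  classical
  have hfilter : (Set.toFinite {a | P a}).toFinset = univ.filter P := by
    ext a
    simp
  rw [hfilter, sum_filter]
  simp only [indicator, ite_mul, one_mul, zero_mul]

theorem sum_indicator {P : StandardTableau n → Prop} {r : ℕ → ℕ} {t N : ℕ}
    (h : UniqueTableau P r t) (hN : r N = 0) :
    ∑ Q : StandardTableau n, indicator (P Q) * schur Q.shape = jtDet N r := h.sum_eq hN

theorem indicator_even_firstAscentFrom {m : ℕ} (hm : m ≤ n) (Q : StandardTableau (n + 1)) :
    indicator (Even (Q.firstAscentFrom m)) - indicator (Even (Q.restrict.firstAscentFrom m)) =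
      (-1) ^ (n + 1) * indicator (Q.firstAscentFrom m = n + 1) := by
  obtain heq | ⟨hsucc, hend⟩ := Q.isExtension_restrict.firstAscentFrom_eq hm
  · have hsize := Q.restrict.firstAscentFrom_le_size hm
    rw [heq, sub_self, indicator_neg (Nat.lt_succ_of_le hsize).ne, mul_zero]
  · rw [hend, hsucc, indicator_even_succ, indicator_pos rfl, mul_one]

theorem indicator_isWhitneyGenerating (Q : StandardTableau n) (hn : 4 ≤ n) :
    indicator Q.IsWhitneyGenerating =
      indicator Q.StartsFree + (indicator Q.StartsTwoTwo * indicator (Odd (Q.firstAscentFrom 4)) +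
        indicator Q.StartsThreeOne * indicator (Even (Q.firstAscentFrom 4))) := by
  rw [indicator_congr (Q.isWhitneyGenerating_iff hn), indicator_or, indicator_or, indicator_and,
    indicator_and]
  · exact fun htwo hthree => Q.not_startsHook_of_startsRowThree hthree.1.1 htwo.1.1
  · rintro hfree (htwo | hthree)
    · exact Q.not_startsTwoTwo_of_startsFree hfree htwo.1
    · exact Q.not_startsHook_of_startsRowThree hthree.1.1 hfree.1

theorem indicator_isWhitneyGenerating_sub_of_size_four (Q : StandardTableau 4) :
    indicator Q.IsWhitneyGenerating - indicator Q.restrict.IsWhitneyGenerating =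
      indicator Q.StartsThreeOne - indicator Q.StartsTwoTwo := by
  rw [Q.indicator_isWhitneyGenerating le_rfl, indicator_congr (isWhitneyGenerating_three _),
    indicator_congr Q.startsHook_restrict_iff, indicator_or Q.not_startsTwoTwo_of_startsFree,
    Q.firstAscentFrom_self, indicator_odd, indicator_pos (p := Even 4) (by decide)]
  ring

theorem indicator_isWhitneyGenerating_sub (hn : 3 ≤ n) (Q : StandardTableau (n + 1)) :
    indicator Q.IsWhitneyGenerating - indicator Q.restrict.IsWhitneyGenerating =
      (-1) ^ (n + 1) * (indicator (Q.StartsThreeOne ∧ Q.firstAscentFrom 4 = n + 1) -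
        indicator (Q.StartsTwoTwo ∧ Q.firstAscentFrom 4 = n + 1)) := by
  obtain rfl | hn := hn.eq_or_lt
  · rw [indicator_isWhitneyGenerating_sub_of_size_four, Q.firstAscentFrom_self, indicator_and,
      indicator_and, indicator_pos (p := 3 + 1 = 3 + 1) rfl]
    ring
  · have hQ := Q.isExtension_restrict
    rw [Q.indicator_isWhitneyGenerating (Nat.le_succ_of_le hn),
      Q.restrict.indicator_isWhitneyGenerating hn, indicator_and, indicator_and,
      indicator_congr (isInitial_startsFree n hn _ _ _ hQ),
      indicator_congr (isInitial_startsTwoTwo n hn _ _ _ hQ),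
      indicator_congr (isInitial_startsThreeOne n hn _ _ _ hQ), indicator_odd, indicator_odd]
    linear_combination (indicator Q.restrict.StartsThreeOne - indicator Q.restrict.StartsTwoTwo) *
      indicator_even_firstAscentFrom hn Q

/-- The sum of the Schur functions of the shapes of the desarrangement tableaux of size `n`. -/
def desarrangementSum (n : ℕ) : Series := ∑ Q ∈ desarrangementTableaux n, schur Q.shape

/-- The sum of the Schur functions of the shapes of the Whitney-generating tableaux of size `n`. -/
def whitneySum (n : ℕ) : Series := ∑ Q ∈ whitneyGeneratingTableaux n, schur Q.shape

theorem desarrangementSum_eq (n : ℕ) : desarrangementSum n =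
    ∑ Q : StandardTableau n, indicator (Even (Q.firstAscentFrom 0)) * schur Q.shape :=
  sum_toFinset_eq_sum_indicator _ _

theorem whitneySum_eq (n : ℕ) : whitneySum n =
    ∑ Q : StandardTableau n, indicator Q.IsWhitneyGenerating * schur Q.shape :=
  sum_toFinset_eq_sum_indicator _ _

theorem desarrangementSum_zero : desarrangementSum 0 = 1 := by
  rw [desarrangementSum_eq, Fintype.sum_unique, firstAscentFrom_self, indicator_pos Even.zero,
    one_mul, schur_shape _ le_rfl]
  exact Matrix.det_isEmpty

theorem desarrangementSum_succ (n : ℕ) : desarrangementSum (n + 1) =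
    hsymm 1 * desarrangementSum n + (-1) ^ (n + 1) * colSchur (n + 1) := by
  rw [desarrangementSum_eq, desarrangementSum_eq, ← sum_restrict_mul_schur, colSchur,
    ← sum_indicator (uniqueTableau_column n) (by simp [hookRows]), mul_sum, ← sum_add_distrib]
  refine sum_congr rfl fun Q _ => ?_
  rw [indicator_congr (iff_of_eq (true_and _))]
  linear_combination schur Q.shape * indicator_even_firstAscentFrom (Nat.zero_le n) Q

theorem whitneySum_zero : whitneySum 0 = 1 := by
  rw [whitneySum_eq, Fintype.sum_unique,
    indicator_pos (p := IsWhitneyGenerating default) (Or.inl rfl), one_mul, schur_shape _ le_rfl]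
  exact Matrix.det_isEmpty

theorem whitneySum_one : whitneySum 1 = 0 := by
  rw [whitneySum_eq]
  exact sum_eq_zero fun Q _ => by rw [indicator_neg Q.isWhitneyGenerating_one, zero_mul]

theorem whitneySum_two : whitneySum 2 = hsymm 2 := by
  rw [whitneySum_eq]
  simp_rw [indicator_congr (isWhitneyGenerating_two _)]
  rw [sum_indicator (N := 1) uniqueTableau_startsRowTwo (by simp [hookRows]),
    jtDet_hookRows_one, Nat.cast_ofNat]

theorem whitneySum_three : whitneySum 3 = hsymm 1 * whitneySum 2 - hsymm 3 := by
  have hthree : hsymm 3 = jtDet 1 (hookRows 3 1) := (jtDet_hookRows_one 3).symm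
  rw [whitneySum_eq, whitneySum_eq, ← sum_restrict_mul_schur, hthree,
    ← sum_indicator uniqueTableau_startsRowThree (by simp [hookRows]), ← sum_sub_distrib]
  refine sum_congr rfl fun Q _ => ?_
  rw [indicator_congr (isWhitneyGenerating_three _), indicator_congr (isWhitneyGenerating_two _),
    indicator_congr Q.startsRowTwo_restrict_iff,
    indicator_or fun hhook hrow => Q.not_startsHook_of_startsRowThree hrow hhook]
  ring

theorem whitneySum_add_four (k : ℕ) : whitneySum (k + 4) = hsymm 1 * whitneySum (k + 3) +
    (-1) ^ (k + 4) * (jtDet (k + 2) (hookRows 3 (k + 2)) - jtDet (k + 2) (twoTwoRows k)) := by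
  rw [whitneySum_eq, whitneySum_eq, ← sum_restrict_mul_schur,
    ← sum_indicator (uniqueTableau_threeOne k) (by simp [hookRows]),
    ← sum_indicator (uniqueTableau_twoTwo k) (by simp [twoTwoRows]), ← sum_sub_distrib, mul_sum,
    ← sum_add_distrib]
  refine sum_congr rfl fun Q _ => ?_
  linear_combination schur Q.shape * indicator_isWhitneyGenerating_sub (Nat.le_add_left 3 k) Q

theorem whitneySum_add_two (n : ℕ) : whitneySum (n + 2) =
    hsymm 1 * whitneySum (n + 1) + (-1) ^ n * (colSchur (n + 2) + psum 2 * colSchur n) := by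
  obtain _ | _ | k := n
  · have htwo : colSchur 2 = hsymm 1 * colSchur 1 - jtDet 1 (hookRows 2 1) :=
      jtDet_hookRows_succ 1 0
    rw [jtDet_hookRows_one, colSchur_one, Nat.cast_ofNat] at htwo
    rw [whitneySum_two, whitneySum_one, colSchur_zero, htwo, psum_two]
    ring
  · have hthree := colSchur_add_psum_two 0
    simp only [zero_add, sub_zero, jtDet_hookRows_one, Nat.cast_ofNat] at hthree
    rw [whitneySum_three]
    linear_combination hthree
  · have hcol := colSchur_add_psum_two (k + 1)
    dsimp only at hcol
    rw [whitneySum_add_four]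
    linear_combination -(-1) ^ (k + 4) * hcol

end StandardTableau

/-! ### Comparison of generating functions -/

section Geometric

variable {R : Type*} [CommRing R] (p : R) (a : ℕ → R)

theorem coeff_zero_one_sub_mul_mk :
    PowerSeries.coeff 0 ((1 - PowerSeries.C p * PowerSeries.X) * PowerSeries.mk a) = a 0 := by
  simp

theorem coeff_succ_one_sub_mul_mk (n : ℕ) :
    PowerSeries.coeff (n + 1) ((1 - PowerSeries.C p * PowerSeries.X) * PowerSeries.mk a) =
      a (n + 1) - p * a n := by
  rw [sub_mul, one_mul, map_sub, mul_assoc, PowerSeries.coeff_C_mul, PowerSeries.coeff_succ_X_mul,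
    PowerSeries.coeff_mk, PowerSeries.coeff_mk]

end Geometric

open StandardTableau

theorem one_sub_mul_desarrangementSum :
    (1 - PowerSeries.C (psum 1) * PowerSeries.X) * PowerSeries.mk desarrangementSum =
      colSeries := by
  ext1 n
  rw [colSeries, PowerSeries.coeff_mk]
  obtain _ | n := n
  · rw [coeff_zero_one_sub_mul_mk, desarrangementSum_zero, colSchur_zero, pow_zero, mul_one]
  · rw [coeff_succ_one_sub_mul_mk, desarrangementSum_succ, hsymm_one, add_sub_cancel_left]

theorem one_sub_mul_whitneySum :
    (1 - PowerSeries.C (psum 1) * PowerSeries.X) * PowerSeries.mk whitneySum =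
      (1 + PowerSeries.C (psum 2) * PowerSeries.X ^ 2) * colSeries := by
  ext1 n
  rw [add_mul, one_mul, map_add, mul_assoc, PowerSeries.coeff_C_mul,
    PowerSeries.coeff_X_pow_mul', colSeries]
  obtain _ | _ | n := n
  · rw [coeff_zero_one_sub_mul_mk, whitneySum_zero, PowerSeries.coeff_mk, colSchur_zero,
      if_neg (by lia)]
    ring
  · rw [coeff_succ_one_sub_mul_mk, whitneySum_one, whitneySum_zero, PowerSeries.coeff_mk,
      colSchur_one, hsymm_one, if_neg (by lia)]
    ring
  · rw [coeff_succ_one_sub_mul_mk, whitneySum_add_two, hsymm_one, PowerSeries.coeff_mk,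
      if_pos (by lia), PowerSeries.coeff_mk, show n + 1 + 1 - 2 = n from rfl]
    ring

theorem eq_of_hsymm_mul_eq {L D F : PowerSeries Series}
    (hL : (PowerSeries.mk fun m => hsymm (m : ℕ)) * L = F * PowerSeries.mk fun r => psum 1 ^ r)
    (hD : (1 - PowerSeries.C (psum 1) * PowerSeries.X) * D = F * colSeries) : L = D :=
  calc L = colSeries * ((PowerSeries.mk fun m => hsymm (m : ℕ)) * L) := by
        rw [← mul_assoc, colSeries_mul_hsymm, one_mul]
    _ = (F * colSeries) * PowerSeries.mk fun r => psum 1 ^ r := by rw [hL]; ring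
    _ = D * ((PowerSeries.mk fun r => psum 1 ^ r) *
        (1 - PowerSeries.C (psum 1) * PowerSeries.X)) := by rw [← hD]; ring
    _ = D := by rw [mk_pow_mul_one_sub, mul_one]

theorem lieHatSeries_eq_mk_desarrangementSum :
    lieHatSeries = PowerSeries.mk desarrangementSum :=
  eq_of_hsymm_mul_eq (F := 1) (by rw [hsymm_mul_lieHatSeries, one_mul])
    (by rw [one_sub_mul_desarrangementSum, one_mul])

theorem whitneyHatSeries_eq_mk_whitneySum : whitneyHatSeries = PowerSeries.mk whitneySum :=
  eq_of_hsymm_mul_eq hsymm_mul_whitneyHatSeries one_sub_mul_whitneySum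

theorem ch_lieHat (n : ℕ) : ch n (lieHat n) = ∑ Q ∈ desarrangementTableaux n, schur Q.shape := by
  have hcoeff := congrArg (PowerSeries.coeff n) lieHatSeries_eq_mk_desarrangementSum
  rwa [lieHatSeries, PowerSeries.coeff_mk, PowerSeries.coeff_mk] at hcoeff

theorem ch_whitneyHat (n : ℕ) :
    ch n (whitneyHat n) = ∑ Q ∈ whitneyGeneratingTableaux n, schur Q.shape := by
  have hcoeff := congrArg (PowerSeries.coeff n) whitneyHatSeries_eq_mk_whitneySum
  rwa [whitneyHatSeries, PowerSeries.coeff_mk, PowerSeries.coeff_mk] at hcoeff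

end

end WhitneyTableaux

end

theorem theorem1p3 (n : ℕ) :
    WhitneyTableaux.lieHat n =
        ∑ Q ∈ WhitneyTableaux.desarrangementTableaux n,
          WhitneyTableaux.irreducibleCharacter n Q.shape ∧
      WhitneyTableaux.whitneyHat n =
        ∑ Q ∈ WhitneyTableaux.whitneyGeneratingTableaux n,
          WhitneyTableaux.irreducibleCharacter n Q.shape :=
  ⟨WhitneyTableaux.eq_sum_irreducibleCharacter (WhitneyTableaux.isClassFunction_lieHat n) _
      (WhitneyTableaux.ch_lieHat n),
    WhitneyTableaux.eq_sum_irreducibleCharacter (WhitneyTableaux.isClassFunction_whitneyHat n) _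
      (WhitneyTableaux.ch_whitneyHat n)⟩
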